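/- Let $Z\subset\mathbb{P}^2_{\mathbb{Q}}$ be the line $z_0+z_1+z_2=0$, let $P_i\in Z$ be the point $z_i=0$ ($i=0,1,2$), let $D_\epsilon=\tfrac12P_0+\tfrac12P_1+\tfrac12P_2$, and let $Z^\circ=Z\setminus\{P_0,P_1,P_2\}$. Let $$\mathrm{Br}(Z,D_\epsilon)=\{\beta\in\mathrm{Br}\,Z^\circ : 2\,\mathrm{res}_{P_i}(\beta)=0 \text{ in } \mathrm{H}^1(\mathbb{Q},\mathbb{Q}/\mathbb{Z}) \text{ for } i=0,1,2\}$$ be the Campana Brauer group, where $\mathrm{res}_{P_i}:\mathrm{Br}\,Z^\circ\to\mathrm{H}^1(\mathbb{Q},\mathbb{Q}/\mathbb{Z})$ is the residue map at the rational point $P_i$. It is a subgroup of $\mathrm{Br}\,Z^\circ$ that contains the image of $\mathrm{Br}\,\mathbb{Q}$; write $\mathrm{Br}(Z,D_\epsilon)/\mathrm{Br}\,\mathbb{Q}$ for the quotient by this image. Write $(a,b)$ for the class of the quaternion algebra generated by $i,j$ with $i^2=a$, $j^2=b$, $ij=-ji$. Then the map $$\{(d_0,d_1,d_2)\in\mathbb{Z}^3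 : d_0d_1d_2 \text{ is squarefree and positive}\}\to \mathrm{Br}(Z,D_\epsilon)/\mathrm{Br}\,\mathbb{Q},$$ $$(d_0,d_1,d_2)\mapsto (d_0,z_1/z_2)+(d_1,z_0/z_2)+(d_2,z_0/z_1),$$ is well defined and bijective. Moreover, there is an isomorphism of groups $\mathrm{Br}(Z,D_\epsilon)/\mathrm{Br}\,\mathbb{Q}\cong\mathrm{H}^1(\mathbb{Q},\mathbb{Z}/2\mathbb{Z}\times\mathbb{Z}/2\mathbb{Z})$, where the Galois action on the coefficients is trivial. -/

import Mathlib

open scoped TensorProduct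
namespace CampanaBrauer
universe u
open MulOpposite

section Preliminaries

variable {R : Type*} [CommRing R]

theorem exists_dual_eq_one (P : Type*) [AddCommGroup P] [Module R P] [Module.Finite R P]
    [Module.Projective R P] [FaithfulSMul R P] :
    ∃ x : Module.Dual R P ⊗[R] P, contractLeft R P x = 1 := by
  obtain ⟨t, ht⟩ := (dualTensorHomEquiv R P P).surjective LinearMap.id
  have key : ∀ (x : Module.Dual R P ⊗[R] P) (p : P),
      dualTensorHom R P P x p ∈ (LinearMap.range (contractLeft R P)) • (⊤ : Submodule R P) := by
    intro x p
    induction x with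
    | zero => simp
    | add x y hx hy => simpa using add_mem hx hy
    | tmul f q =>
      rw [dualTensorHom_apply]
      exact Submodule.smul_mem_smul ⟨f ⊗ₜ p, by simp⟩ trivial
  obtain ⟨r, hr, hr'⟩ := Submodule.exists_sub_one_mem_and_smul_eq_zero_of_fg_of_le_smul
    (LinearMap.range (contractLeft R P)) (⊤ : Submodule R P) Module.Finite.fg_top (by
      intro p _
      have h2 : dualTensorHom R P P t p = p := by
        have : dualTensorHom R P P t = LinearMap.id := ht
        rw [this]; rfl
      rw [← h2]
      exact key t p)
  have h0 : r = 0 := by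
    apply FaithfulSMul.eq_of_smul_eq_smul (M := R) (α := P)
    intro p
    rw [hr' p trivial, zero_smul]
  obtain ⟨x, hx⟩ := hr
  exact ⟨(-1 : R) • x, by rw [map_smul, hx, h0]; simp⟩

theorem faithful_baseChange (S : Type*) [CommRing S] [Algebra R S] (P : Type*) [AddCommGroup P]
    [Module R P] [Module.Finite R P] [Module.Projective R P] [FaithfulSMul R P] :
    FaithfulSMul S (S ⊗[R] P) := by
  obtain ⟨x, hx⟩ := exists_dual_eq_one (R := R) P
  have key : ∀ s : S, (∀ p : S ⊗[R] P, s • p = 0) → ∀ y : Module.Dual R P ⊗[R] P,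
      s * algebraMap R S (contractLeft R P y) = 0 := by
    intro s hs y
    induction y with
    | zero => simp
    | add x y hx hy => simp [mul_add, hx, hy]
    | tmul f q =>
      have h1 := congrArg ((TensorProduct.rid R S).toLinearMap ∘ₗ LinearMap.lTensor S f) (hs (1 ⊗ₜ q))
      simpa [TensorProduct.smul_tmul', Algebra.smul_def, mul_comm] using h1
  constructor
  intro s s' h
  have := key (s - s') (fun p => by
    have e : (s - s') • p + s' • p = s' • p := by rw [← add_smul, sub_add_cancel, h p]
    simpa using e) x
  rw [hx, map_one, mul_one] at this
  exact sub_eq_zero.mp this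

theorem faithful_tensor (P Q : Type*) [AddCommGroup P] [Module R P] [Module.Finite R P]
    [Module.Projective R P] [FaithfulSMul R P] [AddCommGroup Q] [Module R Q] [FaithfulSMul R Q] :
    FaithfulSMul R (P ⊗[R] Q) := by
  obtain ⟨x, hx⟩ := exists_dual_eq_one (R := R) P
  have key : ∀ s : R, (∀ p : P ⊗[R] Q, s • p = 0) → ∀ y : Module.Dual R P ⊗[R] P,
      ∀ q : Q, s • (contractLeft R P y) • q = 0 := by
    intro s hs y q
    induction y with
    | zero => simp
    | add x y hx hy => simp [add_smul, hx, hy]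
    | tmul f p =>
      have h1 := congrArg ((TensorProduct.lid R Q).toLinearMap ∘ₗ LinearMap.rTensor Q f) (hs (p ⊗ₜ q))
      simpa using h1
  constructor
  intro s s' h
  apply FaithfulSMul.eq_of_smul_eq_smul (M := R) (α := Q)
  intro q
  have := key (s - s') (fun p => by
    have e : (s - s') • p + s' • p = s' • p := by rw [← add_smul, sub_add_cancel, h p]
    simpa using e) x q
  rw [hx, one_smul, sub_smul] at this
  exact sub_eq_zero.mp this

/-- `End P ⊗ End Q ≃ End (P ⊗ Q)` for finitely generated projective modules. -/
noncomputable def endTensorEnd (P Q : Type*) [AddCommGroup P] [Module R P] [Module.Finite R P]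
    [Module.Projective R P] [AddCommGroup Q] [Module R Q] [Module.Finite R Q]
    [Module.Projective R Q] :
    Module.End R P ⊗[R] Module.End R Q ≃ₐ[R] Module.End R (P ⊗[R] Q) :=
  AlgEquiv.ofBijective (Module.endTensorEndAlgHom (R := R) (S := R) (A := R) (M := P) (N := Q)) (by
    have h := (homTensorHomEquiv R P Q P Q).bijective
    have e : (homTensorHomEquiv R P Q P Q).toLinearMap =
      (Module.endTensorEndAlgHom (R := R) (S := R) (A := R) (M := P) (N := Q)).toLinearMap := by
      rw [homTensorHomEquiv_toLinearMap]
      ext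
      rfl
    have e' : ⇑(homTensorHomEquiv R P Q P Q) =
      ⇑(Module.endTensorEndAlgHom (R := R) (S := R) (A := R) (M := P) (N := Q)) := by
      funext x; exact congrArg (fun f => f x) e
    rwa [e'] at h)

/-- `S ⊗ End P ≃ End (S ⊗ P)` for a finitely generated projective module `P`. -/
noncomputable def baseChangeEnd (S : Type*) [CommRing S] [Algebra R S] (P : Type*) [AddCommGroup P]
    [Module R P] [Module.Finite R P] [Module.Projective R P] :
    S ⊗[R] Module.End R P ≃ₐ[S] Module.End S (S ⊗[R] P) :=
  AlgEquiv.ofBijective (LinearMap.tensorProductEnd R S P) (by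
    have h := ((lTensorHomEquivHomLTensor R P S P).toEquiv.trans
      (LinearMap.liftBaseChangeEquiv (R := R) (M := P) (N := S ⊗[R] P) S).toEquiv).bijective
    convert h using 1
    funext x
    simp only [Equiv.coe_trans, LinearEquiv.coe_toEquiv, Function.comp_apply,
      lTensorHomEquivHomLTensor_apply]
    induction x with
    | zero => simp
    | add x y hx hy => simp only [map_add, hx, hy]
    | tmul s f =>
      apply TensorProduct.AlgebraTensorModule.ext
      intro a p
      simp [LinearMap.tensorProductEnd, LinearMap.tensorProduct, TensorProduct.smul_tmul', mul_comm])

/-- `(S ⊗ A) ⊗ (S ⊗ B) ≃ S ⊗ (A ⊗ B)`. -/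
noncomputable def baseChangeTensor (S : Type*) [CommRing S] [Algebra R S] (A B : Type*) [Ring A]
    [Algebra R A] [Ring B] [Algebra R B] :
    (S ⊗[R] A) ⊗[S] (S ⊗[R] B) ≃ₐ[S] S ⊗[R] (A ⊗[R] B) :=
  (Algebra.TensorProduct.tensorTensorTensorComm R R S S S A S B).trans
    (Algebra.TensorProduct.congr (Algebra.TensorProduct.lid S S) AlgEquiv.refl)

theorem isAzumaya_tensor (A B : Type*) [Ring A] [Algebra R A] [Ring B] [Algebra R B]
    [IsAzumaya R A] [IsAzumaya R B] : IsAzumaya R (A ⊗[R] B) where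
  toFaithfulSMul := faithful_tensor A B
  bij := by
    let e : (A ⊗[R] Aᵐᵒᵖ) ⊗[R] (B ⊗[R] Bᵐᵒᵖ) ≃ₐ[R] (A ⊗[R] B) ⊗[R] (A ⊗[R] B)ᵐᵒᵖ :=
      (Algebra.TensorProduct.tensorTensorTensorComm R R R R A Aᵐᵒᵖ B Bᵐᵒᵖ).trans
        (Algebra.TensorProduct.congr AlgEquiv.refl (Algebra.TensorProduct.opAlgEquiv R R A B))
    let f := (Algebra.TensorProduct.congr
      (AlgEquiv.ofBijective (AlgHom.mulLeftRight R A) IsAzumaya.bij)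
      (AlgEquiv.ofBijective (AlgHom.mulLeftRight R B) IsAzumaya.bij)).trans (endTensorEnd A B)
    have h : (AlgHom.mulLeftRight R (A ⊗[R] B)).comp e.toAlgHom = f.toAlgHom := by
      have he : ∀ a a' b b', e ((a ⊗ₜ a') ⊗ₜ (b ⊗ₜ b')) = (a ⊗ₜ b) ⊗ₜ op (unop a' ⊗ₜ unop b') :=
        fun _ _ _ _ => rfl
      ext x a b <;> simp [Algebra.TensorProduct.one_def, he, f, endTensorEnd,
        Module.endTensorEndAlgHom_apply]
    have h' : ⇑(AlgHom.mulLeftRight R (A ⊗[R] B)) = f ∘ e.symm := by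
      funext x
      obtain ⟨y, rfl⟩ := e.surjective x
      simpa using congrArg (fun g => g y) h
    rw [h']
    exact f.bijective.comp e.symm.bijective

theorem isAzumaya_op (A : Type*) [Ring A] [Algebra R A] [IsAzumaya R A] :
    IsAzumaya R Aᵐᵒᵖ where
  toProjective := Module.Projective.of_equiv (opLinearEquiv R : A ≃ₗ[R] Aᵐᵒᵖ)
  toFinite := Module.Finite.equiv (opLinearEquiv R : A ≃ₗ[R] Aᵐᵒᵖ)
  toFaithfulSMul := ⟨fun {r s} h => FaithfulSMul.eq_of_smul_eq_smul (M := R) (α := A) fun a => by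
    simpa using congrArg unop (h (op a))⟩
  bij := by
    let e : A ⊗[R] Aᵐᵒᵖ ≃ₐ[R] Aᵐᵒᵖ ⊗[R] Aᵐᵒᵖᵐᵒᵖ :=
      (Algebra.TensorProduct.comm R A Aᵐᵒᵖ).trans
        (Algebra.TensorProduct.congr AlgEquiv.refl (AlgEquiv.opOp R A))
    let f := (AlgEquiv.ofBijective (AlgHom.mulLeftRight R A) IsAzumaya.bij).trans
      ((opLinearEquiv R : A ≃ₗ[R] Aᵐᵒᵖ).conjAlgEquiv R)
    have h : (AlgHom.mulLeftRight R Aᵐᵒᵖ).comp e.toAlgHom = f.toAlgHom := by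
      ext x a <;> simp [e, f]
    have h' : ⇑(AlgHom.mulLeftRight R Aᵐᵒᵖ) = f ∘ e.symm := by
      funext x
      obtain ⟨y, rfl⟩ := e.surjective x
      simpa using congrArg (fun g => g y) h
    rw [h']
    exact f.bijective.comp e.symm.bijective

theorem isAzumaya_baseChange (S : Type*) [CommRing S] [Algebra R S] (A : Type*) [Ring A]
    [Algebra R A] [IsAzumaya R A] : IsAzumaya S (S ⊗[R] A) where
  toFaithfulSMul := faithful_baseChange S A
  bij := by
    let e : S ⊗[R] (A ⊗[R] Aᵐᵒᵖ) ≃ₐ[S] (S ⊗[R] A) ⊗[S] (S ⊗[R] A)ᵐᵒᵖ :=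
      (baseChangeTensor (R := R) S A Aᵐᵒᵖ).symm.trans (Algebra.TensorProduct.congr AlgEquiv.refl
        ((Algebra.TensorProduct.congr (AlgEquiv.toOpposite S S) AlgEquiv.refl).trans
          (Algebra.TensorProduct.opAlgEquiv R S S A)))
    let f := (Algebra.TensorProduct.congr (AlgEquiv.refl : S ≃ₐ[S] S)
      (AlgEquiv.ofBijective (AlgHom.mulLeftRight R A) IsAzumaya.bij)).trans (baseChangeEnd S A)
    have h : (AlgHom.mulLeftRight S (S ⊗[R] A)).comp e.toAlgHom = f.toAlgHom := by
      have he : ∀ s a b, e (s ⊗ₜ (a ⊗ₜ b)) = (1 ⊗ₜ a) ⊗ₜ op (s ⊗ₜ unop b) :=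
        fun _ _ _ => rfl
      ext x a <;> simp [he, f, baseChangeEnd, LinearMap.tensorProductEnd, LinearMap.tensorProduct]
    have h' : ⇑(AlgHom.mulLeftRight S (S ⊗[R] A)) = f ∘ e.symm := by
      funext x
      obtain ⟨y, rfl⟩ := e.surjective x
      simpa using congrArg (fun g => g y) h
    rw [h']
    exact f.bijective.comp e.symm.bijective

end Preliminaries

section BrauerGroup

/-- An Azumaya algebra over the commutative ring `R`. -/
structure AzumayaAlg (R : Type u) [CommRing R] where
  carrier : Type u
  [ring : Ring carrier]
  [algebra : Algebra R carrier]
  [isAzumaya : IsAzumaya R carrier]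

attribute [instance] AzumayaAlg.ring AzumayaAlg.algebra AzumayaAlg.isAzumaya

/-- A finitely generated projective faithful `R`-module. -/
structure FaithfulProjective (R : Type u) [CommRing R] where
  carrier : Type u
  [addCommGroup : AddCommGroup carrier]
  [module : Module R carrier]
  [finite : Module.Finite R carrier]
  [projective : Module.Projective R carrier]
  [faithful : FaithfulSMul R carrier]

attribute [instance] FaithfulProjective.addCommGroup FaithfulProjective.module
  FaithfulProjective.finite FaithfulProjective.projective FaithfulProjective.faithful

variable {R : Type u} [CommRing R]

namespace FaithfulProjective

/-- The tensor product of two faithful projective modules. -/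
noncomputable def tensor (P Q : FaithfulProjective R) : FaithfulProjective R :=
  have : FaithfulSMul R (P.carrier ⊗[R] Q.carrier) := faithful_tensor P.carrier Q.carrier
  ⟨P.carrier ⊗[R] Q.carrier⟩

/-- The base change of a faithful projective module. -/
noncomputable def baseChange (S : Type u) [CommRing S] [Algebra R S] (P : FaithfulProjective R) :
    FaithfulProjective S :=
  have : FaithfulSMul S (S ⊗[R] P.carrier) := faithful_baseChange S P.carrier
  ⟨S ⊗[R] P.carrier⟩

/-- The free module of rank one. -/
def one (R : Type u) [CommRing R] : FaithfulProjective R := ⟨R⟩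

end FaithfulProjective

namespace AzumayaAlg

/-- The tensor product of two Azumaya algebras. -/
noncomputable def tensor (A B : AzumayaAlg R) : AzumayaAlg R :=
  have := isAzumaya_tensor (R := R) A.carrier B.carrier
  ⟨A.carrier ⊗[R] B.carrier⟩

/-- The opposite of an Azumaya algebra. -/
def op (A : AzumayaAlg R) : AzumayaAlg R :=
  have := isAzumaya_op (R := R) A.carrier
  ⟨A.carrierᵐᵒᵖ⟩

/-- The base change `S ⊗ A` of an Azumaya algebra. -/
noncomputable def baseChange (S : Type u) [CommRing S] [Algebra R S] (A : AzumayaAlg R) :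
    AzumayaAlg S :=
  have := isAzumaya_baseChange (R := R) S A.carrier
  ⟨S ⊗[R] A.carrier⟩

/-- The trivial Azumaya algebra `R`. -/
def one (R : Type u) [CommRing R] : AzumayaAlg R := ⟨R⟩

/-- Brauer equivalence of Azumaya algebras: `A ⊗ End P ≃ B ⊗ End Q` for some finitely generated
projective faithful modules `P`, `Q`. -/
def Equivalent (A B : AzumayaAlg R) : Prop :=
  ∃ P Q : FaithfulProjective R, Nonempty
    (A.carrier ⊗[R] Module.End R P.carrier ≃ₐ[R] B.carrier ⊗[R] Module.End R Q.carrier)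

theorem Equivalent.of_algEquiv {A B : AzumayaAlg R} (e : A.carrier ≃ₐ[R] B.carrier) :
    A.Equivalent B :=
  ⟨.one R, .one R, ⟨Algebra.TensorProduct.congr e AlgEquiv.refl⟩⟩

theorem Equivalent.symm {A B : AzumayaAlg R} : A.Equivalent B → B.Equivalent A :=
  fun ⟨P, Q, ⟨e⟩⟩ => ⟨Q, P, ⟨e.symm⟩⟩

/-- `A ⊗ End (P ⊗ Q) ≃ (A ⊗ End P) ⊗ End Q`. -/
noncomputable def splitEnd (A : Type u) [Ring A] [Algebra R A] (P Q : FaithfulProjective R) :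
    A ⊗[R] Module.End R (P.tensor Q).carrier ≃ₐ[R]
      (A ⊗[R] Module.End R P.carrier) ⊗[R] Module.End R Q.carrier :=
  (Algebra.TensorProduct.congr AlgEquiv.refl (endTensorEnd P.carrier Q.carrier).symm).trans
    (Algebra.TensorProduct.assoc R R R A (Module.End R P.carrier) (Module.End R Q.carrier)).symm

/-- `(A ⊗ B) ⊗ C ≃ (A ⊗ C) ⊗ B`. -/
noncomputable def swapRight (A B C : Type*) [Ring A] [Algebra R A] [Ring B] [Algebra R B] [Ring C]
    [Algebra R C] : (A ⊗[R] B) ⊗[R] C ≃ₐ[R] (A ⊗[R] C) ⊗[R] B :=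
  (Algebra.TensorProduct.assoc R R R A B C).trans
    ((Algebra.TensorProduct.congr AlgEquiv.refl (Algebra.TensorProduct.comm R B C)).trans
      (Algebra.TensorProduct.assoc R R R A C B).symm)

theorem Equivalent.trans {A B C : AzumayaAlg R} :
    A.Equivalent B → B.Equivalent C → A.Equivalent C := by
  rintro ⟨P, Q, ⟨e⟩⟩ ⟨P', Q', ⟨e'⟩⟩
  exact ⟨P.tensor P', Q'.tensor Q, ⟨(splitEnd A.carrier P P').trans
    ((Algebra.TensorProduct.congr e AlgEquiv.refl).trans
    ((swapRight _ _ _).trans ((Algebra.TensorProduct.congr e' AlgEquiv.refl).trans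
    (splitEnd C.carrier Q' Q).symm)))⟩⟩

theorem Equivalent.tensor {A A' B B' : AzumayaAlg R} :
    A.Equivalent A' → B.Equivalent B' → (A.tensor B).Equivalent (A'.tensor B') := by
  rintro ⟨P, Q, ⟨e⟩⟩ ⟨P', Q', ⟨e'⟩⟩
  exact ⟨P.tensor P', Q.tensor Q',
    ⟨(Algebra.TensorProduct.congr AlgEquiv.refl (endTensorEnd P.carrier P'.carrier).symm).trans
    ((Algebra.TensorProduct.tensorTensorTensorComm R R R R _ _ _ _).trans
    ((Algebra.TensorProduct.congr e e').trans
    ((Algebra.TensorProduct.tensorTensorTensorComm R R R R _ _ _ _).trans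
    (Algebra.TensorProduct.congr AlgEquiv.refl (endTensorEnd Q.carrier Q'.carrier)))))⟩⟩

theorem Equivalent.baseChange (S : Type u) [CommRing S] [Algebra R S] {A B : AzumayaAlg R} :
    A.Equivalent B → (A.baseChange S).Equivalent (B.baseChange S) := by
  rintro ⟨P, Q, ⟨e⟩⟩
  exact ⟨P.baseChange S, Q.baseChange S,
    ⟨(Algebra.TensorProduct.congr AlgEquiv.refl (baseChangeEnd S P.carrier).symm).trans
    ((baseChangeTensor (R := R) S A.carrier (Module.End R P.carrier)).trans ((Algebra.TensorProduct.congr AlgEquiv.refl e).trans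
    ((baseChangeTensor (R := R) S B.carrier (Module.End R Q.carrier)).symm.trans
    (Algebra.TensorProduct.congr AlgEquiv.refl (baseChangeEnd S Q.carrier)))))⟩⟩

theorem tensor_op_equivalent (A : AzumayaAlg R) : (A.op.tensor A).Equivalent (one R) :=
  ⟨.one R, ⟨A.carrier⟩, ⟨((Algebra.TensorProduct.congr ((Algebra.TensorProduct.comm R _ _).trans
    (AlgEquiv.ofBijective (AlgHom.mulLeftRight R A.carrier) IsAzumaya.bij))
    (show Module.End R R ≃ₐ[R] R from
      ((AlgEquiv.toOpposite R R).trans (AlgEquiv.moduleEndSelf R)).symm)).trans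
    (Algebra.TensorProduct.comm R _ _))⟩⟩

theorem Equivalent.op {A B : AzumayaAlg R} (h : A.Equivalent B) : A.op.Equivalent B.op := by
  have h1 : A.op.Equivalent ((one R).tensor A.op) :=
    .of_algEquiv (Algebra.TensorProduct.lid R A.op.carrier).symm
  have h2 : ((one R).tensor A.op).Equivalent ((B.op.tensor B).tensor A.op) :=
    .tensor B.tensor_op_equivalent.symm (.of_algEquiv AlgEquiv.refl)
  have h3 : ((B.op.tensor B).tensor A.op).Equivalent ((B.op.tensor A).tensor A.op) :=
    .tensor (.tensor (.of_algEquiv AlgEquiv.refl) h.symm) (.of_algEquiv AlgEquiv.refl)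
  have h4 : ((B.op.tensor A).tensor A.op).Equivalent (B.op.tensor (A.op.tensor A)) :=
    .of_algEquiv ((swapRight _ _ _).trans (Algebra.TensorProduct.assoc R R R _ _ _))
  have h5 : (B.op.tensor (A.op.tensor A)).Equivalent (B.op.tensor (one R)) :=
    .tensor (.of_algEquiv AlgEquiv.refl) A.tensor_op_equivalent
  have h6 : (B.op.tensor (one R)).Equivalent B.op :=
    .of_algEquiv (Algebra.TensorProduct.rid R R B.op.carrier)
  exact h1.trans (h2.trans (h3.trans (h4.trans (h5.trans h6))))

end AzumayaAlg

/-- Brauer equivalence as a setoid. -/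
def brauerSetoid (R : Type u) [CommRing R] : Setoid (AzumayaAlg R) where
  r := AzumayaAlg.Equivalent
  iseqv := ⟨fun _ => .of_algEquiv AlgEquiv.refl, .symm, .trans⟩

/-- The Brauer group of a commutative ring: Azumaya algebras up to Brauer equivalence. -/
def Br (R : Type u) [CommRing R] : Type (u + 1) := Quotient (brauerSetoid R)

namespace Br

/-- The Brauer class of an Azumaya algebra. -/
def mk (A : AzumayaAlg R) : Br R := Quotient.mk (brauerSetoid R) A

theorem mk_eq_of_algEquiv {A B : AzumayaAlg R} (e : A.carrier ≃ₐ[R] B.carrier) : mk A = mk B :=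
  Quotient.sound (s := brauerSetoid R) (.of_algEquiv e)

/-- `[A] + [B] = [A ⊗ B]`. -/
noncomputable instance : Add (Br R) :=
  ⟨Quotient.map₂ AzumayaAlg.tensor fun _ _ h _ _ h' => h.tensor h'⟩

/-- `0 = [R]`. -/
instance : Zero (Br R) := ⟨mk (.one R)⟩

/-- `-[A] = [Aᵐᵒᵖ]`. -/
instance : Neg (Br R) := ⟨Quotient.map AzumayaAlg.op fun _ _ h => h.op⟩

noncomputable instance : AddCommGroup (Br R) where
  add_assoc := by
    rintro ⟨A⟩ ⟨B⟩ ⟨C⟩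
    exact mk_eq_of_algEquiv (A := (A.tensor B).tensor C) (B := A.tensor (B.tensor C))
      (Algebra.TensorProduct.assoc R R R A.carrier B.carrier C.carrier)
  zero_add := by
    rintro ⟨A⟩
    exact mk_eq_of_algEquiv (A := (AzumayaAlg.one R).tensor A) (B := A)
      (Algebra.TensorProduct.lid R A.carrier)
  add_zero := by
    rintro ⟨A⟩
    exact mk_eq_of_algEquiv (A := A.tensor (AzumayaAlg.one R)) (B := A)
      (Algebra.TensorProduct.rid R R A.carrier)
  add_comm := by
    rintro ⟨A⟩ ⟨B⟩
    exact mk_eq_of_algEquiv (A := A.tensor B) (B := B.tensor A)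
      (Algebra.TensorProduct.comm R A.carrier B.carrier)
  neg_add_cancel := by
    rintro ⟨A⟩
    exact Quotient.sound (s := brauerSetoid R) A.tensor_op_equivalent
  nsmul := nsmulRec
  zsmul := zsmulRec

/-- The map `Br R → Br S`, `[A] ↦ [S ⊗ A]`, induced by a homomorphism `R → S`. -/
noncomputable def baseChange (R S : Type u) [CommRing R] [CommRing S] [Algebra R S] :
    Br R →+ Br S :=
  AddMonoidHom.mk' (Quotient.map (AzumayaAlg.baseChange S) fun _ _ h => h.baseChange S) (by
    rintro ⟨A⟩ ⟨B⟩
    exact mk_eq_of_algEquiv (A := (A.tensor B).baseChange S)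
      (B := (A.baseChange S).tensor (B.baseChange S))
      (baseChangeTensor S A.carrier B.carrier).symm)

end Br

end BrauerGroup

section Quaternion

/-- The quaternion algebra `R⟨i, j⟩` with `i² = a`, `j² = b`, `ij = -ji` is an Azumaya algebra when
`2`, `a` and `b` are invertible. -/
theorem isAzumaya_quaternion {R : Type*} [CommRing R] (h2 : IsUnit (2 : R)) (a b : Rˣ) :
    IsAzumaya R (QuaternionAlgebra R (a : R) 0 (b : R)) := by
  have hsurj : Function.Surjective
      (AlgHom.mulLeftRight R (QuaternionAlgebra R (a : R) 0 (b : R))) := by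
    obtain ⟨w, hw⟩ := h2
    have hw' : (2 : R) * (↑w⁻¹ : R) = 1 := by rw [← hw]; simp
    have ha : (a : R) * (↑a⁻¹ : R) = 1 := by simp
    have hb : (b : R) * (↑b⁻¹ : R) = 1 := by simp
    generalize (↑w⁻¹ : R) = c at hw'
    generalize (↑a⁻¹ : R) = a' at ha
    generalize (↑b⁻¹ : R) = b' at hb
    generalize (a : R) = a at *
    generalize (b : R) = b at *
    intro f
    -- the standard basis and the inverses of its elements
    let e : Fin 4 → QuaternionAlgebra R a 0 b :=
      ![⟨1, 0, 0, 0⟩, ⟨0, 1, 0, 0⟩, ⟨0, 0, 1, 0⟩, ⟨0, 0, 0, 1⟩]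
    let e' : Fin 4 → QuaternionAlgebra R a 0 b :=
      ![⟨1, 0, 0, 0⟩, ⟨0, a', 0, 0⟩, ⟨0, 0, b', 0⟩, ⟨0, 0, 0, -(a' * b')⟩]
    refine ⟨∑ p, ∑ m, (f (e p) * ((c * c) • (e m * e' p))) ⊗ₜ op (e' m), ?_⟩
    ext x : 1
    have hx : x = x.re • e 0 + x.imI • e 1 + x.imJ • e 2 + x.imK • e 3 := by
      ext <;> simp [e]
    have key : ∀ p, ∑ m, ((c * c) • (e m * e' p)) * x * e' m =
        algebraMap R _ (![x.re, x.imI, x.imJ, x.imK] p) := by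
      have hc : 4 * (c * c) = 1 := by linear_combination (2 * c + 1) * hw'
      have conj : ∀ y : QuaternionAlgebra R a 0 b,
          ∑ m, (c * c) • (e m * y * e' m) = algebraMap R _ y.re := by
        intro y
        ext <;> simp [e, e', Fin.sum_univ_four] <;> grind
      have hre : ∀ p, (e' p * x).re = ![x.re, x.imI, x.imJ, x.imK] p := by
        intro p
        fin_cases p <;> simp [e'] <;> grind
      intro p
      rw [← hre p, ← conj]
      simp only [smul_mul_assoc, mul_assoc]
    have h3 : ∀ p, ∑ m, (f (e p) * ((c * c) • (e m * e' p))) * x * e' m =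
        (![x.re, x.imI, x.imJ, x.imK] p) • f (e p) := by
      intro p
      have := congrArg (fun y => f (e p) * y) (key p)
      simp only [Finset.mul_sum, ← Algebra.commutes, ← Algebra.smul_def] at this
      simpa only [mul_assoc] using this
    conv_rhs => rw [hx]
    simp only [map_sum, LinearMap.sum_apply, AlgHom.mulLeftRight_apply, unop_op, h3]
    simp [Fin.sum_univ_four]
  have : Module.Finite R (QuaternionAlgebra R (a : R) 0 (b : R)) :=
    .of_basis (QuaternionAlgebra.basisOneIJK _ _ _)
  have : Module.Free R (QuaternionAlgebra R (a : R) 0 (b : R)) :=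
    .of_basis (QuaternionAlgebra.basisOneIJK _ _ _)
  refine { toFaithfulSMul := ?_, bij := ⟨?_, hsurj⟩ }
  · exact ⟨fun {r s} h => by simpa using congrArg QuaternionAlgebra.re (h 1)⟩
  · let B := QuaternionAlgebra.basisOneIJK (a : R) 0 (b : R)
    let E : Module.End R (QuaternionAlgebra R (a : R) 0 (b : R)) ≃ₗ[R]
        QuaternionAlgebra R (a : R) 0 (b : R) ⊗[R] (QuaternionAlgebra R (a : R) 0 (b : R))ᵐᵒᵖ :=
      (LinearMap.toMatrix B B).trans ((Matrix.stdBasis R (Fin 4) (Fin 4)).equiv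
        (B.tensorProduct (B.map (opLinearEquiv R))) (Equiv.refl _))
    have h := OrzechProperty.injective_of_surjective_endomorphism
      (E.toLinearMap ∘ₗ (AlgHom.mulLeftRight R _).toLinearMap)
      (E.surjective.comp hsurj)
    exact Function.Injective.of_comp (f := E) h

/-- The class of the quaternion algebra `(a, b)` in the Brauer group. -/
noncomputable def quaternionClass {R : Type u} [CommRing R] (h2 : IsUnit (2 : R)) (a b : Rˣ) :
    Br R :=
  have := isAzumaya_quaternion h2 a b
  Br.mk ⟨QuaternionAlgebra R (a : R) 0 (b : R)⟩

end Quaternion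

section Residue

/-- The absolute Galois group of `k`, with the Krull topology. -/
abbrev AbsGal (k : Type u) [Field k] : Type u := AlgebraicClosure k ≃ₐ[k] AlgebraicClosure k

/-- The group `H¹(k, ℚ/ℤ)` (trivial action): homomorphisms from the absolute Galois group to the
discrete group `ℚ/ℤ` that are continuous, i.e. have open kernel. It is written multiplicatively. -/
def Characters (k : Type u) [Field k] :
    Subgroup (AbsGal k →* Multiplicative (AddCircle (1 : ℚ))) where
  carrier := {χ | IsOpen (χ.ker : Set (AbsGal k))}
  one_mem' := by simp
  mul_mem' := by
    intro χ ψ hχ hψ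
    refine Subgroup.isOpen_mono (H₁ := χ.ker ⊓ ψ.ker) ?_ (IsOpen.inter hχ hψ)
    intro g hg
    have h1 : χ g = 1 := hg.1
    have h2 : ψ g = 1 := hg.2
    simp [MonoidHom.mem_ker, h1, h2]
  inv_mem' := by
    intro χ hχ
    have : χ⁻¹.ker = χ.ker := by ext g; simp [MonoidHom.mem_ker]
    simpa only [Set.mem_ofPred_eq, this] using hχ

/-- The finite cyclic extension of `k` cut out by a character: the fixed field of its kernel. -/
noncomputable def charField {k : Type u} [Field k] (χ : Characters k) :
    IntermediateField k (AlgebraicClosure k) :=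
  IntermediateField.fixedField χ.1.ker

/-- `A` is the cyclic algebra `(χ, π)` over the extension `K` of `k`. Let `L` be the cyclic extension
of `k` of degree `n` cut out by `χ` and let `g` restrict to the generator of `Gal(L/k)` with
`χ(g) = 1/n`. Then `A` has dimension `n²` over `K`, it contains `L` and an element `v` with `vⁿ = π`,
and `v x = g(x) v` for all `x` in `L`. Among central simple algebras over a field `K` in which `k`
is algebraically closed, and for `π ≠ 0`, this determines `A` up to isomorphism. -/
def IsCyclicAlgebra {k K A : Type u} [Field k] [Field K] [Algebra k K] [Ring A] [Algebra K A]
    (χ : Characters k) (π : K) : Prop :=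
  ∃ (g : AbsGal k) (φ : charField χ →+* A) (v : A),
    χ.1 g = Multiplicative.ofAdd
      (((1 / Module.finrank k (charField χ) : ℚ)) : AddCircle (1 : ℚ)) ∧
    Module.finrank K A = Module.finrank k (charField χ) ^ 2 ∧
    (∀ c : k, φ (algebraMap k (charField χ) c) = algebraMap K A (algebraMap k K c)) ∧
    v ^ Module.finrank k (charField χ) = algebraMap K A π ∧
    ∀ x y : charField χ, (y : AlgebraicClosure k) = g x → v * φ x = φ y * v

/-- `χ` is the residue of `β ∈ Br K` along the discrete valuation ring `O` of `K`, where `k ⊆ O` is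
a field of characteristic zero that maps isomorphically to the residue field of `O` (so that `O` is
the local ring at a `k`-rational point of a curve). The residue map `Br K → H¹(k, ℚ/ℤ)` has kernel
`Br O` and sends the class of the cyclic algebra `(χ, π)` to `χ` for every uniformizer `π`, so `χ` is
the residue of `β` exactly when `β - [(χ, π)]` comes from `Br O`. -/
def HasResidue {k K : Type u} [Field k] [Field K] [Algebra k K] (O : Subalgebra k K)
    (β : Br K) (χ : Characters k) : Prop :=
  ∃ (π : O) (A : AzumayaAlg K), Irreducible π ∧
    IsCyclicAlgebra (A := A.carrier) χ (π : K) ∧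
    β - Br.mk A ∈ (Br.baseChange O K).range

end Residue

section Line

/-- The function field of the line `Z : z₀ + z₁ + z₂ = 0` in `ℙ²` is `k(t)` with `t = z₀ / z₂`.
These are the homogeneous coordinates `[t : -(t + 1) : 1]` of the generic point of `Z`. -/
noncomputable def coord (k : Type u) [Field k] : Fin 3 → RatFunc k :=
  ![RatFunc.X, -(RatFunc.X + 1), 1]

theorem coord_sum (k : Type u) [Field k] : coord k 0 + coord k 1 + coord k 2 = 0 := by
  simp [coord]

theorem coord_ne_zero (k : Type u) [Field k] (i : Fin 3) : coord k i ≠ 0 := by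
  have h1 : (RatFunc.X : RatFunc k) + 1 ≠ 0 := by
    have h : (Polynomial.X + Polynomial.C 1 : Polynomial k) ≠ 0 := Polynomial.X_add_C_ne_zero 1
    have h' := (map_ne_zero_iff (algebraMap (Polynomial k) (RatFunc k))
      (RatFunc.algebraMap_injective k)).mpr h
    simpa using h'
  fin_cases i
  · simpa [coord] using RatFunc.X_ne_zero (K := k)
  · show -(RatFunc.X + 1) ≠ (0 : RatFunc k)
    exact neg_ne_zero.mpr h1
  · simp [coord]

/-- The coordinate ring of the affine open curve `Z° = Z ∖ {z₀ z₁ z₂ = 0}`, inside the function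
field: it is generated by the functions `zᵢ / zⱼ`. -/
noncomputable def openRing (k : Type u) [Field k] : Subalgebra k (RatFunc k) :=
  Algebra.adjoin k {f | ∃ i j, f = coord k i / coord k j}

/-- The point `Pᵢ` of `Z` with `zᵢ = 0`. -/
def point (k : Type u) [Field k] : Fin 3 → Fin 3 → k :=
  ![![0, 1, -1], ![-1, 0, 1], ![1, -1, 0]]

/-- The local ring of `Z` at `Pᵢ`, inside the function field: the quotients `F / G` of homogeneous
polynomials in `z₀, z₁, z₂` of equal degree with `G(Pᵢ) ≠ 0`. (Then `G` does not vanish identically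
on `Z`.) -/
noncomputable def localRing (k : Type u) [Field k] (i : Fin 3) : Subalgebra k (RatFunc k) where
  carrier := {f | ∃ (n : ℕ) (F G : MvPolynomial (Fin 3) k), F.IsHomogeneous n ∧ G.IsHomogeneous n ∧
    MvPolynomial.eval (point k i) G ≠ 0 ∧
    f * MvPolynomial.aeval (coord k) G = MvPolynomial.aeval (coord k) F}
  mul_mem' := by
    rintro f f' ⟨n, F, G, hF, hG, h0, h⟩ ⟨n', F', G', hF', hG', h0', h'⟩
    refine ⟨n + n', F * F', G * G', hF.mul hF', hG.mul hG', ?_, ?_⟩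
    · simpa using ⟨h0, h0'⟩
    · rw [map_mul, map_mul, ← h, ← h']; ring
  add_mem' := by
    rintro f f' ⟨n, F, G, hF, hG, h0, h⟩ ⟨n', F', G', hF', hG', h0', h'⟩
    refine ⟨n + n', F * G' + G * F', G * G', (hF.mul hG').add (hG.mul hF'), hG.mul hG', ?_, ?_⟩
    · simpa using ⟨h0, h0'⟩
    · rw [map_mul, map_add, map_mul, map_mul, ← h, ← h']; ring
  algebraMap_mem' c := ⟨0, MvPolynomial.C c, 1, MvPolynomial.isHomogeneous_C _ _,
    MvPolynomial.isHomogeneous_one _ _, by simp, by simp⟩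

/-- The invertible function `zᵢ / zⱼ` on `Z°`. -/
noncomputable def ratio (k : Type u) [Field k] (i j : Fin 3) : (openRing k)ˣ where
  val := ⟨coord k i / coord k j, Algebra.subset_adjoin ⟨i, j, rfl⟩⟩
  inv := ⟨coord k j / coord k i, Algebra.subset_adjoin ⟨j, i, rfl⟩⟩
  val_inv := Subtype.ext (by
    have := coord_ne_zero k i
    have := coord_ne_zero k j
    simp; field_simp)
  inv_val := Subtype.ext (by
    have := coord_ne_zero k i
    have := coord_ne_zero k j
    simp; field_simp)

/-- The Campana Brauer group of the pair `(Z, Σᵢ (1 - 1/mᵢ) Pᵢ)`, as a set: the elements `β` of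
`Br Z°` with `mᵢ res_{Pᵢ}(β) = 0` for every `i`. -/
def campanaBrauer (k : Type u) [Field k] (m : Fin 3 → ℕ) : Set (Br (openRing k)) :=
  {β | ∀ i, ∃ χ : Characters k,
    HasResidue (localRing k i) (Br.baseChange (openRing k) (RatFunc k) β) χ ∧ χ ^ m i = 1}

/-- The image of `Br k` in `Br Z°`. -/
noncomputable def constantClasses (k : Type u) [Field k] : AddSubgroup (Br (openRing k)) :=
  (Br.baseChange k (openRing k)).range

/-- Integer triples whose product is squarefree and positive. -/
abbrev Triple : Type := {d : Fin 3 → ℤ // Squarefree (d 0 * d 1 * d 2) ∧ 0 < d 0 * d 1 * d 2}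

theorem Triple.ne_zero (d : Triple) (i : Fin 3) : (d.1 i : ℚ) ≠ 0 := by
  have h := d.2.2.ne'
  simp only [ne_eq, mul_eq_zero, not_or] at h
  fin_cases i
  · exact_mod_cast h.1.1
  · exact_mod_cast h.1.2
  · exact_mod_cast h.2

/-- The nonzero constant `dᵢ` as an invertible function on `Z°`. -/
noncomputable def Triple.unit (d : Triple) (i : Fin 3) : (openRing ℚ)ˣ :=
  Units.map (algebraMap ℚ (openRing ℚ)).toMonoidHom (Units.mk0 (d.1 i : ℚ) (d.ne_zero i))

theorem isUnit_two : IsUnit (2 : openRing ℚ) := by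
  have h := (IsUnit.mk0 (2 : ℚ) two_ne_zero).map (algebraMap ℚ (openRing ℚ))
  rwa [map_ofNat] at h

/-- The class `(d₀, z₁/z₂) + (d₁, z₀/z₂) + (d₂, z₀/z₁)` in `Br Z°`. -/
noncomputable def symbolClass (d : Triple) : Br (openRing ℚ) :=
  quaternionClass isUnit_two (d.unit 0) (ratio ℚ 1 2) +
    quaternionClass isUnit_two (d.unit 1) (ratio ℚ 0 2) +
    quaternionClass isUnit_two (d.unit 2) (ratio ℚ 0 1)

/-- The Galois cohomology group `H¹(ℚ, ℤ/2 × ℤ/2)`: continuous cohomology of the absolute Galois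
group with coefficients in the discrete module `ℤ/2 × ℤ/2` with trivial action. -/
noncomputable abbrev H1TwoTwo : Type :=
  continuousCohomology 1
    (TopRep.of (ContRepresentation.trivial ℤ (AbsGal ℚ) (ZMod 2 × ZMod 2)))

end Line

end CampanaBrauer

namespace CampanaBrauer
universe u
open MulOpposite

/-! ### Azumaya algebras over a field as central simple algebras. -/

section AzumayaField

variable {F : Type u} [Field F]

/-! Let k be a field of characteristic zero, t = z₀/z₂ and K = k(t). Everything reduces to the map
k* × k* → Br(Z, D_ε)/Br k, (x, y) ↦ (x, z₁/z₂) + (y, z₀/z₂). It is surjective, and its kernel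
consists of the pairs of squares (`pairHom_surjective`, `mem_ker_pairHom`). Over ℚ the class of a
triple d is the image of (d₀d₂, d₁d₂), and triples correspond bijectively to pairs of squarefree
integers, that is, to pairs of square classes. Kummer theory presents H¹(k, ℤ/2 × ℤ/2) as the
quotient of k* × k* by the same subgroup.

Computations take place in Br K, because the Brauer group of the coordinate ring of Z° injects there
(`Br.baseChange_injective`). A character killed by 2 is quadratic, so the condition at Pᵢ says that
the class differs from a symbol (d, πᵢ) with d in k* by an unramified class
(`exists_hasResidue_iff`). The class of (x, y) has the residues y, x and xy at P₀, P₁ and P₂. If it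
is constant, then (y, t) and (x, t + 1) are unramified, which forces x and y to be squares
(`quaternionClass_notMem_range`).

For surjectivity, subtracting a pair class leaves a class that is unramified on the affine line and
differs from a quadratic symbol at P₂ by an unramified class. Such a class is constant
(`mem_constantClasses`). Instead of reciprocity, the proof uses orders in the division algebra D of
the class. There is an order M over k[t] that contains its trace dual, and an order C at infinity
whose trace dual lies in t·C. Lattice reduction on the projective line, in the manner of Birkhoff
and Grothendieck, gives a basis eᵢ of M such that the t^(-aᵢ)eᵢ form a basis of C
(`exists_reduced_basis`). As D has no nilpotents, all aᵢ ≥ 0. The eᵢ with aᵢ = 0 span a subalgebra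
W, and the trace-dual vectors of the other eᵢ lie in W. So W has at least half the dimension of D,
and exactly half would give 1 trace zero. A subalgebra of more than half the dimension of a division
algebra is the whole algebra, so W = D (`exists_basis_mem_inf`). Then M ∩ C is a k-form of D, and
the class comes from Br k. -/

theorem IsAzumaya.isSimpleRing (A : Type*) [Ring A] [Algebra F A] [IsAzumaya F A] :
    IsSimpleRing A := by
  have hnt : Nontrivial A := by
    by_contra h
    rw [not_nontrivial_iff_subsingleton] at h
    exact zero_ne_one (FaithfulSMul.eq_of_smul_eq_smul (M := F) (α := A)
      (m₁ := 0) (m₂ := 1) fun a => Subsingleton.elim _ _)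
  rw [isSimpleRing_iff_isTwoSided_imp]
  refine ⟨hnt, fun I hI => ?_⟩
  by_cases h : I = ⊥
  · exact .inl h
  right
  obtain ⟨x, hx, hx0⟩ := I.ne_bot_iff.mp h
  -- Every linear endomorphism is a sum of maps `y ↦ a * y * b`, so it preserves two-sided ideals;
  -- one that sends `x` to `1` puts `1` in the ideal.
  obtain ⟨f, hf⟩ : ∃ f : Module.End F A, f x = 1 := by
    obtain ⟨φ, hφ⟩ := Module.Projective.exists_dual_ne_zero F hx0
    exact ⟨LinearMap.toSpanSingleton F A ((φ x)⁻¹ • 1) ∘ₗ φ, by simp [smul_smul, hφ]⟩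
  obtain ⟨y, rfl⟩ := (IsAzumaya.bij (R := F) (A := A)).2 f
  rw [Ideal.eq_top_iff_one, ← hf]
  clear hf
  induction y with
  | zero => simp
  | add y z hy hz => simpa using I.add_mem hy hz
  | tmul a b =>
    rw [AlgHom.mulLeftRight_apply]
    exact I.mul_mem_right _ (I.mul_mem_left _ hx)

/-- A homomorphism from an Azumaya algebra over a field to an algebra of the same dimension is
bijective. -/
theorem IsAzumaya.bijective_of_finrank_eq {A B : Type*} [Ring A] [Algebra F A] [IsAzumaya F A]
    [Ring B] [Algebra F B] [Module.Finite F B] (f : A →ₐ[F] B)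
    (h : Module.finrank F A = Module.finrank F B) : Function.Bijective f := by
  have := IsAzumaya.isSimpleRing (F := F) A
  have : Nontrivial B := by
    have : 0 < Module.finrank F B := h ▸ Module.finrank_pos
    exact Module.nontrivial_of_finrank_pos this
  have hi : Function.Injective f := f.toRingHom.injective
  exact ⟨hi, (LinearMap.injective_iff_surjective_of_finrank_eq_finrank (f := f.toLinearMap) h).mp hi⟩

/-- The Artin–Whaples argument: replacing `x` by `x * y` and comparing produces a shorter relation,
so in a minimal one all ratios `b i * (b i₀)⁻¹` are central. Putting `x = 1` then contradicts the
independence of `a`. This is the injectivity of `D ⊗ Dᵐᵒᵖ → End D`. -/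
theorem sum_mul_mul_eq_zero {D : Type*} [DivisionRing D] [Algebra F D] [Algebra.IsCentral F D]
    {ι : Type*} (s : Finset ι) {a : ι → D} (ha : LinearIndependent F a) (b : ι → D)
    (h : ∀ x, ∑ i ∈ s, a i * x * b i = 0) : ∀ i ∈ s, b i = 0 := by
  classical
  induction s using Finset.strongInduction generalizing b with
  | H s ih =>
    by_contra hne
    push Not at hne
    obtain ⟨i₀, hi₀, hb⟩ := hne
    have hcomm : ∀ i ∈ s, ∀ y, y * (b i * (b i₀)⁻¹) = (b i * (b i₀)⁻¹) * y := by
      intro i hi y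
      by_cases hii : i = i₀
      · subst hii; simp [hb]
      have := ih (s.erase i₀) (Finset.erase_ssubset hi₀)
        (fun i => y * (b i * (b i₀)⁻¹) - (b i * (b i₀)⁻¹) * y) (by
          intro x
          have h1 := congrArg (· * (b i₀)⁻¹) (h (x * y))
          have h2 := congrArg (· * ((b i₀)⁻¹ * y)) (h x)
          simp only [Finset.sum_mul, zero_mul] at h1 h2
          rw [Finset.sum_erase _ (by simp [hb])]
          calc _ = ∑ i ∈ s, a i * (x * y) * b i * (b i₀)⁻¹
              - ∑ i ∈ s, a i * x * b i * ((b i₀)⁻¹ * y) := by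
                rw [← Finset.sum_sub_distrib]
                exact Finset.sum_congr rfl fun i _ => by noncomm_ring
            _ = 0 := by rw [h1, h2, sub_zero]) i (Finset.mem_erase.mpr ⟨hii, hi⟩)
      exact sub_eq_zero.mp this
    have hc : ∀ i, ∃ c : F, i ∈ s → b i * (b i₀)⁻¹ = algebraMap F D c := by
      intro i
      by_cases hi : i ∈ s
      · have : b i * (b i₀)⁻¹ ∈ Subalgebra.center F D :=
          Subalgebra.mem_center_iff.mpr (hcomm i hi)
        rw [Algebra.IsCentral.center_eq_bot] at this
        obtain ⟨c, hc⟩ := Algebra.mem_bot.mp this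
        exact ⟨c, fun _ => hc.symm⟩
      · exact ⟨0, fun h => absurd h hi⟩
    choose c hc using hc
    have h1 : ∑ i ∈ s, c i • a i = 0 := by
      have := congrArg (· * (b i₀)⁻¹) (h 1)
      simp only [Finset.sum_mul, zero_mul, mul_one] at this
      rw [← this]
      refine Finset.sum_congr rfl fun i hi => ?_
      rw [mul_assoc, hc i hi, Algebra.smul_def, Algebra.commutes]
    have h2 := linearIndependent_iff'.mp ha s c h1 i₀ hi₀
    have h3 := hc i₀ hi₀
    rw [h2, map_zero, mul_inv_cancel₀ hb] at h3
    exact one_ne_zero h3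

/-- A finite-dimensional central division algebra is an Azumaya algebra. -/
theorem isAzumaya_of_divisionRing (D : Type*) [DivisionRing D] [Algebra F D]
    [Algebra.IsCentral F D] [Module.Finite F D] : IsAzumaya F D where
  bij := by
    have hinj : Function.Injective (AlgHom.mulLeftRight F D) := by
      rw [injective_iff_map_eq_zero]
      intro x hx
      let B := Module.finBasis F D
      obtain ⟨b, rfl⟩ := TensorProduct.eq_repr_basis_left B x
      have := sum_mul_mul_eq_zero b.support B.linearIndependent (fun i => unop (b i)) (by
        intro y
        have := congrArg (fun f : Module.End F D => f y) hx
        simpa [Finsupp.sum, map_sum, LinearMap.sum_apply] using this)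
      have hb : b = 0 := by
        ext i
        by_cases hi : i ∈ b.support
        · simpa using this i hi
        · simpa using hi
      simp [hb]
    refine ⟨hinj, (LinearMap.injective_iff_surjective_of_finrank_eq_finrank
      (f := (AlgHom.mulLeftRight F D).toLinearMap) ?_).mp hinj⟩
    rw [Module.finrank_tensorProduct, Module.finrank_linearMap,
      (opLinearEquiv F : D ≃ₗ[F] Dᵐᵒᵖ).finrank_eq]

end AzumayaField

/-! ### Brauer classes over a field: splitting and division algebras. -/

section Splitting

variable {R : Type u} [CommRing R]

theorem Br.mk_eq_zero_of_algEquiv_end {A : AzumayaAlg R} (P : FaithfulProjective R)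
    (e : A.carrier ≃ₐ[R] Module.End R P.carrier) : Br.mk A = 0 :=
  Quotient.sound (s := brauerSetoid R) ⟨.one R, P, ⟨((Algebra.TensorProduct.congr e
    (show Module.End R R ≃ₐ[R] R from
      ((AlgEquiv.toOpposite R R).trans (AlgEquiv.moduleEndSelf R)).symm)).trans
    (Algebra.TensorProduct.comm R _ _))⟩⟩

theorem Br.mk_tensor (A B : AzumayaAlg R) : Br.mk (A.tensor B) = Br.mk A + Br.mk B := rfl

theorem Br.mk_op (A : AzumayaAlg R) : Br.mk A.op = -Br.mk A := rfl

theorem Br.mk_baseChange (S : Type u) [CommRing S] [Algebra R S] (A : AzumayaAlg R) :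
    Br.mk (A.baseChange S) = Br.baseChange R S (Br.mk A) := rfl

theorem Br.exists_rep (β : Br R) : ∃ A : AzumayaAlg R, Br.mk A = β := Quotient.exists_rep β

/-- Matrix algebras do not change the class. -/
theorem Br.mk_eq_of_algEquiv_tensor_matrix {A B : AzumayaAlg R} [Nontrivial R] (n : ℕ) [NeZero n]
    (e : A.carrier ≃ₐ[R] B.carrier ⊗[R] Matrix (Fin n) (Fin n) R) : Br.mk A = Br.mk B := by
  have : FaithfulSMul R (ULift.{u} (Fin n) → R) := inferInstance
  refine Quotient.sound (s := brauerSetoid R) ⟨.one R, ⟨ULift.{u} (Fin n) → R⟩, ⟨?_⟩⟩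
  refine (Algebra.TensorProduct.congr AlgEquiv.refl (show Module.End R R ≃ₐ[R] R from
      ((AlgEquiv.toOpposite R R).trans (AlgEquiv.moduleEndSelf R)).symm)).trans ?_
  refine (Algebra.TensorProduct.rid R R _).trans (e.trans ?_)
  exact Algebra.TensorProduct.congr AlgEquiv.refl
    ((Matrix.reindexAlgEquiv R R Equiv.ulift.symm).trans Matrix.toLinAlgEquiv')

variable {F : Type u} [Field F]

/-- If `A ⊗ End P ≃ End Q` then `A` is itself an
endomorphism algebra. -/
theorem exists_algEquiv_end_of_tensor {A : Type u} [Ring A] [Algebra F A] [IsAzumaya F A]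
    {P Q : Type u} [AddCommGroup P] [Module F P] [Module.Finite F P] [Nontrivial P]
    [AddCommGroup Q] [Module F Q] [Module.Finite F Q]
    (h : A ⊗[F] Module.End F P ≃ₐ[F] Module.End F Q) :
    ∃ (V : Type u) (_ : AddCommGroup V) (_ : Module F V) (_ : Module.Finite F V),
      Nonempty (A ≃ₐ[F] Module.End F V) := by
  classical
  let b := Module.finBasis F P
  have hp : 0 < Module.finrank F P := Module.finrank_pos
  let o : Fin (Module.finrank F P) := ⟨0, hp⟩
  -- These are matrix units of `End P`. Their images in `End Q` cut `Q` into isomorphic pieces, and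
  -- `A`, which commutes with them, acts on each; `V` below is one of the pieces.
  let E : Fin (Module.finrank F P) → Fin (Module.finrank F P) → Module.End F P :=
    fun i j => LinearMap.toSpanSingleton F P (b i) ∘ₗ b.coord j
  have hE : ∀ i j k l, E i j * E k l = if j = k then E i l else 0 := by
    intro i j k l
    split_ifs with hjk
    · subst hjk
      ext x
      simp [E]
    · ext x
      simp [E, Ne.symm hjk]
  have hE1 : ∑ i, E i i = 1 := by
    ext x
    simp only [E, LinearMap.sum_apply, LinearMap.comp_apply, LinearMap.toSpanSingleton_apply,
      Module.Basis.coord_apply, Module.End.one_apply]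
    exact b.sum_repr x
  let e : Fin (Module.finrank F P) → Fin (Module.finrank F P) → Module.End F Q :=
    fun i j => h (1 ⊗ₜ E i j)
  have he : ∀ i j k l, e i j * e k l = if j = k then e i l else 0 := by
    intro i j k l
    simp only [e, ← map_mul, Algebra.TensorProduct.tmul_mul_tmul, mul_one, hE]
    split_ifs <;> simp
  have he1 : ∑ i, e i i = 1 := by
    simp only [e, ← map_sum, ← TensorProduct.tmul_sum, hE1]
    rw [← Algebra.TensorProduct.one_def, map_one]
  have hcomm : ∀ (a : A) i j, h (a ⊗ₜ 1) * e i j = e i j * h (a ⊗ₜ 1) := by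
    intro a i j
    simp only [e, ← map_mul, Algebra.TensorProduct.tmul_mul_tmul, mul_one, one_mul]
  let V : Submodule F Q := LinearMap.range (e o o)
  have hV : ∀ v ∈ V, e o o v = v := by
    rintro _ ⟨q, rfl⟩
    rw [← Module.End.mul_apply, he, if_pos rfl]
  have hVj : ∀ j q, e o j q ∈ V := fun j q => ⟨e o j q, by
    rw [← Module.End.mul_apply, he, if_pos rfl]⟩
  have hVA : ∀ a : A, ∀ v ∈ V, h (a ⊗ₜ 1) v ∈ V := by
    rintro a _ ⟨q, rfl⟩
    exact ⟨h (a ⊗ₜ 1) q, by rw [← Module.End.mul_apply, ← hcomm, Module.End.mul_apply]⟩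
  let f : A →ₐ[F] Module.End F V := AlgHom.ofLinearMap
    { toFun := fun a => (h (a ⊗ₜ 1)).restrict (hVA a)
      map_add' := fun a a' => by ext v; simp [TensorProduct.add_tmul]
      map_smul' := fun c a => by ext v; simp [← TensorProduct.smul_tmul'] }
    (by ext v; simp [← Algebra.TensorProduct.one_def])
    (fun a a' => by
      ext v
      have : h ((a * a') ⊗ₜ 1) = h (a ⊗ₜ 1) * h (a' ⊗ₜ 1) := by
        rw [← map_mul, Algebra.TensorProduct.tmul_mul_tmul, mul_one]
      simp [this])
  let g : Q ≃ₗ[F] (Fin (Module.finrank F P) → V) :=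
    { toFun := fun q j => ⟨e o j q, hVj j q⟩
      map_add' := fun q q' => by ext; simp
      map_smul' := fun c q => by ext; simp
      invFun := fun v => ∑ i, e i o (v i)
      left_inv := fun q => by
        simp only [← Module.End.mul_apply, he, if_pos]
        rw [← LinearMap.sum_apply, he1]; rfl
      right_inv := fun v => by
        ext j
        simp only [map_sum, ← Module.End.mul_apply, he]
        rw [Finset.sum_eq_single j]
        · simpa using hV _ (v j).2
        · intro i _ hij; simp [Ne.symm hij]
        · simp }
  -- With p = dim P the isomorphism gives dim A · p² = (p · dim V)², so `A` and `End V` have the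
  -- same dimension.
  have hdim : Module.finrank F A = Module.finrank F (Module.End F V) := by
    have h1 := h.toLinearEquiv.finrank_eq
    rw [Module.finrank_tensorProduct, Module.finrank_linearMap, Module.finrank_linearMap,
      g.finrank_eq, Module.finrank_pi_fintype] at h1
    rw [Module.finrank_linearMap]
    simp only [Finset.sum_const, Finset.card_univ, Fintype.card_fin, smul_eq_mul] at h1
    have hpp : 0 < Module.finrank F P * Module.finrank F P := by positivity
    apply Nat.eq_of_mul_eq_mul_right hpp
    rw [h1]; ring
  exact ⟨V, inferInstance, inferInstance, inferInstance,
    ⟨AlgEquiv.ofBijective f (IsAzumaya.bijective_of_finrank_eq f hdim)⟩⟩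

/-- Over a field, the class of `A` is trivial iff `A` is an endomorphism algebra. -/
theorem Br.exists_algEquiv_end {A : AzumayaAlg F} (h : Br.mk A = 0) :
    ∃ (V : Type u) (_ : AddCommGroup V) (_ : Module F V) (_ : Module.Finite F V),
      Nonempty (A.carrier ≃ₐ[F] Module.End F V) := by
  obtain ⟨P, Q, ⟨e⟩⟩ := Quotient.exact (s := brauerSetoid F) h
  have : Nontrivial P.carrier := by
    by_contra hn
    rw [not_nontrivial_iff_subsingleton] at hn
    exact zero_ne_one (FaithfulSMul.eq_of_smul_eq_smul (M := F) (α := P.carrier)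
      (m₁ := 0) (m₂ := 1) fun a => Subsingleton.elim _ _)
  exact exists_algEquiv_end_of_tensor (e.trans (Algebra.TensorProduct.lid F _))

/-- Algebras with the same class, as bimodules: `A ⊗ Bᵐᵒᵖ` acts on some `V` as the full endomorphism
algebra. -/
theorem Br.exists_algEquiv_end_of_eq {A B : AzumayaAlg F} (h : Br.mk A = Br.mk B) :
    ∃ (V : Type u) (_ : AddCommGroup V) (_ : Module F V) (_ : Module.Finite F V),
      Nonempty (A.carrier ⊗[F] B.carrierᵐᵒᵖ ≃ₐ[F] Module.End F V) := by
  have : Br.mk (A.tensor B.op) = 0 := by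
    rw [Br.mk_tensor, Br.mk_op, h, add_neg_cancel]
  exact Br.exists_algEquiv_end this

/-- Every Brauer class of a field is represented by a division algebra. -/
theorem Br.exists_divisionRing (β : Br F) : ∃ (D : Type u) (_ : DivisionRing D) (_ : Algebra F D)
    (_ : IsAzumaya F D), Br.mk ⟨D⟩ = β := by
  obtain ⟨A, rfl⟩ := Br.exists_rep β
  have := IsAzumaya.isSimpleRing (F := F) A.carrier
  have : IsArtinianRing A.carrier := IsArtinianRing.of_finite F A.carrier
  obtain ⟨n, hn, D, _, _, _, ⟨e⟩⟩ :=
    IsSimpleRing.exists_algEquiv_matrix_divisionRing_finite F A.carrier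
  let e' : A.carrier ≃ₐ[F] D ⊗[F] Matrix (Fin n) (Fin n) F := e.trans (matrixEquivTensor (Fin n) F D)
  have : Algebra.IsCentral F (D ⊗[F] Matrix (Fin n) (Fin n) F) := .of_algEquiv F _ _ e'
  have : Algebra.IsCentral F D :=
    Algebra.IsCentral.left_of_tensor_of_field F D (Matrix (Fin n) (Fin n) F)
  have := isAzumaya_of_divisionRing (F := F) D
  exact ⟨D, _, _, this, (Br.mk_eq_of_algEquiv_tensor_matrix (B := ⟨D⟩) n e').symm⟩

end Splitting

/-! ### The trace form, dual bases and the Casimir element. -/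

section RegTrace

variable (F : Type*) [Field F] (A : Type*) [Ring A] [Algebra F A]

/-- The trace of left multiplication. -/
noncomputable def regTrace : A →ₗ[F] F :=
  LinearMap.trace F A ∘ₗ (Algebra.lmul F A).toLinearMap

variable {F A}

theorem regTrace_apply (x : A) : regTrace F A x = LinearMap.trace F A (Algebra.lmul F A x) := rfl

theorem regTrace_mul_comm (x y : A) : regTrace F A (x * y) = regTrace F A (y * x) := by
  simp only [regTrace_apply, map_mul]
  exact LinearMap.trace_mul_comm F _ _

theorem regTrace_one [Module.Finite F A] : regTrace F A 1 = Module.finrank F A := by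
  rw [regTrace_apply, map_one, LinearMap.trace_one]

/-- The families `a` and `b` are dual for the trace form. -/
def IsTraceDual {ι : Type*} [DecidableEq ι] (a b : ι → A) : Prop :=
  ∀ i j, regTrace F A (a i * b j) = if i = j then 1 else 0

variable {ι : Type*} [Fintype ι] [DecidableEq ι]

section

variable {a : Module.Basis ι F A} {b : ι → A}

theorem IsTraceDual.repr_apply (h : IsTraceDual (F := F) a b) (x : A) (i : ι) :
    a.repr x i = regTrace F A (x * b i) := by
  conv_rhs => rw [← a.sum_repr x]
  simp only [Finset.sum_mul, map_sum, smul_mul_assoc, map_smul, h _ _]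
  simp

theorem IsTraceDual.sum_left (h : IsTraceDual (F := F) a b) (x : A) :
    ∑ i, regTrace F A (x * b i) • a i = x := by
  simp only [← h.repr_apply, a.sum_repr]

theorem IsTraceDual.sum_right (h : IsTraceDual (F := F) a b) (x : A) :
    ∑ i, regTrace F A (a i * x) • b i = x := by
  refine eq_of_sub_eq_zero ?_
  set y := ∑ i, regTrace F A (a i * x) • b i - x with hy
  have h1 : ∀ i, regTrace F A (a i * y) = 0 := by
    intro i
    simp only [hy, mul_sub, Finset.mul_sum, mul_smul_comm, map_sub, map_sum, map_smul, h _ _]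
    simp
  have h2 : ∀ z, regTrace F A (z * y) = 0 := by
    intro z
    rw [← a.sum_repr z]
    simp only [Finset.sum_mul, smul_mul_assoc, map_sum, map_smul, h1, smul_zero,
      Finset.sum_const_zero]
  rw [← h.sum_left y]
  simp [regTrace_mul_comm y, h2]

/-- The Casimir element ∑ aᵢ ⊗ bᵢ commutes with `A`: the matrix of `x * a i` in the basis `a` and
that of `b j * x` in `b` agree up to transposition by cyclicity of the trace. A general bilinear `Φ`
allows factors to be inserted between the two tensor legs. -/
theorem IsTraceDual.casimir (h : IsTraceDual (F := F) a b) {W : Type*} [AddCommGroup W]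
    [Module F W] (Φ : A →ₗ[F] A →ₗ[F] W) (x : A) :
    ∑ i, Φ (x * a i) (b i) = ∑ i, Φ (a i) (b i * x) := by
  have h1 : ∀ i, Φ (x * a i) (b i) = ∑ j, regTrace F A (x * a i * b j) • Φ (a j) (b i) := by
    intro i
    conv_lhs => rw [← h.sum_left (x * a i)]
    simp
  have h2 : ∀ j, Φ (a j) (b j * x) = ∑ i, regTrace F A (a i * (b j * x)) • Φ (a j) (b i) := by
    intro j
    conv_lhs => rw [← h.sum_right (b j * x)]
    simp
  simp only [h1, h2]
  rw [Finset.sum_comm]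
  refine Finset.sum_congr rfl fun j _ => Finset.sum_congr rfl fun i _ => ?_
  rw [mul_assoc, regTrace_mul_comm, mul_assoc]

theorem IsTraceDual.casimir' (h : IsTraceDual (F := F) a b) {W : Type*} [AddCommGroup W]
    [Module F W] (Φ : A →ₗ[F] A →ₗ[F] W) (x : A) :
    ∑ i, Φ (x * b i) (a i) = ∑ i, Φ (b i) (a i * x) := by
  have h1 : ∀ i, Φ (x * b i) (a i) = ∑ j, regTrace F A (a j * (x * b i)) • Φ (b j) (a i) := by
    intro i
    conv_lhs => rw [← h.sum_right (x * b i)]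
    simp
  have h2 : ∀ j, Φ (b j) (a j * x) = ∑ i, regTrace F A (a j * x * b i) • Φ (b j) (a i) := by
    intro j
    conv_lhs => rw [← h.sum_left (a j * x)]
    simp
  simp only [h1, h2]
  rw [Finset.sum_comm]
  simp only [mul_assoc]

end

variable [IsAzumaya F A]

theorem finrank_ne_zero [CharZero F] : (Module.finrank F A : F) ≠ 0 := by
  have := IsAzumaya.isSimpleRing (F := F) A
  have : 0 < Module.finrank F A := Module.finrank_pos
  exact_mod_cast this.ne'

theorem exists_algebraMap_of_commute {z : A} (h : ∀ x, x * z = z * x) :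
    ∃ c : F, algebraMap F A c = z := by
  have : z ∈ Subalgebra.center F A := Subalgebra.mem_center_iff.mpr h
  rw [Algebra.IsCentral.center_eq_bot] at this
  exact Algebra.mem_bot.mp this

variable [CharZero F]

/-- The trace form of a central simple algebra is nondegenerate in characteristic zero. -/
theorem exists_isTraceDual {κ : Type*} [Finite κ] [DecidableEq κ] (a : Module.Basis κ F A) :
    ∃ b : κ → A, IsTraceDual (F := F) a b := by
  let B : LinearMap.BilinForm F A := (LinearMap.mul F A).compr₂ (regTrace F A)
  have hB : B.Nondegenerate := by
    have hr : LinearMap.IsRefl B := fun x y h => by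
      simpa [B, regTrace_mul_comm y x] using h
    refine (LinearMap.IsRefl.nondegenerate_iff_separatingLeft hr).mpr ?_
    intro x hx
    by_contra hx0
    have := IsAzumaya.isSimpleRing (F := F) A
    -- The radical of the form is a two-sided ideal. If it were nonzero it would contain `1`, whose
    -- trace is the dimension and hence nonzero.
    let I : TwoSidedIdeal A := TwoSidedIdeal.mk' {x | ∀ y, regTrace F A (x * y) = 0}
      (by simp) (fun {x y} hx hy z => by simp [add_mul, hx z, hy z])
      (fun {x} hx z => by simp [hx z])
      (fun {x y} hy z => by rw [mul_assoc, regTrace_mul_comm, mul_assoc]; exact hy _)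
      (fun {x y} hx z => by rw [mul_assoc]; exact hx _)
    have hxI : x ∈ I := by
      rw [TwoSidedIdeal.mem_mk']; exact hx
    have h1 := IsSimpleRing.one_mem_of_ne_zero_mem I hx0 hxI
    rw [TwoSidedIdeal.mem_mk'] at h1
    have h2 := h1 1
    rw [mul_one, regTrace_one] at h2
    exact finrank_ne_zero h2
  refine ⟨fun i => B.dualBasis hB a i, fun i j => ?_⟩
  have h1 := LinearMap.BilinForm.apply_dualBasis_left hB a j i
  rw [regTrace_mul_comm]
  simpa [B, eq_comm] using h1

variable {a : Module.Basis ι F A} {b : ι → A}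

/-- The sum commutes with `A`, so it is a scalar c; taking traces gives c · dim A = dim A. -/
theorem IsTraceDual.sum_mul_eq_one (h : IsTraceDual (F := F) a b) : ∑ i, b i * a i = 1 := by
  obtain ⟨c, hc⟩ := exists_algebraMap_of_commute (F := F) (z := ∑ i, b i * a i) (fun x => by
    have := h.casimir' (LinearMap.mul F A) x
    simpa [Finset.mul_sum, Finset.sum_mul, mul_assoc] using this)
  have h1 : regTrace F A (∑ i, b i * a i) = Module.finrank F A := by
    simp only [map_sum, regTrace_mul_comm (b _), h _ _]
    simp [Module.finrank_eq_card_basis a]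
  rw [← hc, Algebra.algebraMap_eq_smul_one, map_smul, regTrace_one, smul_eq_mul] at h1
  have : c = 1 := mul_right_cancel₀ finrank_ne_zero (h1.trans (one_mul _).symm)
  rw [← hc, this, map_one]

/-- Averaging over dual bases projects to the centre. -/
theorem IsTraceDual.sum_mul_mul (h : IsTraceDual (F := F) a b) (x : A) :
    ∑ i, a i * x * b i = algebraMap F A ((Module.finrank F A : F)⁻¹ * regTrace F A x) := by
  obtain ⟨c, hc⟩ := exists_algebraMap_of_commute (F := F) (z := ∑ i, a i * x * b i) (fun y => by
    have := h.casimir ((LinearMap.mul F A).compl₁₂ (LinearMap.mulRight F x) LinearMap.id) y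
    simpa [Finset.mul_sum, Finset.sum_mul, mul_assoc] using this)
  have h1 : regTrace F A (∑ i, a i * x * b i) = regTrace F A x := by
    simp only [map_sum, regTrace_mul_comm (a _ * x)]
    simp only [← mul_assoc]
    rw [← map_sum, ← Finset.sum_mul, h.sum_mul_eq_one, one_mul]
  rw [← hc, Algebra.algebraMap_eq_smul_one, map_smul, regTrace_one, smul_eq_mul] at h1
  rw [← hc, ← h1, mul_comm c, inv_mul_cancel_left₀ finrank_ne_zero]

/-- A functional on a central simple algebra that vanishes on commutators is a multiple of the
trace. -/
theorem finrank_mul_of_map_mul_comm (φ : A →ₗ[F] F) (hφ : ∀ x y, φ (x * y) = φ (y * x)) (x : A) :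
    Module.finrank F A * φ x = φ 1 * regTrace F A x := by
  obtain ⟨b, hb⟩ := exists_isTraceDual (Module.finBasis F A)
  have h1 := congrArg φ (hb.sum_mul_mul x)
  rw [Algebra.algebraMap_eq_smul_one, map_smul, smul_eq_mul] at h1
  have h2 : φ (∑ i, Module.finBasis F A i * x * b i) = φ x := by
    simp only [map_sum, hφ (Module.finBasis F A _ * x)]
    simp only [← mul_assoc]
    rw [← map_sum, ← Finset.sum_mul, hb.sum_mul_eq_one, one_mul]
  rw [← h2, h1]
  have := finrank_ne_zero (F := F) (A := A)
  field_simp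

end RegTrace

/-! ### Orders, lattices and transport along Brauer equivalence. -/

section Orders

variable (O : Type*) [CommRing O] {K : Type u} [Field K] [Algebra O K]

/-- The endomorphisms of `V` that preserve the `O`-lattice spanned by a basis. -/
noncomputable def latticeEnd {V ι : Type*} [AddCommGroup V] [Module K V] [Fintype ι]
    [DecidableEq ι] (l : Module.Basis ι K V) : Subring (Module.End K V) :=
  ((algebraMap O K).mapMatrix (m := ι)).range.comap (LinearMap.toMatrixAlgEquiv l).toRingHom

variable {O}

theorem mem_latticeEnd {V ι : Type*} [AddCommGroup V] [Module K V] [Fintype ι]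
    [DecidableEq ι] {l : Module.Basis ι K V} {f : Module.End K V} :
    f ∈ latticeEnd O l ↔ ∀ i j, l.repr (f (l j)) i ∈ (algebraMap O K).range := by
  constructor
  · rintro ⟨M, hM⟩ i j
    refine ⟨M i j, ?_⟩
    have := congrFun (congrFun hM i) j
    simpa [LinearMap.toMatrixAlgEquiv_apply] using this
  · intro h
    choose M hM using h
    refine ⟨Matrix.of M, ?_⟩
    ext i j
    simp [LinearMap.toMatrixAlgEquiv_apply, hM]

theorem trace_mem_of_mem_latticeEnd {V ι : Type*} [AddCommGroup V] [Module K V] [Fintype ι]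
    [DecidableEq ι] {l : Module.Basis ι K V} {f : Module.End K V} (hf : f ∈ latticeEnd O l) :
    LinearMap.trace K V f ∈ (algebraMap O K).range := by
  rw [LinearMap.trace_eq_matrix_trace K l, Matrix.trace]
  refine sum_mem fun i _ => ?_
  rw [Matrix.diag_apply, LinearMap.toMatrix_apply]
  exact mem_latticeEnd.mp hf i i

/-- The endomorphism ring of a lattice contains its own trace dual: pairing with the elementary
matrix that carries `l i` to `l j` reads off the entry (i, j). -/
theorem mem_latticeEnd_of_trace {V ι : Type*} [AddCommGroup V] [Module K V] [Module.Finite K V]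
    [Fintype ι]
    [DecidableEq ι] {l : Module.Basis ι K V} {f : Module.End K V}
    (hf : ∀ g ∈ latticeEnd O l, LinearMap.trace K V (f * g) ∈ (algebraMap O K).range) :
    f ∈ latticeEnd O l := by
  rw [mem_latticeEnd]
  intro i j
  let g : Module.End K V := LinearMap.toSpanSingleton K V (l j) ∘ₗ l.coord i
  have hg : g ∈ latticeEnd O l := by
    rw [mem_latticeEnd]
    intro p q
    by_cases h1 : q = i <;> by_cases h2 : j = p <;>
      simp [g, h1, h2, one_mem]
  have h1 := hf g hg
  have h2 : f * g = LinearMap.toSpanSingleton K V (f (l j)) ∘ₗ l.coord i := by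
    ext x; simp [g]
  rw [h2, LinearMap.trace_comp_comm'] at h1
  have h3 : l.coord i ∘ₗ LinearMap.toSpanSingleton K V (f (l j)) =
      LinearMap.mulLeft K (l.repr (f (l j)) i) := by
    ext; simp
  rw [h3] at h1
  convert h1
  exact (Algebra.trace_self_apply (R := K) _).symm

/-- A finite family spanning an order stabilises some lattice. -/
theorem exists_basis_mem_latticeEnd [IsDomain O] [IsPrincipalIdealRing O] [IsFractionRing O K]
    {V ι : Type*} [AddCommGroup V] [Module K V] [Module.Finite K V] [Fintype ι]
    (T : ι → Module.End K V)
    (hT : ∀ i j, ∃ c : ι → O, T i * T j = ∑ k, algebraMap O K (c k) • T k)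
    (h1 : (1 : Module.End K V) ∈ Submodule.span K (Set.range T)) :
    ∃ (n : ℕ) (l : Module.Basis (Fin n) K V), ∀ i, T i ∈ latticeEnd O l := by
  let _ : Module O V := Module.compHom V (algebraMap O K)
  have : IsScalarTower O K V := ⟨fun x y z => by
    rw [Algebra.smul_def, mul_smul]; rfl⟩
  have hsmul : ∀ (r : O) (v : V), r • v = algebraMap O K r • v := fun _ _ => rfl
  let v := Module.finBasis K V
  let w : ι × Fin (Module.finrank K V) → V := fun p => T p.1 (v p.2)
  -- The candidate lattice. It is finitely generated and torsion-free over a principal ideal domain,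
  -- hence free; it is stable because products of the `T i` are integral combinations of them, and
  -- full because `1` is in their span.
  let L : Submodule O V := Submodule.span O (Set.range w)
  have : Module.Finite O L := Module.Finite.span_of_finite O (Set.finite_range w)
  have : Module.IsTorsionFree O V := by
    refine Module.IsTorsionFree.of_smul_eq_zero fun r x hrx => ?_
    rw [hsmul, smul_eq_zero] at hrx
    simpa using hrx
  have : Module.Free O L := inferInstance
  let n := Module.finrank O L
  let bL : Module.Basis (Fin n) O L := Module.finBasis O L
  have hli : LinearIndependent K (fun i => (bL i : V)) := by
    rw [← LinearIndependent.iff_fractionRing (R := O) (K := K)]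
    exact bL.linearIndependent.map' L.subtype (by simp)
  have hsp : ⊤ ≤ Submodule.span K (Set.range fun i => (bL i : V)) := by
    have hL : ∀ x ∈ L, x ∈ Submodule.span K (Set.range fun i => (bL i : V)) := by
      intro x hx
      have := congrArg Subtype.val (bL.sum_repr ⟨x, hx⟩)
      simp only [Submodule.coe_sum, Submodule.coe_smul] at this
      rw [← this]
      refine sum_mem fun i _ => ?_
      rw [hsmul]
      exact Submodule.smul_mem _ _ (Submodule.subset_span ⟨i, rfl⟩)
    have hv : ∀ S ∈ Submodule.span K (Set.range T), ∀ j,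
        S (v j) ∈ Submodule.span K (Set.range fun i => (bL i : V)) := by
      intro S hS j
      induction hS using Submodule.span_induction with
      | mem x hx =>
        obtain ⟨i, rfl⟩ := hx
        exact hL _ (Submodule.subset_span ⟨(i, j), rfl⟩)
      | zero => simp
      | add x y _ _ hx hy => simpa using add_mem hx hy
      | smul c x _ hx => simpa using Submodule.smul_mem _ c hx
    rw [← v.span_eq, Submodule.span_le]
    rintro _ ⟨j, rfl⟩
    exact hv 1 h1 j
  let l := Module.Basis.mk hli hsp
  have hl : ∀ x ∈ L, ∀ i, l.repr x i ∈ (algebraMap O K).range := by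
    intro x hx i
    have := congrArg Subtype.val (bL.sum_repr ⟨x, hx⟩)
    simp only [Submodule.coe_sum, Submodule.coe_smul] at this
    have h2 : ∀ i, (bL i : V) = l i := fun i => by simp [l]
    rw [← this]
    simp only [hsmul, h2, map_sum, map_smul, Module.Basis.repr_self, Finsupp.coe_finsetSum,
      Finset.sum_apply, Finsupp.smul_apply, smul_eq_mul]
    refine sum_mem fun j _ => mul_mem ⟨_, rfl⟩ ?_
    by_cases hij : j = i <;> simp [hij, one_mem]
  refine ⟨n, l, fun i => mem_latticeEnd.mpr fun p q => hl _ ?_ p⟩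
  have hstab : ∀ x ∈ L, T i x ∈ L := by
    intro x hx
    induction hx using Submodule.span_induction with
    | mem x hx =>
      obtain ⟨⟨k, j⟩, rfl⟩ := hx
      obtain ⟨c, hc⟩ := hT i k
      have : T i (w (k, j)) = ∑ m, c m • w (m, j) := by
        have := congrArg (fun f : Module.End K V => f (v j)) hc
        simpa only [w, LinearMap.sum_apply, hsmul, LinearMap.smul_apply, Module.End.mul_apply] using this
      rw [this]
      exact sum_mem fun m _ => Submodule.smul_mem _ _ (Submodule.subset_span ⟨(m, j), rfl⟩)
    | zero => simp
    | add x y _ _ hx hy => simpa using add_mem hx hy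
    | smul c x _ hx =>
      rw [hsmul, map_smul]
      exact Submodule.smul_mem _ c hx
  have : l q = bL q := by simp [l]
  rw [this]
  exact hstab _ (bL q).2

variable (O)

/-- The `K`-algebra `A` has an `O`-order whose trace dual is contained in `s⁻¹` times the order. -/
def HasOrder (s : K) (A : Type*) [Ring A] [Algebra K A] : Prop :=
  ∃ (n : ℕ) (a : Module.Basis (Fin n) K A) (b : Fin n → A), IsTraceDual (F := K) a b ∧
    (∀ i j k, a.repr (a i * a j) k ∈ (algebraMap O K).range) ∧
    ∀ i k, s * a.repr (b i) k ∈ (algebraMap O K).range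

/-- `C` is an `R`-order of `D` with traces in `R` whose trace dual is contained in `s⁻¹ C`. -/
structure IsTraceOrder (R : Subring K) (s : K) {D : Type*} [Ring D] [Algebra K D] (C : Subring D) :
    Prop where
  smul_mem : ∀ r ∈ R, ∀ x ∈ C, r • x ∈ C
  exists_smul_mem : ∀ x : D, ∃ r ∈ R, r ≠ 0 ∧ r • x ∈ C
  trace_mem : ∀ x ∈ C, regTrace K D x ∈ R
  dual_mem : ∀ x, (∀ c ∈ C, regTrace K D (x * c) ∈ R) → s • x ∈ C

variable {O}

theorem exists_commonDenominator [IsDomain O] [IsFractionRing O K] {ι : Type*} [Fintype ι]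
    (x : ι → K) : ∃ r : O, r ≠ 0 ∧ ∀ i, algebraMap O K r * x i ∈ (algebraMap O K).range := by
  obtain ⟨r, hr⟩ := IsLocalization.exist_integer_multiples_of_finite (nonZeroDivisors O) x
  refine ⟨r, nonZeroDivisors.ne_zero r.2, fun i => ?_⟩
  obtain ⟨y, hy⟩ := hr i
  exact ⟨y, by rw [hy, Algebra.smul_def]⟩

/-- An order in `A` gives an order in every algebra Brauer equivalent to `A`. -/
theorem HasOrder.exists_isTraceOrder [IsDomain O] [IsPrincipalIdealRing O] [IsFractionRing O K]
    [CharZero K] (hO : ∀ n : ℕ, n ≠ 0 → IsUnit (n : O))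
    {s : K} {A D : Type*} {V : Type*} [Ring A] [Algebra K A]
    [IsAzumaya K A] [Ring D] [Algebra K D] [IsAzumaya K D] [AddCommGroup V] [Module K V]
    [Module.Finite K V] (e : A ⊗[K] Dᵐᵒᵖ ≃ₐ[K] Module.End K V) (h : HasOrder O s A) :
    ∃ C : Subring D, IsTraceOrder (algebraMap O K).range s C := by
  obtain ⟨N, a, b, hab, hmul, hdual⟩ := h
  let α : A →ₐ[K] Module.End K V := e.toAlgHom.comp Algebra.TensorProduct.includeLeft
  let ρ : Dᵐᵒᵖ →ₐ[K] Module.End K V := e.toAlgHom.comp Algebra.TensorProduct.includeRight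
  have hαρ : ∀ x y, α x * ρ y = ρ y * α x := by
    intro x y
    simp [α, ρ, ← map_mul]
  -- the centraliser of `A`
  have hcent : ∀ f : Module.End K V, (∀ x, α x * f = f * α x) → ∃ c, ρ (op c) = f := by
    intro f hf
    obtain ⟨y, rfl⟩ := e.surjective f
    -- Since ∑ bᵢaᵢ = 1, `z` is `y` itself. Moving `a i` to the other side of `y`, which commutes
    -- with `A`, turns the sum into an average that lands in `1 ⊗ Dᵐᵒᵖ`.
    let z := ∑ i, (b i ⊗ₜ[K] (1 : Dᵐᵒᵖ)) * (a i ⊗ₜ[K] (1 : Dᵐᵒᵖ)) * y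
    have hz : z = y := by
      have h3 := hab.sum_mul_eq_one
      simp only [z, Algebra.TensorProduct.tmul_mul_tmul, mul_one, ← Finset.sum_mul,
        ← TensorProduct.sum_tmul, h3]
      rw [← Algebra.TensorProduct.one_def, one_mul]
    have hz' : ∃ c, y = 1 ⊗ₜ[K] c := by
      have h4 : ∀ y : A ⊗[K] Dᵐᵒᵖ, ∃ c, ∑ i, (b i ⊗ₜ[K] (1 : Dᵐᵒᵖ)) * y * (a i ⊗ₜ[K] (1 : Dᵐᵒᵖ)) =
          1 ⊗ₜ[K] c := by
        intro y
        induction y with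
        | zero => exact ⟨0, by simp⟩
        | add y z hy hz =>
          obtain ⟨c, hc⟩ := hy
          obtain ⟨c', hc'⟩ := hz
          refine ⟨c + c', ?_⟩
          simp only [mul_add, add_mul, Finset.sum_add_distrib, hc, hc', TensorProduct.tmul_add]
        | tmul x d =>
          obtain ⟨r, hr⟩ := exists_algebraMap_of_commute (F := K) (z := ∑ i, b i * x * a i)
            (fun y => by
              have := hab.casimir' ((LinearMap.mul K A).compl₁₂ (LinearMap.mulRight K x)
                LinearMap.id) y
              simpa [Finset.mul_sum, Finset.sum_mul, mul_assoc] using this)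
          refine ⟨r • d, ?_⟩
          simp only [Algebra.TensorProduct.tmul_mul_tmul, mul_one, one_mul,
            ← TensorProduct.sum_tmul]
          rw [← hr, Algebra.algebraMap_eq_smul_one, TensorProduct.smul_tmul]
      obtain ⟨c, hc⟩ := h4 y
      refine ⟨c, ?_⟩
      rw [← hc, ← hz]
      refine Finset.sum_congr rfl fun i _ => ?_
      rw [hz, mul_assoc, mul_assoc]
      congr 1
      apply e.injective
      simpa [α] using hf (a i)
    obtain ⟨c, rfl⟩ := hz'
    exact ⟨unop c, by simp [ρ]⟩
  -- the trace on `V` against the trace of `D`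
  have : Nontrivial A := (IsAzumaya.isSimpleRing (F := K) A).instNontrivial
  have : Nontrivial D := (IsAzumaya.isSimpleRing (F := K) D).instNontrivial
  have hV0 : Module.finrank K V ≠ 0 := by
    intro h0
    have h1 := e.toLinearEquiv.finrank_eq
    rw [Module.finrank_tensorProduct, Module.finrank_linearMap, h0, zero_mul,
      ← (opLinearEquiv K : D ≃ₗ[K] Dᵐᵒᵖ).finrank_eq] at h1
    exact (Nat.mul_pos (Module.finrank_pos (R := K) (M := A))
      (Module.finrank_pos (R := K) (M := D))).ne' h1
  have htr : ∀ x : D, (Module.finrank K D : K) * LinearMap.trace K V (ρ (op x)) =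
      Module.finrank K V * regTrace K D x := by
    intro x
    have := finrank_mul_of_map_mul_comm (F := K) (A := D)
      (LinearMap.trace K V ∘ₗ ρ.toLinearMap ∘ₗ (opLinearEquiv K : D ≃ₗ[K] Dᵐᵒᵖ).toLinearMap)
      (fun x y => by simp [LinearMap.trace_mul_comm]) x
    simpa using this
  have hunit : ∀ n : ℕ, n ≠ 0 → ∀ x : K, (n : K) * x ∈ (algebraMap O K).range →
      x ∈ (algebraMap O K).range := by
    rintro n hn x ⟨y, hy⟩
    obtain ⟨u, hu⟩ := (hO n hn).exists_right_inv
    refine ⟨u * y, ?_⟩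
    rw [map_mul, hy, ← mul_assoc]
    have := congrArg (algebraMap O K) hu
    simp only [map_mul, map_natCast, map_one] at this
    rw [mul_comm _ (n : K), this, one_mul]
  have hnat : ∀ n : ℕ, (n : K) ∈ (algebraMap O K).range := fun n => ⟨n, by simp⟩
  have hD0 : Module.finrank K D ≠ 0 := Module.finrank_pos.ne'
  -- The two traces are proportional with ratio a quotient of nonzero integers, which are units of
  -- `O`.
  have htr1 : ∀ x : D, LinearMap.trace K V (ρ (op x)) ∈ (algebraMap O K).range ↔
      regTrace K D x ∈ (algebraMap O K).range := by
    intro x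
    constructor
    · intro hx
      exact hunit _ hV0 _ (htr x ▸ mul_mem (hnat _) hx)
    · intro hx
      exact hunit _ hD0 _ ((htr x).symm ▸ mul_mem (hnat _) hx)
  obtain ⟨m, l, hl⟩ := exists_basis_mem_latticeEnd (O := O) (fun i => α (a i))
    (fun i j => by
      choose c hc using hmul i j
      refine ⟨c, ?_⟩
      rw [← map_mul]
      conv_lhs => rw [← a.sum_repr (a i * a j)]
      simp only [hc, map_sum, map_smul])
    (by
      rw [← map_one α, ← a.sum_repr 1, map_sum]
      refine sum_mem fun i _ => ?_
      rw [map_smul]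
      exact Submodule.smul_mem _ _ (Submodule.subset_span ⟨i, rfl⟩))
  have hscal : ∀ (r : O) (f : Module.End K V), f ∈ latticeEnd O l →
      algebraMap O K r • f ∈ latticeEnd O l := by
    intro r f hf
    rw [mem_latticeEnd] at hf ⊢
    intro i j
    rw [LinearMap.smul_apply, map_smul, Finsupp.smul_apply, smul_eq_mul]
    exact mul_mem ⟨r, rfl⟩ (hf i j)
  have hsb : ∀ i, s • α (b i) ∈ latticeEnd O l := by
    intro i
    have : s • α (b i) = ∑ k, (s * a.repr (b i) k) • α (a k) := by
      conv_lhs => rw [← a.sum_repr (b i)]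
      simp only [map_sum, map_smul, Finset.smul_sum, smul_smul]
    rw [this]
    refine sum_mem fun k _ => ?_
    obtain ⟨r, hr⟩ := hdual i k
    rw [← hr]
    exact hscal r _ (hl k)
  -- The part of `D` that preserves a lattice stable under the given order of `A`.
  let C : Subring D :=
    { carrier := {x | ρ (op x) ∈ latticeEnd O l}
      mul_mem' := fun {x y} hx hy => by
        simpa using mul_mem hy hx
      one_mem' := by simp [one_mem]
      add_mem' := fun {x y} hx hy => by
        simpa using add_mem hx hy
      zero_mem' := by simp [zero_mem]
      neg_mem' := fun {x} hx => by simpa using hx }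
  refine ⟨C, ⟨?_, fun x => ?_, fun x hx => ?_, fun x hx => ?_⟩⟩
  · rintro _ ⟨r, rfl⟩ x hx
    show ρ (op (algebraMap O K r • x)) ∈ latticeEnd O l
    rw [op_smul, map_smul]
    exact hscal r _ hx
  · obtain ⟨r, hr, hr'⟩ := exists_commonDenominator (O := O)
      (fun p : Fin m × Fin m => l.repr (ρ (op x) (l p.2)) p.1)
    refine ⟨_, ⟨r, rfl⟩,
      (map_ne_zero_iff _ (IsFractionRing.injective O K)).mpr hr, ?_⟩
    show ρ (op (algebraMap O K r • x)) ∈ latticeEnd O l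
    rw [op_smul, map_smul, mem_latticeEnd]
    intro i j
    rw [LinearMap.smul_apply, map_smul, Finsupp.smul_apply, smul_eq_mul]
    exact hr' (i, j)
  · exact (htr1 x).mp (trace_mem_of_mem_latticeEnd hx)
  · show ρ (op (s • x)) ∈ latticeEnd O l
    -- To test `s • x` against `g`, average `g` over the Casimir element of `A`, with the factor `s`
    -- making it integral. The average commutes with `A`, so it comes from some `c ∈ C`, and ∑ bᵢaᵢ
    -- = 1 identifies the trace of `x * c` with that of `s • x` against `g`.
    refine mem_latticeEnd_of_trace fun g hg => ?_
    have hf' : ∑ i, α (a i) * g * (s • α (b i)) ∈ latticeEnd O l :=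
      sum_mem fun i _ => mul_mem (mul_mem (hl i) hg) (hsb i)
    obtain ⟨c, hc⟩ := hcent (∑ i, α (a i) * g * (s • α (b i))) (fun y => by
      have := hab.casimir ((LinearMap.mul K (Module.End K V)).compl₁₂
        (LinearMap.mulRight K g ∘ₗ α.toLinearMap) (s • α.toLinearMap)) y
      simpa [Finset.mul_sum, Finset.sum_mul, mul_assoc] using this)
    have hcC : c ∈ C := by
      show ρ (op c) ∈ latticeEnd O l
      rw [hc]; exact hf'
    have h1 := (htr1 _).mpr (hx c hcC)
    convert h1 using 1
    have h5 : ∀ i, LinearMap.trace K V (ρ (op x) * (α (a i) * g * (s • α (b i)))) =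
        s • LinearMap.trace K V (ρ (op x) * (α (b i * a i) * g)) := by
      intro i
      have h6 : ρ (op x) * (α (a i) * g * (s • α (b i))) =
          s • ((ρ (op x) * (α (a i) * g)) * α (b i)) := by
        rw [mul_smul_comm, mul_smul_comm, ← mul_assoc]
      rw [h6, map_smul, LinearMap.trace_mul_comm, ← mul_assoc, hαρ, map_mul α, mul_assoc,
        mul_assoc]
    have h7 : ρ (op (x * c)) = ρ (op c) * ρ (op x) := by rw [op_mul, map_mul]
    rw [h7, LinearMap.trace_mul_comm K (ρ (op c)), hc, Finset.mul_sum, map_sum]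
    simp only [h5]
    rw [← Finset.smul_sum, ← map_sum, ← Finset.mul_sum, ← Finset.sum_mul, ← map_sum,
      hab.sum_mul_eq_one, map_one, one_mul, op_smul, map_smul, smul_mul_assoc, map_smul]

end Orders

/-! ### Orders in quaternion algebras and in Azumaya algebras. -/

section OrderConstructions

variable {O : Type u} [CommRing O] {K : Type u} [Field K] [Algebra O K]

theorem HasOrder.of_basis {s : K} {A ι : Type*} [Ring A] [Algebra K A] [Fintype ι] [DecidableEq ι]
    (a : Module.Basis ι K A) (b : ι → A) (hab : IsTraceDual (F := K) a b)
    (hmul : ∀ i j k, a.repr (a i * a j) k ∈ (algebraMap O K).range)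
    (hdual : ∀ i k, s * a.repr (b i) k ∈ (algebraMap O K).range) : HasOrder O s A := by
  let ε := Fintype.equivFin ι
  refine ⟨Fintype.card ι, a.reindex ε, b ∘ ε.symm, fun i j => ?_, fun i j k => ?_, fun i k => ?_⟩
  · simpa using hab (ε.symm i) (ε.symm j)
  · simpa using hmul (ε.symm i) (ε.symm j) (ε.symm k)
  · simpa using hdual (ε.symm i) (ε.symm k)

theorem regTrace_tmul {A B : Type*} [Ring A] [Algebra K A] [Ring B] [Algebra K B]
    [Module.Finite K A] [Module.Finite K B] (x : A) (y : B) :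
    regTrace K (A ⊗[K] B) (x ⊗ₜ y) = regTrace K A x * regTrace K B y := by
  rw [regTrace_apply, regTrace_apply, regTrace_apply, ← LinearMap.trace_tensorProduct']
  congr 1
  ext
  simp

theorem HasOrder.tensor {s s' : K} {A B : Type*} [Ring A] [Algebra K A] [Ring B] [Algebra K B]
    (hA : HasOrder O s A) (hB : HasOrder O s' B) : HasOrder O (s * s') (A ⊗[K] B) := by
  obtain ⟨n, a, b, hab, hmul, hdual⟩ := hA
  obtain ⟨n', a', b', hab', hmul', hdual'⟩ := hB
  have : Module.Finite K A := .of_basis a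
  have : Module.Finite K B := .of_basis a'
  refine HasOrder.of_basis (a.tensorProduct a') (fun p => b p.1 ⊗ₜ b' p.2) ?_ ?_ ?_
  · rintro ⟨i, i'⟩ ⟨j, j'⟩
    rw [Module.Basis.tensorProduct_apply, Algebra.TensorProduct.tmul_mul_tmul, regTrace_tmul,
      hab, hab']
    by_cases h : i = j <;> by_cases h' : i' = j' <;> simp [h, h']
  · rintro ⟨i, i'⟩ ⟨j, j'⟩ ⟨k, k'⟩
    simp only [Module.Basis.tensorProduct_apply, Algebra.TensorProduct.tmul_mul_tmul,
      Module.Basis.tensorProduct_repr_tmul_apply, smul_eq_mul]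
    exact mul_mem (hmul' _ _ _) (hmul _ _ _)
  · rintro ⟨i, i'⟩ ⟨k, k'⟩
    simp only [Module.Basis.tensorProduct_repr_tmul_apply, smul_eq_mul]
    convert mul_mem (hdual i k) (hdual' i' k') using 1
    ring

theorem basisOneIJK_eq (a b : K) : ⇑(QuaternionAlgebra.basisOneIJK a 0 b) =
    ![⟨1, 0, 0, 0⟩, ⟨0, 1, 0, 0⟩, ⟨0, 0, 1, 0⟩, ⟨0, 0, 0, 1⟩] := by
  funext j
  apply (QuaternionAlgebra.basisOneIJK a 0 b).repr.injective
  ext i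
  rw [Module.Basis.repr_self]
  fin_cases i <;> fin_cases j <;> simp

theorem regTrace_quaternion (a b : K) (x : QuaternionAlgebra K a 0 b) :
    regTrace K _ x = 4 * x.re := by
  rw [regTrace_apply, LinearMap.trace_eq_matrix_trace K (QuaternionAlgebra.basisOneIJK a 0 b),
    Matrix.trace, Fin.sum_univ_four]
  simp only [Matrix.diag_apply, LinearMap.toMatrix_apply, QuaternionAlgebra.coe_basisOneIJK_repr,
    basisOneIJK_eq]
  simp
  ring

/-- The trace is four times the real part, so the basis dual to 1, i, j, k is 1/4, i/(4e), j/(4p),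
-k/(4ep). The only factor in the denominators that need not be a unit is `p`. -/
theorem hasOrder_quaternion [CharZero K] (hO : ∀ n : ℕ, n ≠ 0 → IsUnit (n : O)) (e : Oˣ) (p : O)
    (hp : algebraMap O K p ≠ 0) : HasOrder O (algebraMap O K p)
      (QuaternionAlgebra K (algebraMap O K e) 0 (algebraMap O K p)) := by
  have he : algebraMap O K e ≠ 0 := (e.isUnit.map (algebraMap O K)).ne_zero
  have he' : (algebraMap O K e)⁻¹ ∈ (algebraMap O K).range := by
    refine ⟨↑e⁻¹, eq_inv_of_mul_eq_one_left ?_⟩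
    rw [← map_mul]; simp
  have h4 : (4 : K)⁻¹ ∈ (algebraMap O K).range := by
    obtain ⟨u, hu⟩ := (hO 4 (by norm_num)).exists_left_inv
    refine ⟨u, eq_inv_of_mul_eq_one_left ?_⟩
    have := congrArg (algebraMap O K) hu
    rw [map_mul, map_natCast, map_one] at this
    exact_mod_cast this
  have hpm : algebraMap O K p ∈ (algebraMap O K).range := ⟨p, rfl⟩
  have hem : algebraMap O K e ∈ (algebraMap O K).range := ⟨e, rfl⟩
  generalize algebraMap O K p = p at *
  generalize algebraMap O K (e : O) = e at *
  refine HasOrder.of_basis (QuaternionAlgebra.basisOneIJK e 0 p)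
    ![⟨4⁻¹, 0, 0, 0⟩, ⟨0, 4⁻¹ * e⁻¹, 0, 0⟩, ⟨0, 0, 4⁻¹ * p⁻¹, 0⟩, ⟨0, 0, 0, -(4⁻¹ * e⁻¹ * p⁻¹)⟩]
    ?_ ?_ ?_
  · intro i j
    rw [regTrace_quaternion, basisOneIJK_eq]
    fin_cases i <;> fin_cases j <;> simp <;> field_simp
  · intro i j k
    rw [basisOneIJK_eq, QuaternionAlgebra.coe_basisOneIJK_repr]
    fin_cases i <;> fin_cases j <;> fin_cases k <;>
      simp [-RingHom.mem_range, zero_mem, one_mem, hpm, hem, mul_mem]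
  · intro i k
    have h1 : p * (4⁻¹ * p⁻¹) = 4⁻¹ := by field_simp
    have h2 : p * (4⁻¹ * e⁻¹ * p⁻¹) = 4⁻¹ * e⁻¹ := by field_simp
    rw [QuaternionAlgebra.coe_basisOneIJK_repr]
    fin_cases i <;> fin_cases k <;>
      simp [-RingHom.mem_range, zero_mem, hpm, h4, he', mul_mem, h1, h2, -mul_inv_rev]

/-- Injectivity of `A ⊗ Aᵐᵒᵖ → End A` in coordinates; it makes the coefficients of a Casimir
identity unique. -/
theorem IsAzumaya.eq_zero_of_sum_mul_mul {F A ι : Type*} [CommRing F] [Ring A] [Algebra F A]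
    [IsAzumaya F A] [Fintype ι] (a : Module.Basis ι F A) (c : ι → A)
    (h : ∀ x, ∑ i, a i * x * c i = 0) : c = 0 := by
  have h0 : ∑ i, a i ⊗ₜ[F] op (c i) = 0 := by
    apply (IsAzumaya.bij (R := F) (A := A)).1
    ext x
    simpa [LinearMap.sum_apply] using h x
  have h1 := TensorProduct.sum_tmul_basis_left_eq_zero a
    (Finsupp.equivFunOnFinite.symm fun i => op (c i)) (by
      rw [Finsupp.sum_fintype _ _ (by simp)]
      simpa using h0)
  funext i
  simpa using DFunLike.congr_fun h1 i

theorem baseChange_repr_mem (A : Type u) [Ring A] [Algebra O A] {n : ℕ}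
    (B : Module.Basis (Fin n) O A) (x : A) (i : Fin n) :
    (B.baseChange K).repr (1 ⊗ₜ x) i ∈ (algebraMap O K).range := by
  rw [Module.Basis.baseChange_repr_tmul]
  exact ⟨B.repr x i, by rw [Algebra.smul_def, mul_one]⟩

variable [CharZero K]

/-- An Azumaya algebra is an order with unimodular trace form. -/
theorem exists_isTraceDual_baseChange (hO : ∀ n : ℕ, n ≠ 0 → IsUnit (n : O)) (A : Type u) [Ring A]
    [Algebra O A] [IsAzumaya O A] {n : ℕ} (B : Module.Basis (Fin n) O A) :
    ∃ b : Fin n → A, IsTraceDual (F := K) (B.baseChange K) (fun i => 1 ⊗ₜ b i) := by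
  have := isAzumaya_baseChange (R := O) K A
  have : Module.Free O A := .of_basis B
  have hbc : ∀ i, B.baseChange K i = 1 ⊗ₜ B i := fun i => by simp
  obtain ⟨b, hb⟩ := exists_isTraceDual (B.baseChange K)
  -- the trace as an element of the enveloping algebra
  obtain ⟨y, hy⟩ := (IsAzumaya.bij (R := O) (A := A)).2
    (LinearMap.toSpanSingleton O A 1 ∘ₗ LinearMap.trace O A ∘ₗ (Algebra.lmul O A).toLinearMap)
  obtain ⟨w, rfl⟩ := TensorProduct.eq_repr_basis_left B y
  have hw : ∀ x, ∑ i, B i * x * unop (w i) =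
      algebraMap O A (LinearMap.trace O A (Algebra.lmul O A x)) := by
    intro x
    have := congrArg (fun f : Module.End O A => f x) hy
    rw [Finsupp.sum_fintype _ _ (by simp)] at this
    simpa [LinearMap.sum_apply, Algebra.algebraMap_eq_smul_one] using this
  have htr : ∀ x : A, regTrace K (K ⊗[O] A) (1 ⊗ₜ x) =
      algebraMap O K (LinearMap.trace O A (Algebra.lmul O A x)) := by
    intro x
    rw [regTrace_apply, ← LinearMap.trace_baseChange]
    congr 1
    ext
    simp
  have hw' : ∀ X : K ⊗[O] A, ∑ i, B.baseChange K i * X * (1 ⊗ₜ unop (w i)) =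
      algebraMap K (K ⊗[O] A) (regTrace K (K ⊗[O] A) X) := by
    intro X
    induction X with
    | zero => simp
    | add X Y hX hY => simp only [mul_add, add_mul, Finset.sum_add_distrib, hX, hY, map_add]
    | tmul c x =>
      have h1 : (c ⊗ₜ[O] x : K ⊗[O] A) = c • (1 ⊗ₜ x) := by
        rw [TensorProduct.smul_tmul', smul_eq_mul, mul_one]
      rw [h1, map_smul, smul_eq_mul, htr]
      simp only [hbc, mul_smul_comm, smul_mul_assoc, ← Finset.smul_sum,
        Algebra.TensorProduct.tmul_mul_tmul, mul_one, ← TensorProduct.tmul_sum, hw]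
      rw [map_mul, ← Algebra.smul_def c]
      congr 1
      rw [Algebra.algebraMap_eq_smul_one, ← TensorProduct.smul_tmul,
        Algebra.TensorProduct.algebraMap_apply, Algebra.smul_def, mul_one]
      rfl
  have hN := finrank_ne_zero (F := K) (A := K ⊗[O] A)
  obtain ⟨u, hu⟩ := (hO (Module.finrank K (K ⊗[O] A)) (by exact_mod_cast hN)).exists_left_inv
  have hu' : algebraMap O K u = (Module.finrank K (K ⊗[O] A) : K)⁻¹ := by
    refine eq_inv_of_mul_eq_one_left ?_
    have := congrArg (algebraMap O K) hu
    simpa only [map_mul, map_natCast, map_one] using this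
  refine ⟨fun i => u • unop (w i), ?_⟩
  -- The integral coefficients `w i` represent the trace, whereas the dual basis `b` represents the
  -- trace divided by the dimension. By uniqueness `b i` is `w i` over the dimension, hence
  -- integral.
  have hz := IsAzumaya.eq_zero_of_sum_mul_mul (B.baseChange K)
    (fun i => (1 ⊗ₜ[O] (u • unop (w i)) : K ⊗[O] A) - b i) (by
      intro X
      have h1 := hw' X
      have h2 := hb.sum_mul_mul X
      simp only [mul_sub, Finset.sum_sub_distrib, h2]
      have h3 : ∀ i, (1 ⊗ₜ[O] (u • unop (w i)) : K ⊗[O] A) =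
          algebraMap O K u • (1 ⊗ₜ[O] unop (w i)) := by
        intro i
        rw [TensorProduct.smul_tmul', smul_eq_mul, mul_one, ← TensorProduct.smul_tmul,
          Algebra.smul_def, mul_one]
      simp only [h3, mul_smul_comm, ← Finset.smul_sum, h1]
      rw [hu', Algebra.smul_def, ← map_mul, sub_self])
  have hb' : (fun i => (1 ⊗ₜ[O] (u • unop (w i)) : K ⊗[O] A)) = b := by
    funext i
    exact sub_eq_zero.mp (congrFun hz i)
  rw [hb']
  exact hb

variable [IsDomain O] [IsPrincipalIdealRing O]

theorem hasOrder_baseChange (hO : ∀ n : ℕ, n ≠ 0 → IsUnit (n : O)) (A : Type u) [Ring A]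
    [Algebra O A] [IsAzumaya O A] : HasOrder O (1 : K) (K ⊗[O] A) := by
  have : Module.IsTorsionFree O A := inferInstance
  have : Module.Free O A := inferInstance
  let B := Module.finBasis O A
  obtain ⟨b, hb⟩ := exists_isTraceDual_baseChange (K := K) hO A B
  refine ⟨_, B.baseChange K, _, hb, fun i j k => ?_, fun i k => ?_⟩
  · have : B.baseChange K i * B.baseChange K j = 1 ⊗ₜ (B i * B j) := by simp
    rw [this]
    exact baseChange_repr_mem A B _ k
  · rw [one_mul]
    exact baseChange_repr_mem A B _ k

variable [IsFractionRing O K]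

/-- The order defined by an Azumaya algebra over `O` with class `β` in the algebra `D`. -/
theorem exists_isTraceOrder_of_mem_range (hO : ∀ n : ℕ, n ≠ 0 → IsUnit (n : O)) (D : AzumayaAlg K)
    (h : Br.mk D ∈ (Br.baseChange O K).range) :
    ∃ C : Subring D.carrier, IsTraceOrder (algebraMap O K).range (1 : K) C := by
  obtain ⟨β, hβ⟩ := h
  obtain ⟨A, rfl⟩ := Br.exists_rep β
  rw [← Br.mk_baseChange] at hβ
  obtain ⟨V, _, _, _, ⟨e⟩⟩ := Br.exists_algEquiv_end_of_eq hβ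
  have := (A.baseChange K).isAzumaya
  exact HasOrder.exists_isTraceOrder hO e (hasOrder_baseChange hO A.carrier)

theorem isUnit_two_field {K : Type*} [Field K] [CharZero K] : IsUnit (2 : K) := two_ne_zero.isUnit

/-- The class is that of an Azumaya algebra tensored with a quaternion algebra, whose orders have
discrepancies 1 and `p`. The product bound `p` is then carried over to `D`. -/
theorem exists_isTraceOrder_of_sub_mem_range (hO : ∀ n : ℕ, n ≠ 0 → IsUnit (n : O))
    (D : AzumayaAlg K) (e : Oˣ) (p : O) (u v : Kˣ) (hu : (u : K) = algebraMap O K e)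
    (hv : (v : K) = algebraMap O K p)
    (h : Br.mk D - quaternionClass isUnit_two_field u v ∈ (Br.baseChange O K).range) :
    ∃ C : Subring D.carrier, IsTraceOrder (algebraMap O K).range (algebraMap O K p) C := by
  obtain ⟨β, hβ⟩ := h
  obtain ⟨A, rfl⟩ := Br.exists_rep β
  rw [← Br.mk_baseChange, eq_sub_iff_add_eq] at hβ
  have := isAzumaya_quaternion isUnit_two_field u v
  have hβ' : Br.mk ((A.baseChange K).tensor ⟨QuaternionAlgebra K (u : K) 0 (v : K)⟩) = Br.mk D := hβ
  obtain ⟨V, _, _, _, ⟨f⟩⟩ := Br.exists_algEquiv_end_of_eq hβ'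
  have := ((A.baseChange K).tensor ⟨QuaternionAlgebra K (u : K) 0 (v : K)⟩).isAzumaya
  refine HasOrder.exists_isTraceOrder hO f ?_
  have h1 := hasOrder_quaternion (K := K) hO e p (hv ▸ v.ne_zero)
  rw [← hu, ← hv] at h1
  have h2 := (hasOrder_baseChange (K := K) hO A.carrier).tensor h1
  rw [one_mul] at h2
  rw [← hv]
  exact h2

end OrderConstructions

/-! ### Injectivity of the Brauer group of a principal ideal domain. -/

section Injectivity

variable {O : Type u} [CommRing O] {K : Type u} [Field K] [Algebra O K]
  [IsDomain O] [IsPrincipalIdealRing O] [IsFractionRing O K] [CharZero K]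

/-- The Brauer group of a principal ideal domain injects into that of its fraction field. -/
theorem Br.baseChange_injective (hO : ∀ n : ℕ, n ≠ 0 → IsUnit (n : O)) :
    Function.Injective (Br.baseChange O K) := by
  rw [injective_iff_map_eq_zero]
  intro β hβ
  obtain ⟨A, rfl⟩ := Br.exists_rep β
  rw [← Br.mk_baseChange] at hβ
  obtain ⟨V, _, _, _, ⟨e⟩⟩ := Br.exists_algEquiv_end hβ
  change (K ⊗[O] A.carrier) ≃ₐ[K] Module.End K V at e
  have := isAzumaya_baseChange (R := O) K A.carrier
  have : Nontrivial (K ⊗[O] A.carrier) :=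
    (IsAzumaya.isSimpleRing (F := K) (K ⊗[O] A.carrier)).instNontrivial
  have : Module.Free O A.carrier := inferInstance
  let B := Module.finBasis O A.carrier
  obtain ⟨b, hb⟩ := exists_isTraceDual_baseChange (K := K) hO A.carrier B
  have hbc : ∀ i, B.baseChange K i = 1 ⊗ₜ B i := fun i => by simp
  have hinc : ∀ x, (1 ⊗ₜ x : K ⊗[O] A.carrier) =
      ∑ i, algebraMap O K (B.repr x i) • B.baseChange K i := by
    intro x
    rw [← (B.baseChange K).sum_repr (1 ⊗ₜ x)]
    refine Finset.sum_congr rfl fun i _ => ?_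
    rw [Module.Basis.baseChange_repr_tmul, Algebra.algebraMap_eq_smul_one]
  obtain ⟨m, l, hl⟩ := exists_basis_mem_latticeEnd (O := O) (fun i => e (B.baseChange K i))
    (fun i j => by
      refine ⟨B.repr (B i * B j), ?_⟩
      rw [← map_mul, hbc, hbc, Algebra.TensorProduct.tmul_mul_tmul, mul_one, hinc]
      simp only [map_sum, map_smul])
    (by
      rw [← map_one e, ← (B.baseChange K).sum_repr 1, map_sum]
      refine sum_mem fun i _ => ?_
      rw [map_smul]
      exact Submodule.smul_mem _ _ (Submodule.subset_span ⟨i, rfl⟩))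
  have hA : ∀ x, e (1 ⊗ₜ x) ∈ latticeEnd O l := by
    intro x
    rw [hinc, map_sum]
    refine sum_mem fun i _ => ?_
    rw [map_smul, mem_latticeEnd]
    intro p q
    rw [LinearMap.smul_apply, map_smul, Finsupp.smul_apply, smul_eq_mul]
    exact mul_mem ⟨_, rfl⟩ (mem_latticeEnd.mp (hl i) p q)
  have hV0 : Module.finrank K V ≠ 0 := by
    intro h0
    have h1 := e.toLinearEquiv.finrank_eq
    rw [Module.finrank_linearMap, h0, zero_mul] at h1
    exact Module.finrank_pos.ne' h1
  have htr : ∀ X, e X ∈ latticeEnd O l → regTrace K (K ⊗[O] A.carrier) X ∈ (algebraMap O K).range := by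
    intro X hX
    have h1 := finrank_mul_of_map_mul_comm (F := K) (A := K ⊗[O] A.carrier)
      (LinearMap.trace K V ∘ₗ e.toLinearMap)
      (fun x y => by simp [LinearMap.trace_mul_comm]) X
    simp only [LinearMap.comp_apply, AlgEquiv.toLinearMap_apply, map_one, LinearMap.trace_one] at h1
    obtain ⟨y, hy⟩ := trace_mem_of_mem_latticeEnd hX
    obtain ⟨u, hu⟩ := (hO _ hV0).exists_left_inv
    refine ⟨u * ((Module.finrank K (K ⊗[O] A.carrier) : ℕ) : O) * y, ?_⟩
    have hu' := congrArg (algebraMap O K) hu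
    rw [map_mul, map_natCast, map_one] at hu'
    rw [map_mul, map_mul, map_natCast, hy, mul_assoc, h1, ← mul_assoc, hu', one_mul]
  -- The trace-dual basis of `A` is integral, so the coordinates of `X` are traces of endomorphisms
  -- that preserve the lattice. Hence `A` is the full endomorphism ring of the lattice, a matrix
  -- algebra over `O`.
  have hfull : ∀ X, e X ∈ latticeEnd O l → ∃ x, X = 1 ⊗ₜ x := by
    intro X hX
    have h1 : ∀ i, ∃ r, algebraMap O K r = (B.baseChange K).repr X i := by
      intro i
      rw [hb.repr_apply]
      exact htr _ (by rw [map_mul]; exact mul_mem hX (hA _))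
    choose r hr using h1
    refine ⟨∑ i, r i • B i, ?_⟩
    rw [← (B.baseChange K).sum_repr X, TensorProduct.tmul_sum]
    refine Finset.sum_congr rfl fun i _ => ?_
    rw [← hr, hbc, TensorProduct.smul_tmul', smul_eq_mul, mul_one, ← TensorProduct.smul_tmul,
      Algebra.smul_def, mul_one]
  have hOK : Function.Injective (algebraMap O K) := IsFractionRing.injective O K
  let g : Matrix (Fin m) (Fin m) O →+* Matrix (Fin m) (Fin m) K := (algebraMap O K).mapMatrix
  have hg : Function.Injective g := Matrix.map_injective hOK
  let f : A.carrier →+* Matrix (Fin m) (Fin m) K :=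
    ((LinearMap.toMatrixAlgEquiv l).toRingHom.comp e.toRingHom).comp
      (Algebra.TensorProduct.includeRight (R := O) (A := K) (B := A.carrier)).toRingHom
  have hf_apply : ∀ x, f x = LinearMap.toMatrixAlgEquiv l (e (1 ⊗ₜ x)) := fun x => rfl
  have hf : Function.Injective f := by
    intro x y hxy
    rw [hf_apply, hf_apply] at hxy
    exact Algebra.TensorProduct.includeRight_injective hOK
      (e.injective ((LinearMap.toMatrixAlgEquiv l).injective hxy))
  have hfg : ∀ x, ∃ M, g M = f x := fun x => hA x
  choose φ hφ using hfg
  have hφb : Function.Bijective φ := by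
    constructor
    · intro x y hxy
      exact hf (by rw [← hφ, ← hφ, hxy])
    · intro M
      obtain ⟨X, hX⟩ := ((e.toEquiv).trans (LinearMap.toMatrixAlgEquiv l).toEquiv).surjective (g M)
      have hX' : LinearMap.toMatrixAlgEquiv l (e X) = g M := hX
      obtain ⟨x, rfl⟩ := hfull X ⟨M, hX'.symm⟩
      exact ⟨x, hg (by rw [hφ, hf_apply, hX'])⟩
  let φ' : A.carrier →ₐ[O] Matrix (Fin m) (Fin m) O :=
    { toFun := φ
      map_one' := hg (by rw [hφ, map_one, map_one])
      map_mul' := fun x y => hg (by rw [hφ, map_mul, map_mul, hφ, hφ])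
      map_zero' := hg (by rw [hφ, map_zero, map_zero])
      map_add' := fun x y => hg (by rw [hφ, map_add, map_add, hφ, hφ])
      commutes' := fun r => hg (by
        rw [hφ, hf_apply]
        have h1 : (1 ⊗ₜ algebraMap O A.carrier r : K ⊗[O] A.carrier) =
            algebraMap K _ (algebraMap O K r) := by
          rw [Algebra.algebraMap_eq_smul_one, ← TensorProduct.smul_tmul,
            Algebra.TensorProduct.algebraMap_apply, Algebra.smul_def, mul_one]
          rfl
        rw [h1, AlgEquiv.commutes, AlgEquiv.commutes]
        ext i j
        by_cases hij : i = j <;> simp [g, Matrix.algebraMap_matrix_apply, hij]) }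
  have hm : NeZero m := ⟨by
    rintro rfl
    exact hV0 (Module.finrank_eq_card_basis l)⟩
  exact Br.mk_eq_zero_of_algEquiv_end ⟨Fin m → O⟩
    ((AlgEquiv.ofBijective φ' hφb).trans Matrix.toLinAlgEquiv')

end Injectivity

/-! ### Quaternion symbols with nontrivial residue. -/

section Uniqueness

variable {O : Type u} [CommRing O] {K : Type u} [Field K] [Algebra O K]
  [IsDomain O] [IsDiscreteValuationRing O] [IsFractionRing O K] [CharZero K]

/-- The class `(d, p)` is ramified if `p` is a uniformizer and the unit `d` is not a square in the
residue field. -/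
theorem quaternionClass_notMem_range (hO : ∀ n : ℕ, n ≠ 0 → IsUnit (n : O)) (d : Oˣ) {p : O}
    (hp : Irreducible p) (hd : ∀ x y : O, p ∣ x ^ 2 - d * y ^ 2 → p ∣ x ∧ p ∣ y) (u v : Kˣ)
    (hu : (u : K) = algebraMap O K d) (hv : (v : K) = algebraMap O K p) :
    quaternionClass isUnit_two_field u v ∉ (Br.baseChange O K).range := by
  intro h
  have := isAzumaya_quaternion isUnit_two_field u v
  obtain ⟨C, hC⟩ : ∃ C : Subring (QuaternionAlgebra K (u : K) 0 (v : K)), IsTraceOrder (algebraMap O K).range (1 : K) C :=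
    exists_isTraceOrder_of_mem_range hO ⟨QuaternionAlgebra K (u : K) 0 (v : K)⟩ h
  clear h
  have hOK : Function.Injective (algebraMap O K) := IsFractionRing.injective O K
  have hu0 := u.ne_zero
  have hv0 := v.ne_zero
  generalize (u : K) = u at *
  generalize (v : K) = v at *
  have hdiv : ∀ n : ℕ, n ≠ 0 → ∀ x : K, (n : K) * x ∈ (algebraMap O K).range →
      x ∈ (algebraMap O K).range := by
    rintro n hn x ⟨y, hy⟩
    obtain ⟨w, hw⟩ := (hO n hn).exists_right_inv
    refine ⟨w * y, ?_⟩
    rw [map_mul, hy, ← mul_assoc]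
    have := congrArg (algebraMap O K) hw
    simp only [map_mul, map_natCast, map_one] at this
    rw [mul_comm _ (n : K), this, one_mul]
  have hre : ∀ x ∈ C, x.re ∈ (algebraMap O K).range := by
    intro x hx
    have := hC.trace_mem x hx
    rw [regTrace_quaternion] at this
    exact hdiv 4 (by norm_num) _ (by exact_mod_cast this)
  have hN : ∀ x ∈ C, x.re ^ 2 - u * x.imI ^ 2 - v * (x.imJ ^ 2 - u * x.imK ^ 2) ∈
      (algebraMap O K).range := by
    intro x hx
    have h1 := hre _ (mul_mem hx hx)
    have h2 := hre x hx
    have h3 : x.re ^ 2 - u * x.imI ^ 2 - v * (x.imJ ^ 2 - u * x.imK ^ 2) =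
        2 * (x.re * x.re) - (x * x).re := by
      simp; ring
    rw [h3]
    exact sub_mem (mul_mem ⟨2, map_ofNat (algebraMap O K) 2⟩ (mul_mem h2 h2)) h1
  -- the order is contained in the standard order
  have hdesc : ∀ (n : ℕ) (x : QuaternionAlgebra K u 0 v) (y₀ y₁ y₂ y₃ : O),
      x.re ^ 2 - u * x.imI ^ 2 - v * (x.imJ ^ 2 - u * x.imK ^ 2) ∈ (algebraMap O K).range →
      v ^ n * x.re = algebraMap O K y₀ → v ^ n * x.imI = algebraMap O K y₁ →
      v ^ n * x.imJ = algebraMap O K y₂ → v ^ n * x.imK = algebraMap O K y₃ →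
      x.imJ ∈ (algebraMap O K).range := by
    intro n
    induction n with
    | zero => intro x y₀ y₁ y₂ y₃ _ _ _ h2 _; exact ⟨y₂, by rw [← h2]; simp⟩
    | succ n ih =>
      rintro x y₀ y₁ y₂ y₃ ⟨z, hz⟩ h0 h1 h2 h3
      -- The integral norm after clearing denominators. Both sides are read modulo p², and
      -- anisotropy of x² - dy² modulo p shows that p divides y₀, y₁ and then y₂, y₃, so the
      -- exponent of the denominator drops by one.
      have hrel : y₀ ^ 2 - d * y₁ ^ 2 - p * (y₂ ^ 2 - d * y₃ ^ 2) = p ^ (2 * (n + 1)) * z := by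
        apply hOK
        simp only [map_sub, map_mul, map_pow, ← h0, ← h1, ← h2, ← h3, hz, ← hu, ← hv]
        ring
      have hp2 : p ^ 2 ∣ p ^ (2 * (n + 1)) * z :=
        Dvd.dvd.mul_right (pow_dvd_pow p (by omega)) z
      have hA := hd y₀ y₁ (by
        have : y₀ ^ 2 - d * y₁ ^ 2 = p ^ (2 * (n + 1)) * z + p * (y₂ ^ 2 - d * y₃ ^ 2) := by
          rw [← hrel]; ring
        rw [this]
        exact dvd_add ((dvd_pow_self p two_ne_zero).trans hp2) (Dvd.intro _ rfl))
      obtain ⟨⟨t₀, rfl⟩, ⟨t₁, rfl⟩⟩ := hA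
      have hB := hd y₂ y₃ (by
        have : p * p ∣ p * (y₂ ^ 2 - d * y₃ ^ 2) := by
          have h4 : p * (y₂ ^ 2 - d * y₃ ^ 2) =
              p ^ 2 * (t₀ ^ 2 - d * t₁ ^ 2) - p ^ (2 * (n + 1)) * z := by
            rw [← hrel]; ring
          rw [h4, ← pow_two]
          exact dvd_sub (Dvd.intro _ rfl) hp2
        exact (mul_dvd_mul_iff_left hp.ne_zero).mp this)
      obtain ⟨⟨t₂, rfl⟩, ⟨t₃, rfl⟩⟩ := hB
      have hcancel : ∀ a (t : O), v ^ (n + 1) * a = algebraMap O K (p * t) →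
          v ^ n * a = algebraMap O K t := by
        intro a t ht
        rw [map_mul, ← hv, pow_succ', mul_assoc] at ht
        exact mul_left_cancel₀ hv0 ht
      exact ih x t₀ t₁ t₂ t₃ ⟨z, hz⟩ (hcancel _ _ h0) (hcancel _ _ h1) (hcancel _ _ h2)
        (hcancel _ _ h3)
  have hJ : ∀ x ∈ C, x.imJ ∈ (algebraMap O K).range := by
    intro x hx
    obtain ⟨r, hr0, hr⟩ := exists_commonDenominator (O := O) ![x.re, x.imI, x.imJ, x.imK]
    obtain ⟨n, w, hw⟩ := IsDiscreteValuationRing.eq_unit_mul_pow_irreducible hr0 hp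
    have hr' : ∀ i, v ^ n * ![x.re, x.imI, x.imJ, x.imK] i ∈ (algebraMap O K).range := by
      intro i
      obtain ⟨y, hy⟩ := hr i
      refine ⟨↑w⁻¹ * y, ?_⟩
      have : algebraMap O K ↑w⁻¹ * algebraMap O K ↑w = 1 := by rw [← map_mul]; simp
      rw [map_mul, hy, hw, map_mul, map_pow, ← hv, ← mul_assoc, ← mul_assoc, this, one_mul]
    obtain ⟨y₀, h0⟩ := hr' 0
    obtain ⟨y₁, h1⟩ := hr' 1
    obtain ⟨y₂, h2⟩ := hr' 2
    obtain ⟨y₃, h3⟩ := hr' 3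
    exact hdesc n x y₀ y₁ y₂ y₃ (hN x hx) h0.symm h1.symm h2.symm h3.symm
  -- The trace of v⁻¹j against `c` is `4 * c.imJ`, which is integral. Duality puts v⁻¹j in the
  -- order, although its own `imJ` is not integral.
  have h1 := hC.dual_mem ⟨0, 0, v⁻¹, 0⟩ (by
    intro c hc
    rw [regTrace_quaternion]
    simp only [QuaternionAlgebra.re_mul]
    obtain ⟨y, hy⟩ := hJ c hc
    refine ⟨4 * y, ?_⟩
    rw [map_mul, hy, map_ofNat (algebraMap O K) 4]
    simp [hv0])
  rw [one_smul] at h1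
  obtain ⟨y, hy⟩ := hJ _ h1
  refine hp.not_isUnit (IsUnit.of_mul_eq_one y (hOK ?_))
  rw [map_mul, ← hv, hy, map_one, mul_inv_cancel₀ hv0]

end Uniqueness

/-! ### Lattice reduction on the projective line. -/

section Reduction

variable {K : Type u} [Field K]

/-- `P` and `R` behave like `k[t]` and the local ring at infinity in `k(t)`. -/
structure IsComplementary (P R : Subring K) (t : K) : Prop where
  ne_zero : t ≠ 0
  mem : t ∈ P
  inv_mem : t⁻¹ ∈ R
  eq_zero : ∀ f ∈ P, t * f ∈ R → f = 0
  exists_sub : ∀ f : K, ∃ q ∈ P, t * (f - q) ∈ R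
  exists_pow : ∀ f : K, ∃ n : ℕ, t⁻¹ ^ n * f ∈ R

variable {P R : Subring K} {t : K}

theorem IsComplementary.zpow_mem_left (h : IsComplementary P R t) {n : ℤ} (hn : 0 ≤ n) :
    t ^ n ∈ P := by
  lift n to ℕ using hn
  rw [zpow_natCast]
  exact pow_mem h.mem n

theorem IsComplementary.zpow_mem_right (h : IsComplementary P R t) {n : ℤ} (hn : n ≤ 0) :
    t ^ n ∈ R := by
  obtain ⟨m, rfl⟩ : ∃ m : ℕ, n = -(m : ℤ) := ⟨n.natAbs, by omega⟩
  rw [zpow_neg, zpow_natCast, ← inv_pow]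
  exact pow_mem h.inv_mem m

/-- The polynomial part of a function regular at infinity is again regular there. It plays the role
of the value at infinity. -/
theorem IsComplementary.exists_const (h : IsComplementary P R t) {f : K} (hf : f ∈ R) :
    ∃ c ∈ P, c ∈ R ∧ t * (f - c) ∈ R := by
  obtain ⟨q, hq, hq'⟩ := h.exists_sub f
  refine ⟨q, hq, ?_, hq'⟩
  have h1 := sub_mem hf (mul_mem h.inv_mem hq')
  rwa [inv_mul_cancel_left₀ h.ne_zero, sub_sub_cancel] at h1

variable {D : Type*} [Ring D] [Algebra K D] {M C : Subring D} {s : K}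

theorem smul_mem_of_le (hPR : IsComplementary P R t) (hC : IsTraceOrder R s C) {m n : ℤ}
    (hmn : m ≤ n) {x : D} (hx : t ^ (-m) • x ∈ C) : t ^ (-n) • x ∈ C := by
  have := hC.smul_mem (t ^ (m - n)) (hPR.zpow_mem_right (by omega)) _ hx
  rwa [smul_smul, ← zpow_add₀ hPR.ne_zero, show m - n + -m = -n by ring] at this

theorem exists_zpow_smul_mem (hPR : IsComplementary P R t) (hC : IsTraceOrder R s C) (x : D) :
    ∃ n : ℤ, t ^ (-n) • x ∈ C := by
  obtain ⟨r, _, hr0, hr⟩ := hC.exists_smul_mem x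
  obtain ⟨n, hn⟩ := hPR.exists_pow r⁻¹
  refine ⟨n, ?_⟩
  have := hC.smul_mem _ hn _ hr
  rwa [smul_smul, mul_assoc, inv_mul_cancel₀ hr0, mul_one, inv_pow, ← zpow_natCast,
    ← zpow_neg] at this

variable [CharZero K] [IsAzumaya K D]

theorem eq_zero_of_regTrace_mul {ι : Type*} [Finite ι] (y : Module.Basis ι K D) {x : D}
    (h : ∀ i, regTrace K D (x * y i) = 0) : x = 0 := by
  have h1 : ∀ z, regTrace K D (x * z) = 0 := by
    intro z
    have : Fintype ι := Fintype.ofFinite ι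
    rw [← y.sum_repr z]
    simp only [Finset.mul_sum, mul_smul_comm, map_sum, map_smul, h, smul_zero,
      Finset.sum_const_zero]
  obtain ⟨b, hb⟩ := exists_isTraceDual (Module.finBasis K D)
  rw [← hb.sum_left x]
  simp only [h1, zero_smul, Finset.sum_const_zero]

/-- The nonzero elements of `M` have bounded order along the filtration `tⁿ C`. -/
theorem exists_bound (hPR : IsComplementary P R t) (hM : IsTraceOrder P (1 : K) M)
    (hC : IsTraceOrder R s C) : ∃ n : ℤ, ∀ x ∈ M, ∀ m ≤ n, t ^ (-m) • x ∈ C → x = 0 := by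
  let y := Module.finBasis K D
  choose r hrP hr0 hr using fun i => hM.exists_smul_mem (y i)
  choose n hn using fun i => exists_zpow_smul_mem hPR hC (r i • y i)
  obtain ⟨N, hN⟩ : ∃ N : ℤ, ∀ i, n i ≤ N := by
    obtain ⟨N, hN⟩ := (Set.finite_range n).bddAbove
    exact ⟨N, fun i => hN ⟨i, rfl⟩⟩
  -- The extra one forces the trace of `x` against each `r i • y i` to be an element of `P` that
  -- vanishes at infinity, hence zero.
  refine ⟨-(N + 1), fun x hx m hm hxC => eq_zero_of_regTrace_mul y fun i => ?_⟩
  have h1 : regTrace K D (x * (r i • y i)) ∈ P := hM.trace_mem _ (mul_mem hx (hr i))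
  have h2 := hC.trace_mem _ (mul_mem (smul_mem_of_le hPR hC hm hxC)
    (smul_mem_of_le hPR hC (hN i) (hn i)))
  rw [smul_mul_smul_comm, map_smul, ← zpow_add₀ hPR.ne_zero,
    show -(-(N + 1)) + -N = (1 : ℤ) by ring, zpow_one, smul_eq_mul] at h2
  have h3 := hPR.eq_zero _ h1 h2
  rw [mul_smul_comm, map_smul, smul_eq_mul, mul_eq_zero] at h3
  exact h3.resolve_left (hr0 i)

/-- A greedy choice of elements of `M` of smallest possible order along the filtration `tⁿ C`. -/
theorem exists_greedy (hPR : IsComplementary P R t) (hM : IsTraceOrder P (1 : K) M)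
    (hC : IsTraceOrder R s C) (N : ℕ) (hN : N ≤ Module.finrank K D) :
    ∃ (e : ℕ → D) (a : ℕ → ℤ), LinearIndependent K (fun i : Fin N => e i) ∧
      ∀ i < N, e i ∈ M ∧ t ^ (-a i) • e i ∈ C ∧ (∀ j ≤ i, a j ≤ a i) ∧
        ∀ x ∈ M, ∀ m < a i, t ^ (-m) • x ∈ C → x ∈ Submodule.span K (e '' Set.Iio i) := by
  classical
  induction N with
  | zero => exact ⟨0, 0, linearIndependent_empty_type, fun i hi => absurd hi (by omega)⟩
  | succ N ih =>
    obtain ⟨e, a, hli, hea⟩ := ih (by omega)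
    obtain ⟨n₀, hn₀⟩ := exists_bound hPR hM hC
    let S := Submodule.span K (e '' Set.Iio N)
    have hrange : e '' Set.Iio N = Set.range fun i : Fin N => e i := by
      ext x
      exact ⟨fun ⟨i, hi, h⟩ => ⟨⟨i, hi⟩, h⟩, fun ⟨i, h⟩ => ⟨i, i.2, h⟩⟩
    have hS : S = Submodule.span K (Set.range fun i : Fin N => e i) :=
      congrArg (Submodule.span K) hrange
    have hex : ∃ x ∈ M, x ∉ S := by
      by_contra hcon
      push Not at hcon
      have htop : S = ⊤ := by
        rw [eq_top_iff]
        intro x _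
        obtain ⟨r, _, hr0, hr⟩ := hM.exists_smul_mem x
        exact (S.smul_mem_iff hr0).mp (hcon _ hr)
      have h1 := finrank_span_eq_card hli
      rw [← hS, htop, finrank_top, Fintype.card_fin] at h1
      omega
    obtain ⟨x₁, hx₁, hx₁S⟩ := hex
    obtain ⟨n₁, hn₁⟩ := exists_zpow_smul_mem hPR hC x₁
    -- Orders of nonzero elements of `M` are bounded below, so among the elements outside the span
    -- chosen so far one has least order.
    obtain ⟨m, ⟨y, hyM, hyS, hyC⟩, hmin⟩ := Int.exists_least_of_bdd
      (P := fun m => ∃ x ∈ M, x ∉ S ∧ t ^ (-m) • x ∈ C)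
      ⟨n₀, fun m ⟨x, hx, hxS, hxC⟩ => by
        by_contra hlt
        have := hn₀ x hx m (by omega) hxC
        exact hxS (this ▸ S.zero_mem)⟩
      ⟨n₁, x₁, hx₁, hx₁S, hn₁⟩
    have hup : ∀ i < N, Function.update e N y i = e i := fun i hi =>
      Function.update_of_ne (by omega) _ _
    have hupa : ∀ i < N, Function.update a N m i = a i := fun i hi =>
      Function.update_of_ne (by omega) _ _
    have himg : ∀ i ≤ N, Function.update e N y '' Set.Iio i = e '' Set.Iio i := fun i hi =>
      Set.image_congr fun j hj => hup j (by simp at hj; omega)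
    refine ⟨Function.update e N y, Function.update a N m, ?_, fun i hi => ?_⟩
    · have hinit : Fin.init (fun i : Fin (N + 1) => Function.update e N y i) =
          fun i : Fin N => e i := funext fun i => hup i i.2
      rw [linearIndependent_finSucc', hinit, Fin.val_last, Function.update_self]
      exact ⟨hli, fun h => hyS (hS.symm ▸ h)⟩
    · rcases Nat.lt_succ_iff_lt_or_eq.mp hi with hi' | rfl
      · obtain ⟨h1, h2, h3, h4⟩ := hea i hi'
        rw [hup i hi', hupa i hi', himg i hi'.le]
        exact ⟨h1, h2, fun j hj => by rw [hupa j (by omega)]; exact h3 j hj, h4⟩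
      · rw [Function.update_self, Function.update_self, himg i le_rfl]
        refine ⟨hyM, hyC, fun j hj => ?_, fun x hx m' hm' hxC => ?_⟩
        · rcases hj.lt_or_eq with hj | rfl
          · rw [hupa j hj]
            by_contra hlt
            exact hyS (Submodule.span_mono (Set.image_mono (Set.Iio_subset_Iio hj.le))
              ((hea j hj).2.2.2 y hyM m (by omega) hyC))
          · rw [Function.update_self]
        · by_contra hxS
          exact absurd (hmin m' ⟨x, hx, hxS, hxC⟩) (by omega)

/-- A basis of `D` adapted to both `M` and the filtration `tⁿ C`. -/
theorem exists_reduced_basis (hPR : IsComplementary P R t) (hM : IsTraceOrder P (1 : K) M)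
    (hC : IsTraceOrder R s C) :
    ∃ (e : Module.Basis (Fin (Module.finrank K D)) K D) (a : Fin (Module.finrank K D) → ℤ),
      (∀ i, e i ∈ M) ∧ (∀ i, t ^ (-a i) • e i ∈ C) ∧ (∀ x ∈ M, ∀ i, e.repr x i ∈ P) ∧
      ∀ x ∈ C, ∀ i, t ^ a i * e.repr x i ∈ R := by
  obtain ⟨e', a', hli, hea⟩ := exists_greedy hPR hM hC (Module.finrank K D) le_rfl
  have hnt : Nontrivial D := (IsAzumaya.isSimpleRing (F := K) D).instNontrivial
  have : Nonempty (Fin (Module.finrank K D)) := ⟨⟨0, Module.finrank_pos⟩⟩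
  let e : Module.Basis (Fin (Module.finrank K D)) K D :=
    basisOfLinearIndependentOfCardEqFinrank hli (by simp)
  let a : Fin (Module.finrank K D) → ℤ := fun i => a' i
  have he : ∀ i, e i = e' i := fun i => by simp [e]
  have heM : ∀ i, e i ∈ M := fun i => he i ▸ (hea i i.2).1
  have heC : ∀ i, t ^ (-a i) • e i ∈ C := fun i => he i ▸ (hea i i.2).2.1
  have hmono : ∀ i j, i ≤ j → a i ≤ a j := fun i j hij => (hea j j.2).2.2.1 i hij
  have hmin : ∀ i, ∀ x ∈ M, ∀ m < a i, t ^ (-m) • x ∈ C → e.repr x i = 0 := by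
    intro i x hx m hm hxC
    have h1 := (hea i i.2).2.2.2 x hx m hm hxC
    have h2 : Submodule.span K (e' '' Set.Iio (i : ℕ)) ≤ LinearMap.ker (e.coord i) := by
      rw [Submodule.span_le]
      rintro _ ⟨j, hj, rfl⟩
      have hj' : j < (i : ℕ) := hj
      have hjl : j < Module.finrank K D := hj'.trans i.2
      have : e' j = e ⟨j, hjl⟩ := (he ⟨j, hjl⟩).symm
      rw [this]
      simp only [SetLike.mem_coe, LinearMap.mem_ker, Module.Basis.coord_apply,
        Module.Basis.repr_self]
      exact Finsupp.single_eq_of_ne (by rw [Fin.ne_iff_vne]; simp; omega)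
    exact h2 h1
  -- leading coefficients are independent
  have hlead : ∀ c : Fin (Module.finrank K D) → K, (∀ i, c i ∈ P ∧ c i ∈ R) →
      t • ∑ i, c i • t ^ (-a i) • e i ∈ C → c = 0 := by
    intro c hc hsum
    by_contra hne
    -- Let `j` be the last index that occurs. Multiplying by `t ^ a j` gives an element of `M` of
    -- order at most `a j - 1` whose coordinate at `j` is `c j`, against the minimality of `a j`.
    obtain ⟨j, hj, hjmax⟩ : ∃ j, c j ≠ 0 ∧ ∀ i, c i ≠ 0 → i ≤ j := by
      obtain ⟨j₀, hj₀⟩ := Function.ne_iff.mp hne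
      obtain ⟨j, hj⟩ := (Set.toFinite {i | c i ≠ 0}).exists_maximal ⟨j₀, hj₀⟩
      exact ⟨j, hj.1, fun i hi => le_of_not_gt fun hlt => hlt.not_ge (hj.2 hi hlt.le)⟩
    have hx : t ^ a j • ∑ i, c i • t ^ (-a i) • e i = ∑ i, (c i * t ^ (a j - a i)) • e i := by
      rw [Finset.smul_sum]
      refine Finset.sum_congr rfl fun i _ => ?_
      rw [smul_smul, smul_smul, sub_eq_add_neg, zpow_add₀ hPR.ne_zero]
      congr 1; ring
    have hxM : t ^ a j • ∑ i, c i • t ^ (-a i) • e i ∈ M := by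
      rw [hx]
      refine sum_mem fun i _ => ?_
      by_cases hi : c i = 0
      · simp [hi]
      · exact hM.smul_mem _ (mul_mem (hc i).1
          (hPR.zpow_mem_left (sub_nonneg.mpr (hmono i j (hjmax i hi))))) _ (heM i)
    have h1 := hmin j _ hxM (a j - 1) (by omega) (by
      rw [smul_smul, ← zpow_add₀ hPR.ne_zero, show -(a j - 1) + a j = (1 : ℤ) by ring, zpow_one]
      exact hsum)
    rw [hx] at h1
    simp only [map_sum, map_smul, Module.Basis.repr_self, Finsupp.coe_finsetSum,
      Finset.sum_apply, Finsupp.smul_apply, smul_eq_mul] at h1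
    rw [Finset.sum_eq_single j (fun i _ hij => by simp [Finsupp.single_eq_of_ne hij.symm])
      (by simp)] at h1
    simp [hj] at h1
  refine ⟨e, a, heM, heC, fun x hx => ?_, fun x hx => ?_⟩
  -- After subtracting polynomial parts all coordinates vanish at infinity. At the last nonzero one,
  -- `j`, the remainder has order at most `a j - 1`, so minimality kills that coordinate.
  · choose q hqP hq using fun i => hPR.exists_sub (e.repr x i)
    have hy : x - ∑ i, q i • e i ∈ M :=
      sub_mem hx (sum_mem fun i _ => hM.smul_mem _ (hqP i) _ (heM i))
    have hyr : ∀ i, e.repr (x - ∑ i, q i • e i) i = e.repr x i - q i := by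
      intro i
      rw [map_sub, Finsupp.sub_apply, Module.Basis.repr_sum_self]
    by_contra hne
    push Not at hne
    obtain ⟨j₀, hj₀⟩ := hne
    obtain ⟨j, hj, hjmax⟩ : ∃ j, e.repr x j - q j ≠ 0 ∧ ∀ i, e.repr x i - q i ≠ 0 → i ≤ j := by
      obtain ⟨j, hj⟩ := (Set.toFinite {i | e.repr x i - q i ≠ 0}).exists_maximal
        ⟨j₀, fun h0 => hj₀ (by rw [sub_eq_zero.mp h0]; exact hqP j₀)⟩
      exact ⟨j, hj.1, fun i hi => le_of_not_gt fun hlt => hlt.not_ge (hj.2 hi hlt.le)⟩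
    refine hj ?_
    rw [← hyr]
    refine hmin j _ hy (a j - 1) (by omega) ?_
    rw [← e.sum_repr (x - ∑ i, q i • e i), Finset.smul_sum]
    refine sum_mem fun i _ => ?_
    rw [hyr]
    by_cases hi : e.repr x i - q i = 0
    · simp [hi]
    · have h1 : t ^ (-(a i - 1)) • (e.repr x i - q i) • e i ∈ C := by
        have := hC.smul_mem _ (hq i) _ (heC i)
        rw [smul_smul] at this ⊢
        convert this using 2
        rw [show -(a i - 1) = 1 + -a i by ring, zpow_add₀ hPR.ne_zero, zpow_one]
        ring
      exact smul_mem_of_le hPR hC (by have := hmono i j (hjmax i hi); omega) h1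
  -- Induction on a bound `n` for the poles of the coordinates: `hlead` annihilates their leading
  -- values at infinity, which lowers the bound.
  · obtain ⟨n, hn⟩ : ∃ n : ℕ, ∀ i, t⁻¹ ^ n * (t ^ a i * e.repr x i) ∈ R := by
      choose n hn using fun i => hPR.exists_pow (t ^ a i * e.repr x i)
      refine ⟨∑ i, n i, fun i => ?_⟩
      rw [← Finset.add_sum_erase _ _ (Finset.mem_univ i), add_comm, pow_add, mul_assoc]
      exact mul_mem (pow_mem hPR.inv_mem _) (hn i)
    induction n with
    | zero => intro i; simpa using hn i
    | succ n ih =>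
      apply ih
      choose c hcP hcR hc using fun i => hPR.exists_const (hn i)
      have hc0 : c = 0 := by
        apply hlead c fun i => ⟨hcP i, hcR i⟩
        have h1 : t • ∑ i, c i • t ^ (-a i) • e i = t⁻¹ ^ n • x -
            ∑ i, (t * (t⁻¹ ^ (n + 1) * (t ^ a i * e.repr x i) - c i)) • t ^ (-a i) • e i := by
          conv_rhs => rw [← e.sum_repr x]
          rw [Finset.smul_sum, Finset.smul_sum, ← Finset.sum_sub_distrib]
          refine Finset.sum_congr rfl fun i _ => ?_
          rw [smul_smul, smul_smul, smul_smul, smul_smul, ← sub_smul]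
          congr 1
          have h2 : t ^ a i * t ^ (-a i) = 1 := by
            rw [← zpow_add₀ hPR.ne_zero]; simp
          have h3 : t * t⁻¹ = 1 := mul_inv_cancel₀ hPR.ne_zero
          rw [e.sum_repr]
          linear_combination t⁻¹ ^ n * e.repr x i * t * t⁻¹ * h2 + t⁻¹ ^ n * e.repr x i * h3
        rw [h1]
        exact sub_mem (hC.smul_mem _ (pow_mem hPR.inv_mem n) _ hx)
          (sum_mem fun i _ => hC.smul_mem _ (hc i) _ (heC i))
      intro i
      have h4 := hc i
      rw [hc0, Pi.zero_apply, sub_zero, pow_succ', mul_assoc t⁻¹,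
        mul_inv_cancel_left₀ hPR.ne_zero] at h4
      exact h4

end Reduction

/-! ### Global sections of an order on the projective line. -/

section Descent

variable {K : Type u} [Field K] [CharZero K] {P R : Subring K} {t : K}

theorem linearIndependent_of_isTraceDual {F A ι : Type*} [Field F] [Ring A] [Algebra F A]
    [DecidableEq ι] {a b : ι → A} (h : IsTraceDual (F := F) a b) : LinearIndependent F b := by
  rw [linearIndependent_iff']
  intro s g hg i hi
  have h1 := congrArg (fun x => regTrace F A (a i * x)) hg
  simpa [Finset.mul_sum, h _ _, hi] using h1

theorem finrank_span_image_finset {F V ι : Type*} [Field F] [AddCommGroup V] [Module F V]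
    {v : ι → V} (hv : LinearIndependent F v) (S : Finset ι) :
    Module.finrank F (Submodule.span F (v '' S)) = S.card := by
  rw [Set.image_eq_range]
  exact (finrank_span_eq_card (hv.comp _ Subtype.val_injective)).trans (Fintype.card_coe S)

/-- A subalgebra, of dimension more than half, of a division algebra is everything. -/
theorem eq_top_of_lt_two_mul_finrank {F D : Type*} [Field F] [DivisionRing D] [Algebra F D]
    [Module.Finite F D] (W : Submodule F D) (hmul : ∀ x ∈ W, ∀ y ∈ W, x * y ∈ W)
    (h : Module.finrank F D < 2 * Module.finrank F W) : W = ⊤ := by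
  by_contra hW
  obtain ⟨y, hy⟩ : ∃ y, y ∉ W := by
    by_contra hcon
    push Not at hcon
    exact hW (eq_top_iff.mpr fun x _ => hcon x)
  -- For `y` outside `W` the sum of `W` and `W * y` is direct: if `w + v * y = 0` with `v ≠ 0`, then
  -- left multiplication by `v` is bijective on `W`, so `y` would lie in `W`.
  let f : W × W →ₗ[F] D := LinearMap.coprod W.subtype ((LinearMap.mulRight F y).comp W.subtype)
  have hf : Function.Injective f := by
    rw [injective_iff_map_eq_zero]
    rintro ⟨w, v⟩ hwv
    have hwv' : (w : D) + v * y = 0 := hwv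
    by_cases hv : v = 0
    · subst hv
      simp only [ZeroMemClass.coe_zero, zero_mul, add_zero, ZeroMemClass.coe_eq_zero] at hwv'
      simp [hwv']
    · have hv' : (v : D) ≠ 0 := by simpa using hv
      let m : W →ₗ[F] W := (LinearMap.mulLeft F (v : D)).restrict fun x hx => hmul _ v.2 _ hx
      have hm : Function.Injective m := by
        rw [injective_iff_map_eq_zero]
        intro x hx
        have : (v : D) * x = 0 := congrArg Subtype.val hx
        simpa [hv'] using this
      obtain ⟨x, hx⟩ := (LinearMap.injective_iff_surjective.mp hm) (-w)
      have hx' : (v : D) * x = -w := congrArg Subtype.val hx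
      have : y = x := mul_left_cancel₀ hv' (by rw [hx', eq_neg_of_add_eq_zero_right hwv'])
      exact absurd (this ▸ x.2) hy
  have := LinearMap.finrank_le_finrank_of_injective hf
  rw [Module.finrank_prod] at this
  omega

variable {D : Type*} [DivisionRing D] [Algebra K D] [IsAzumaya K D] {M C : Subring D}

set_option maxHeartbeats 1000000 in
/-- A trace order over the line whose different at infinity is at most the uniformizer has a
basis of global sections. -/
theorem exists_basis_mem_inf (hPR : IsComplementary P R t) (hM : IsTraceOrder P (1 : K) M)
    (hC : IsTraceOrder R t⁻¹ C) :
    ∃ e : Module.Basis (Fin (Module.finrank K D)) K D, (∀ i, e i ∈ M ⊓ C) ∧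
      ∀ x ∈ M ⊓ C, ∀ i, e.repr x i ∈ P ⊓ R := by
  classical
  obtain ⟨e, a, heM, heC, hP, hR⟩ := exists_reduced_basis hPR hM hC
  have ht := hPR.ne_zero
  -- If `e i` vanished at infinity, a high power of it would fall below the bound of `exists_bound`
  -- and be zero, impossible in a division algebra.
  have ha : ∀ i, 0 ≤ a i := by
    intro i
    by_contra hi
    obtain ⟨n₀, hn₀⟩ := exists_bound hPR hM hC
    have h1 : t ^ (-(n₀.natAbs * a i)) • e i ^ n₀.natAbs ∈ C := by
      have := pow_mem (heC i) n₀.natAbs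
      rwa [smul_pow, ← zpow_natCast (t ^ (-a i)), ← zpow_mul, neg_mul, mul_comm (a i)] at this
    have h2 := hn₀ _ (pow_mem (heM i) n₀.natAbs) _ (by nlinarith [neg_abs_le n₀, Int.abs_eq_natAbs n₀]) h1
    exact e.ne_zero i (eq_zero_of_pow_eq_zero h2)
  obtain ⟨b, hb⟩ := exists_isTraceDual e
  have hbM : ∀ i, b i ∈ M := by
    intro i
    rw [← one_smul K (b i)]
    refine hM.dual_mem _ fun c hc => ?_
    rw [regTrace_mul_comm, ← hb.repr_apply]
    exact hP c hc i
  -- Duality at infinity loses one factor `t`, and `a i ≥ 1` is exactly enough to absorb it. This is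
  -- where quadratic ramification is mild enough.
  have hbC : ∀ i, 0 < a i → b i ∈ C := by
    intro i hi
    have h1 : t⁻¹ • t ^ a i • b i ∈ C := by
      refine hC.dual_mem _ fun c hc => ?_
      rw [smul_mul_assoc, map_smul, regTrace_mul_comm, ← hb.repr_apply]
      exact hR c hc i
    have h2 := hC.smul_mem _ (hPR.zpow_mem_right (n := 1 - a i) (by omega)) _ h1
    rwa [smul_smul, smul_smul, ← zpow_neg_one, mul_assoc, ← zpow_add₀ ht, ← zpow_add₀ ht,
      show 1 - a i + (-1 + a i) = 0 by ring, zpow_zero, one_smul] at h2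
  -- A coordinate with `a i > 0` is an element of `P` that vanishes at infinity.
  have hrepr0 : ∀ x ∈ M ⊓ C, ∀ i, 0 < a i → e.repr x i = 0 := by
    intro x hx i hi
    refine hPR.eq_zero _ (hP x hx.1 i) ?_
    have := mul_mem (hPR.zpow_mem_right (n := 1 - a i) (by omega)) (hR x hx.2 i)
    rwa [← mul_assoc, ← zpow_add₀ ht, sub_add_cancel, zpow_one] at this
  let S : Finset (Fin (Module.finrank K D)) := {i | a i = 0}
  have hS : ∀ i, i ∈ S ↔ a i = 0 := fun i => by simp [S]
  have hS' : ∀ i, i ∈ Sᶜ ↔ 0 < a i := fun i => by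
    rw [Finset.mem_compl, hS]
    have := ha i
    omega
  let W : Submodule K D := Submodule.span K (e '' S)
  have hsub : ∀ x ∈ M ⊓ C, x ∈ W := by
    intro x hx
    rw [← e.sum_repr x]
    refine Submodule.sum_mem _ fun i _ => ?_
    by_cases hi : i ∈ S
    · exact W.smul_mem _ (Submodule.subset_span ⟨i, hi, rfl⟩)
    · rw [hrepr0 x hx i ((hS' i).mp (Finset.mem_compl.mpr hi)), zero_smul]
      exact W.zero_mem
  have heD : ∀ i ∈ S, e i ∈ M ⊓ C := fun i hi => ⟨heM i, by
    simpa [(hS i).mp hi] using heC i⟩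
  have hWmul : ∀ x ∈ W, ∀ y ∈ W, x * y ∈ W := by
    have : W * W ≤ W := by
      change Submodule.span K _ * Submodule.span K _ ≤ _
      rw [Submodule.span_mul_span, Submodule.span_le]
      rintro _ ⟨_, ⟨i, hi, rfl⟩, _, ⟨j, hj, rfl⟩, rfl⟩
      exact hsub _ (mul_mem (heD i hi) (heD j hj))
    exact fun x hx y hy => this (Submodule.mul_mem_mul hx hy)
  have hWrank : Module.finrank K W = S.card := finrank_span_image_finset e.linearIndependent S
  let W' : Submodule K D := Submodule.span K (b '' (Sᶜ : Finset _))
  have hW'rank : Module.finrank K W' = Sᶜ.card :=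
    finrank_span_image_finset (linearIndependent_of_isTraceDual hb) Sᶜ
  have hW'W : W' ≤ W := by
    rw [Submodule.span_le]
    rintro _ ⟨i, hi, rfl⟩
    exact hsub _ ⟨hbM i, hbC i ((hS' i).mp hi)⟩
  have hcard : Sᶜ.card = Module.finrank K D - S.card := by
    rw [Finset.card_compl, Fintype.card_fin]
  -- Since `W' ≤ W`, the only obstruction is `W' = W`. But `W'` is orthogonal to `W`, which contains
  -- `1`, so `W'` has trace zero and cannot contain `1`.
  have hlt : Module.finrank K D < 2 * Module.finrank K W := by
    by_contra hge
    have h1 : W' = W := Submodule.eq_of_le_of_finrank_le hW'W (by omega)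
    have h2 : (1 : D) ∈ W' := h1 ▸ hsub 1 (one_mem _)
    have h3 : W' ≤ LinearMap.ker (regTrace K D) := by
      rw [Submodule.span_le]
      rintro _ ⟨i, hi, rfl⟩
      have h4 : W ≤ LinearMap.ker (regTrace K D ∘ₗ LinearMap.mulRight K (b i)) := by
        rw [Submodule.span_le]
        rintro _ ⟨j, hj, rfl⟩
        have hij : j ≠ i := fun h => Finset.mem_compl.mp hi (h ▸ hj)
        simp [hb j i, hij]
      simpa using h4 (hsub 1 (one_mem _))
    have h5 : regTrace K D 1 = 0 := h3 h2
    rw [regTrace_one] at h5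
    exact finrank_ne_zero h5
  have htop := eq_top_of_lt_two_mul_finrank W hWmul hlt
  have hall : ∀ i, i ∈ S := by
    have : S.card = Module.finrank K D := by rw [← hWrank, htop, finrank_top]
    have : S = Finset.univ := Finset.eq_univ_of_card _ (by rw [this, Fintype.card_fin])
    simp [this]
  refine ⟨e, fun i => heD i (hall i), fun x hx i => ⟨hP x hx.1 i, ?_⟩⟩
  simpa [(hS i).mp (hall i)] using hR x hx.2 i

end Descent

/-! ### Descent of a Brauer class to the constants. -/

section DescentClass

variable {k K : Type u} [Field k] [Field K] [CharZero K] [Algebra k K] {P R : Subring K} {t : K}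

/-- A class with suitable trace orders on the line comes from the constants. -/
theorem mk_mem_range_of_isTraceOrder {D : Type u} [DivisionRing D] [Algebra K D] [IsAzumaya K D]
    {M C : Subring D} (hPR : IsComplementary P R t) (hk : (algebraMap k K).range = P ⊓ R)
    (hM : IsTraceOrder P (1 : K) M) (hC : IsTraceOrder R t⁻¹ C) :
    Br.mk ⟨D⟩ ∈ (Br.baseChange k K).range := by
  obtain ⟨e, he, hrepr⟩ := exists_basis_mem_inf hPR hM hC
  let _ : Algebra k D := Algebra.compHom D (algebraMap k K)
  have : IsScalarTower k K D := .of_algebraMap_eq' rfl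
  have hkm : ∀ c : k, algebraMap k K c ∈ P ⊓ R := fun c => hk ▸ ⟨c, rfl⟩
  -- The global sections of the order; the adapted basis makes this a `k`-form of `D`.
  let E : Subalgebra k D :=
    { M ⊓ C with
      algebraMap_mem' := fun c => by
        have h1 : algebraMap k D c = algebraMap k K c • (1 : D) := by
          rw [IsScalarTower.algebraMap_apply k K D, Algebra.algebraMap_eq_smul_one]
        change algebraMap k D c ∈ M ⊓ C
        rw [h1]
        exact ⟨hM.smul_mem _ (hkm c).1 _ (one_mem _), hC.smul_mem _ (hkm c).2 _ (one_mem _)⟩ }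
  have hE : ∀ x, x ∈ E ↔ x ∈ M ⊓ C := fun x => Iff.rfl
  let v : Fin (Module.finrank K D) → E := fun i => ⟨e i, he i⟩
  have hli : LinearIndependent k v := by
    refine LinearIndependent.of_comp E.val.toLinearMap ?_
    refine LinearIndependent.restrict_scalars ?_ (v := e) e.linearIndependent
    intro a b hab
    simpa [Algebra.smul_def] using hab
  have hspan : ⊤ ≤ Submodule.span k (Set.range v) := by
    rintro x -
    choose c hc using fun i => (hk ▸ hrepr x x.2 i : e.repr (x : D) i ∈ (algebraMap k K).range)
    have : x = ∑ i, c i • v i := by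
      apply Subtype.ext
      conv_lhs => rw [← e.sum_repr (x : D)]
      simp only [AddSubmonoidClass.coe_finsetSum, ← hc, algebraMap_smul]
      rfl
    rw [this]
    exact Submodule.sum_mem _ fun i _ => Submodule.smul_mem _ _ (Submodule.subset_span ⟨i, rfl⟩)
  let B : Module.Basis (Fin (Module.finrank K D)) k E := .mk hli hspan
  have hfin : Module.Finite k E := .of_basis B
  have hrank : Module.finrank k E = Module.finrank K D := by
    rw [Module.finrank_eq_card_basis B, Fintype.card_fin]
  -- As `E` contains a `K`-basis of `D`, a central element of `E` is a scalar of `K`. Its trace lies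
  -- in `P ⊓ R`, so the scalar is a constant.
  have hcentral : Algebra.IsCentral k E := by
    refine ⟨fun z hz => ?_⟩
    rw [Subalgebra.mem_center_iff] at hz
    obtain ⟨f, hf⟩ := exists_algebraMap_of_commute (F := K) (z := (z : D)) (by
      intro x
      rw [← e.sum_repr x, Finset.sum_mul, Finset.mul_sum]
      refine Finset.sum_congr rfl fun i _ => ?_
      rw [smul_mul_assoc, mul_smul_comm]
      exact congrArg _ (congrArg Subtype.val (hz (v i))))
    have htr : (Module.finrank K D : K) * f ∈ P ⊓ R := by
      have h1 : regTrace K D (z : D) = Module.finrank K D * f := by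
        rw [← hf, Algebra.algebraMap_eq_smul_one, map_smul, regTrace_one, smul_eq_mul, mul_comm]
      rw [← h1]
      exact ⟨hM.trace_mem _ z.2.1, hC.trace_mem _ z.2.2⟩
    rw [← hk] at htr
    obtain ⟨c, hc⟩ := htr
    refine Algebra.mem_bot.mpr ⟨(Module.finrank K D : k)⁻¹ * c, Subtype.ext ?_⟩
    change algebraMap k D _ = _
    rw [IsScalarTower.algebraMap_apply k K D, map_mul, hc, map_inv₀, map_natCast,
      inv_mul_cancel_left₀ finrank_ne_zero, hf]
  have haz : IsAzumaya k E := by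
    let _ : DivisionRing E := divisionRingOfFiniteDimensional k E
    exact isAzumaya_of_divisionRing (F := k) E
  refine ⟨Br.mk ⟨E⟩, ?_⟩
  rw [← Br.mk_baseChange]
  have haz' : IsAzumaya K (K ⊗[k] E) := (AzumayaAlg.baseChange K (⟨E⟩ : AzumayaAlg k)).isAzumaya
  let f : K ⊗[k] E →ₐ[K] D :=
    Algebra.TensorProduct.lift (Algebra.ofId K D) E.val fun x y => Algebra.commutes x (y : D)
  have hf := IsAzumaya.bijective_of_finrank_eq f (by rw [Module.finrank_baseChange, hrank])
  exact Br.mk_eq_of_algEquiv (A := AzumayaAlg.baseChange K (⟨E⟩ : AzumayaAlg k)) (B := ⟨D⟩)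
    (AlgEquiv.ofBijective f hf)

end DescentClass

/-! ### Gluing local orders. -/

section Glue

variable {K : Type*} [Field K] {D : Type*} [Ring D] [Algebra K D]

/-- Glueing of trace orders along a family of subrings of a field. -/
theorem isTraceOrder_iInf {ι : Type*} [Fintype ι] [DecidableEq ι] {P : Subring K}
    {R : ι → Subring K} (hPR : ∀ i, P ≤ R i) (hRP : ∀ f, (∀ i, f ∈ R i) → f ∈ P)
    (hfrac : ∀ f : K, ∃ s ∈ P, s ≠ 0 ∧ s * f ∈ P)
    (hsep : ∀ i j, i ≠ j → ∀ f : K, ∃ s ∈ P, s ≠ 0 ∧ s⁻¹ ∈ R i ∧ s * f ∈ R j)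
    {C : ι → Subring D} (hC : ∀ i, IsTraceOrder (R i) (1 : K) (C i)) :
    IsTraceOrder P (1 : K) (⨅ i, C i) where
  smul_mem r hr x hx := by
    rw [Subring.mem_iInf] at hx ⊢
    exact fun i => (hC i).smul_mem r (hPR i hr) x (hx i)
  exists_smul_mem x := by
    choose r hrR hr0 hr using fun i => (hC i).exists_smul_mem x
    choose s hsP hs0 hs using fun i => hfrac (r i)⁻¹
    refine ⟨∏ i, s i, prod_mem fun i _ => hsP i, Finset.prod_ne_zero_iff.mpr fun i _ => hs0 i, ?_⟩
    rw [Subring.mem_iInf]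
    intro i
    have h1 := (hC i).smul_mem _ (hPR i (hs i)) _ (hr i)
    rw [smul_smul, mul_assoc, inv_mul_cancel₀ (hr0 i), mul_one] at h1
    rw [← Finset.mul_prod_erase _ _ (Finset.mem_univ i), mul_comm, ← smul_smul]
    exact (hC i).smul_mem _ (hPR i (prod_mem fun j _ => hsP j)) _ h1
  trace_mem x hx := by
    rw [Subring.mem_iInf] at hx
    exact hRP _ fun i => (hC i).trace_mem x (hx i)
  dual_mem x hx := by
    rw [Subring.mem_iInf]
    refine fun i => (hC i).dual_mem x fun c hc => ?_
    choose r hrR hr0 hr using fun j => (hC j).exists_smul_mem c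
    -- An element `c` of the order at `i` becomes global after multiplication by functions that are
    -- units at `i` and clear the denominators elsewhere, so testing against global elements
    -- suffices.
    have : ∀ j, ∃ s ∈ P, s ≠ 0 ∧ s⁻¹ ∈ R i ∧ s • c ∈ C j := by
      intro j
      by_cases hij : i = j
      · subst hij
        exact ⟨1, one_mem _, one_ne_zero, by simp [one_mem], by simpa using hc⟩
      · obtain ⟨s, hsP, hs0, hsi, hs⟩ := hsep i j hij (r j)⁻¹
        refine ⟨s, hsP, hs0, hsi, ?_⟩
        have h1 := (hC j).smul_mem _ hs _ (hr j)
        rwa [smul_smul, mul_assoc, inv_mul_cancel₀ (hr0 j), mul_one] at h1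
    choose s hsP hs0 hsi hs using this
    have h1 : (∏ j, s j) • c ∈ ⨅ j, C j := by
      rw [Subring.mem_iInf]
      intro j
      rw [← Finset.mul_prod_erase _ _ (Finset.mem_univ j), mul_comm, ← smul_smul]
      exact (hC j).smul_mem _ (hPR j (prod_mem fun j _ => hsP j)) _ (hs j)
    have h2 := hPR i (hx _ h1)
    rw [mul_smul_comm, map_smul, smul_eq_mul] at h2
    have h3 := mul_mem (prod_mem fun j (_ : j ∈ Finset.univ) => hsi j) h2
    rwa [Finset.prod_inv_distrib,
      inv_mul_cancel_left₀ (Finset.prod_ne_zero_iff.mpr fun j _ => hs0 j)] at h3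

end Glue

/-! ### Rational places of a function field. -/

section Uniformizer

variable {k K : Type*} [Field k] [Field K] [Algebra k K]

/-- `O` is a discrete valuation ring of `K` with uniformizer `ϖ` and residue field `k`. -/
structure IsRationalPlace (O : Subalgebra k K) (ϖ : K) : Prop where
  mem : ϖ ∈ O
  ne_zero : ϖ ≠ 0
  inv_notMem : ϖ⁻¹ ∉ O
  factor : ∀ f : K, f ≠ 0 → ∃ (n : ℤ) (u : K), u ∈ O ∧ u⁻¹ ∈ O ∧ f = u * ϖ ^ n
  residue : ∀ f ∈ O, ∃ c : k, ϖ⁻¹ * (f - algebraMap k K c) ∈ O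

namespace IsRationalPlace

variable {O : Subalgebra k K} {ϖ : K}

theorem factor_of_mem (h : IsRationalPlace O ϖ) {f : K} (hf : f ∈ O) (hf0 : f ≠ 0) :
    ∃ (n : ℕ) (u : K), u ∈ O ∧ u⁻¹ ∈ O ∧ f = u * ϖ ^ n := by
  obtain ⟨n, u, hu, hu', rfl⟩ := h.factor f hf0
  have hu0 : u ≠ 0 := left_ne_zero_of_mul hf0
  obtain ⟨n, rfl⟩ | ⟨n, rfl⟩ : (∃ m : ℕ, n = m) ∨ ∃ m : ℕ, n = -(m + 1 : ℕ) := by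
    rcases lt_or_ge n 0 with hn | hn
    · exact .inr ⟨(-n - 1).toNat, by omega⟩
    · exact .inl ⟨n.toNat, by omega⟩
  · exact ⟨n, u, hu, hu', by rw [zpow_natCast]⟩
  · refine absurd ?_ h.inv_notMem
    have h1 := mul_mem (mul_mem hu' hf) (pow_mem h.mem n)
    rwa [inv_mul_cancel_left₀ hu0, zpow_neg, zpow_natCast, pow_succ, mul_inv, mul_comm, ← mul_assoc,
      mul_inv_cancel₀ (pow_ne_zero _ h.ne_zero), one_mul] at h1

theorem irreducible (h : IsRationalPlace O ϖ) : Irreducible (⟨ϖ, h.mem⟩ : O) := by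
  have hnu : ¬ IsUnit (⟨ϖ, h.mem⟩ : O) := by
    rintro ⟨⟨v, w, hvw, hwv⟩, hv⟩
    change v = _ at hv
    subst hv
    have h1 : ϖ * (w : K) = 1 := congrArg Subtype.val hvw
    exact h.inv_notMem (eq_inv_of_mul_eq_one_right h1 ▸ w.2)
  refine ⟨hnu, fun {a b} hab => ?_⟩
  have hab' : ϖ = a * b := congrArg Subtype.val hab
  have hab0 : (a : K) * b ≠ 0 := hab' ▸ h.ne_zero
  obtain ⟨m, u, hu, hu', ha⟩ := h.factor_of_mem a.2 (left_ne_zero_of_mul hab0)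
  obtain ⟨n, v, hv, hv', hb⟩ := h.factor_of_mem b.2 (right_ne_zero_of_mul hab0)
  have key : ∀ (x : O) (w : K), w ∈ O → w⁻¹ ∈ O → (x : K) ≠ 0 → (x : K) = w * ϖ ^ 0 → IsUnit x := by
    intro x w hw hw' hx0 hx
    rw [pow_zero, mul_one] at hx
    subst hx
    exact IsUnit.of_mul_eq_one ⟨_, hw'⟩ (Subtype.ext (mul_inv_cancel₀ hx0))
  rcases Nat.eq_zero_or_pos m with rfl | hm
  · exact .inl (key a u hu hu' (left_ne_zero_of_mul hab0) ha)
  rcases Nat.eq_zero_or_pos n with rfl | hn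
  · exact .inr (key b v hv hv' (right_ne_zero_of_mul hab0) hb)
  exfalso
  apply h.inv_notMem
  have h1 : ϖ⁻¹ = (u * ϖ ^ (m - 1)) * (v * ϖ ^ (n - 1)) := by
    obtain ⟨m, rfl⟩ := Nat.exists_eq_add_of_le' hm
    obtain ⟨n, rfl⟩ := Nat.exists_eq_add_of_le' hn
    rw [ha, hb] at hab'
    refine (eq_inv_of_mul_eq_one_right (mul_left_cancel₀ h.ne_zero ?_)).symm
    simp only [Nat.add_sub_cancel]
    linear_combination -hab'
  rw [h1]
  exact mul_mem (mul_mem hu (pow_mem h.mem _)) (mul_mem hv (pow_mem h.mem _))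

theorem isDiscreteValuationRing (h : IsRationalPlace O ϖ) : IsDiscreteValuationRing O := by
  refine IsDiscreteValuationRing.ofHasUnitMulPowIrreducibleFactorization
    ⟨⟨ϖ, h.mem⟩, h.irreducible, fun {x} hx => ?_⟩
  have hx0 : (x : K) ≠ 0 := by simpa using hx
  obtain ⟨n, u, hu, hu', hxu⟩ := h.factor_of_mem x.2 hx0
  have hu0 : u ≠ 0 := left_ne_zero_of_mul (hxu ▸ hx0)
  refine ⟨n, ⟨⟨u, hu⟩, ⟨u⁻¹, hu'⟩, Subtype.ext (mul_inv_cancel₀ hu0),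
    Subtype.ext (inv_mul_cancel₀ hu0)⟩, Subtype.ext ?_⟩
  rw [hxu, mul_comm u]
  rfl

theorem isFractionRing (h : IsRationalPlace O ϖ) : IsFractionRing O K := by
  refine IsFractionRing.of_field O K fun z => ?_
  by_cases hz : z = 0
  · exact ⟨0, 1, by simp [hz]⟩
  obtain ⟨n, u, hu, -, rfl⟩ := h.factor z hz
  obtain ⟨m, rfl | rfl⟩ := n.eq_nat_or_neg
  · exact ⟨⟨u, hu⟩ * ⟨ϖ, h.mem⟩ ^ m, 1, by simp⟩
  · exact ⟨⟨u, hu⟩, ⟨ϖ, h.mem⟩ ^ m, by simp [div_eq_mul_inv]⟩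

theorem dvd_iff (h : IsRationalPlace O ϖ) (x : O) :
    (⟨ϖ, h.mem⟩ : O) ∣ x ↔ ϖ⁻¹ * (x : K) ∈ O := by
  constructor
  · rintro ⟨y, rfl⟩
    change ϖ⁻¹ * (ϖ * (y : K)) ∈ O
    rw [inv_mul_cancel_left₀ h.ne_zero]
    exact y.2
  · intro hx
    exact ⟨⟨_, hx⟩, Subtype.ext (mul_inv_cancel_left₀ h.ne_zero _).symm⟩

/-- Modulo the uniformizer `x` and `y` become constants a, b with a² = db²; as `d` is not a square,
both vanish. This is the anisotropy that `quaternionClass_notMem_range` requires. -/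
theorem dvd_of_dvd_sq_sub (h : IsRationalPlace O ϖ) {d : k} (hd : ¬ IsSquare d) (x y : O)
    (hxy : (⟨ϖ, h.mem⟩ : O) ∣ x ^ 2 - algebraMap k O d * y ^ 2) :
    (⟨ϖ, h.mem⟩ : O) ∣ x ∧ (⟨ϖ, h.mem⟩ : O) ∣ y := by
  obtain ⟨a, ha⟩ := h.residue x x.2
  obtain ⟨b, hb⟩ := h.residue y y.2
  have hx : (⟨ϖ, h.mem⟩ : O) ∣ x - algebraMap k O a := (h.dvd_iff _).mpr ha
  have hy : (⟨ϖ, h.mem⟩ : O) ∣ y - algebraMap k O b := (h.dvd_iff _).mpr hb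
  have h1 : (⟨ϖ, h.mem⟩ : O) ∣ algebraMap k O (a ^ 2 - d * b ^ 2) := by
    have e : algebraMap k O (a ^ 2 - d * b ^ 2) = (x ^ 2 - algebraMap k O d * y ^ 2) -
        (x - algebraMap k O a) * (x + algebraMap k O a) +
        (y - algebraMap k O b) * (algebraMap k O d * (y + algebraMap k O b)) := by
      simp only [map_sub, map_mul, map_pow]; ring
    rw [e]
    exact dvd_add (dvd_sub hxy (hx.mul_right _)) (hy.mul_right _)
  have h2 : a ^ 2 - d * b ^ 2 = 0 := by
    by_contra hne
    exact h.irreducible.not_isUnit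
      (isUnit_of_dvd_unit h1 ((IsUnit.mk0 _ hne).map (algebraMap k O)))
  have hb0 : b = 0 := by
    by_contra hb0
    exact hd ⟨a / b, by field_simp; linear_combination -h2⟩
  have ha0 : a = 0 := by simpa [hb0] using h2
  simpa [ha0, hb0] using And.intro hx hy

end IsRationalPlace

theorem isUnit_natCast (k O : Type*) [Field k] [CharZero k] [CommRing O] [Algebra k O] (n : ℕ)
    (hn : n ≠ 0) : IsUnit (n : O) := by
  simpa using (IsUnit.mk0 (n : k) (by exact_mod_cast hn)).map (algebraMap k O)

theorem IsRationalPlace.quaternionClass_notMem {k K : Type u} [Field k] [Field K] [Algebra k K]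
    [CharZero k] [CharZero K] {O : Subalgebra k K} {ϖ : K} (h : IsRationalPlace O ϖ) (d : kˣ)
    (hd : ¬ IsSquare (d : k)) : quaternionClass isUnit_two_field
      (Units.map (algebraMap k K).toMonoidHom d) (Units.mk0 ϖ h.ne_zero) ∉
        (Br.baseChange O K).range := by
  have := h.isDiscreteValuationRing
  have := h.isFractionRing
  exact quaternionClass_notMem_range (isUnit_natCast k O)
    (Units.map (algebraMap k O).toMonoidHom d) h.irreducible (fun x y => h.dvd_of_dvd_sq_sub hd x y)
    _ _ rfl rfl

end Uniformizer

/-! ### The local rings and the coordinate ring in terms of polynomials in t. -/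

section LocalRings

variable (k : Type u) [Field k]

/-- The polynomials `[t : -(t + 1) : 1]`. -/
noncomputable def polyCoord : Fin 3 → Polynomial k :=
  ![Polynomial.X, -(Polynomial.X + 1), 1]

theorem algebraMap_polyCoord (i : Fin 3) :
    algebraMap (Polynomial k) (RatFunc k) (polyCoord k i) = coord k i := by
  fin_cases i <;> simp [polyCoord, coord]

variable {k}

theorem aeval_coord (G : MvPolynomial (Fin 3) k) : MvPolynomial.aeval (coord k) G =
    algebraMap (Polynomial k) (RatFunc k) (MvPolynomial.aeval (polyCoord k) G) := by
  have : coord k = algebraMap (Polynomial k) (RatFunc k) ∘ polyCoord k :=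
    funext fun i => (algebraMap_polyCoord k i).symm
  rw [this]
  exact MvPolynomial.aeval_algebraMap_apply (RatFunc k) (polyCoord k) G

theorem eval_aeval_polyCoord (G : MvPolynomial (Fin 3) k) (c : k) :
    (MvPolynomial.aeval (polyCoord k) G).eval c = MvPolynomial.eval ![c, -(c + 1), 1] G := by
  have h1 : (Polynomial.aeval c).comp (MvPolynomial.aeval (polyCoord k)) =
      MvPolynomial.aeval (R := k) ![c, -(c + 1), 1] := by
    ext i
    fin_cases i <;> simp [polyCoord]
  have h2 := congrArg (fun f => f G) h1
  simpa [Polynomial.coe_aeval_eq_eval, MvPolynomial.coe_aeval_eq_eval] using h2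

theorem eval_smul_of_isHomogeneous {σ : Type*} {G : MvPolynomial σ k} {n : ℕ}
    (hG : G.IsHomogeneous n) (r : k) (x : σ → k) :
    MvPolynomial.eval (r • x) G = r ^ n * MvPolynomial.eval x G := by
  rw [MvPolynomial.eval_eq, MvPolynomial.eval_eq, Finset.mul_sum]
  refine Finset.sum_congr rfl fun d hd => ?_
  rw [hG.degree_eq_sum_deg_support hd]
  simp only [Pi.smul_apply, smul_eq_mul, mul_pow, Finset.prod_mul_distrib,
    Finset.prod_pow_eq_pow_sum]
  ring

/-- The top coefficient of the dehomogenization is the value at the point at infinity. -/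
theorem natDegree_aeval_polyCoord {G : MvPolynomial (Fin 3) k} {n : ℕ} (hG : G.IsHomogeneous n) :
    (MvPolynomial.aeval (polyCoord k) G).natDegree ≤ n ∧
      (MvPolynomial.aeval (polyCoord k) G).coeff n = MvPolynomial.eval ![1, -1, 0] G := by
  have h1 : ∀ d : Fin 3 →₀ ℕ, d 0 + d 1 + d 2 = n →
      (∏ i, polyCoord k i ^ d i).natDegree ≤ n ∧
      (∏ i, polyCoord k i ^ d i).coeff n = ∏ i, (![1, -1, 0] : Fin 3 → k) i ^ d i := by
    intro d hd
    simp only [Fin.prod_univ_three, polyCoord, Matrix.cons_val_zero, Matrix.cons_val_one,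
      Matrix.cons_val_two, Matrix.tail_cons, Matrix.head_cons,
      one_pow, mul_one, one_mul]
    have e1 : (-(Polynomial.X + 1) : Polynomial k).natDegree ≤ 1 := by
      rw [Polynomial.natDegree_neg]
      exact (Polynomial.natDegree_X_add_C (1 : k)).le
    have e2 : ((-(Polynomial.X + 1) : Polynomial k) ^ d 1).natDegree ≤ d 1 := by
      simpa using Polynomial.natDegree_pow_le_of_le (d 1) e1
    have e3 : ((Polynomial.X : Polynomial k) ^ d 0).natDegree ≤ d 0 := Polynomial.natDegree_X_pow_le _
    have e4 := Polynomial.natDegree_mul_le_of_le e3 e2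
    refine ⟨e4.trans (by omega), ?_⟩
    rcases Nat.eq_zero_or_pos (d 2) with h0 | h0
    · rw [h0, pow_zero, mul_one, ← hd, h0, add_zero, Polynomial.coeff_mul_add_eq_of_natDegree_le e3 e2]
      have := Polynomial.coeff_pow_of_natDegree_le (m := d 1) e1
      rw [mul_one] at this
      rw [this, Polynomial.coeff_X_pow_self]
      simp [Polynomial.coeff_one]
    · rw [zero_pow h0.ne', mul_zero]
      exact Polynomial.coeff_eq_zero_of_natDegree_lt (by omega)
  have h2 : ∀ d ∈ G.support, d 0 + d 1 + d 2 = n := by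
    intro d hd
    rw [hG.degree_eq_sum_deg_support hd, Finset.sum_subset (Finset.subset_univ _)
      (fun i _ hi => by simpa using hi), Fin.sum_univ_three]
  rw [MvPolynomial.aeval_def, MvPolynomial.eval₂_eq', MvPolynomial.eval_eq']
  constructor
  · refine Polynomial.natDegree_sum_le_of_forall_le _ _ fun d hd => ?_
    exact (Polynomial.natDegree_C_mul_le _ _).trans (h1 d (h2 d hd)).1
  · rw [Polynomial.finsetSum_coeff]
    refine Finset.sum_congr rfl fun d hd => ?_
    rw [← (h1 d (h2 d hd)).2]
    exact Polynomial.coeff_C_mul _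

/-- The homogenization of degree `n` of a polynomial in `t = z₀ / z₂`. -/
noncomputable def homogenize (n : ℕ) (q : Polynomial k) : MvPolynomial (Fin 3) k :=
  ∑ i ∈ Finset.range (n + 1),
    MvPolynomial.C (q.coeff i) * (MvPolynomial.X 0 ^ i * MvPolynomial.X 2 ^ (n - i))

theorem homogenize_isHomogeneous (n : ℕ) (q : Polynomial k) : (homogenize n q).IsHomogeneous n := by
  refine MvPolynomial.IsHomogeneous.sum _ _ _ fun i hi => ?_
  refine MvPolynomial.IsHomogeneous.C_mul ?_ _
  have := (MvPolynomial.isHomogeneous_X_pow (R := k) (0 : Fin 3) i).mul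
    (MvPolynomial.isHomogeneous_X_pow (R := k) (2 : Fin 3) (n - i))
  rwa [show i + (n - i) = n by have := Finset.mem_range.mp hi; omega] at this

theorem aeval_homogenize {n : ℕ} {q : Polynomial k} (hq : q.natDegree ≤ n) :
    MvPolynomial.aeval (coord k) (homogenize n q) = algebraMap (Polynomial k) (RatFunc k) q := by
  conv_rhs => rw [q.as_sum_range' (n + 1) (by omega)]
  simp [homogenize, coord, ← Polynomial.C_mul_X_pow_eq_monomial]

theorem eval_homogenize (n : ℕ) (q : Polynomial k) (x : Fin 3 → k) :
    MvPolynomial.eval x (homogenize n q) =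
      ∑ i ∈ Finset.range (n + 1), q.coeff i * (x 0 ^ i * x 2 ^ (n - i)) := by
  simp [homogenize]

/-- Set z₂ = 1. The scalar `r` normalises the chosen coordinates of the point so that its last
coordinate is 1; by homogeneity rescaling does not affect nonvanishing. -/
theorem mem_localRing_of_eval {i : Fin 3} {c r : k} (hr : r ≠ 0) (hi : r • point k i = ![c, -(c + 1), 1]) {f : RatFunc k} :
    f ∈ localRing k i ↔ ∃ p q : Polynomial k, q.eval c ≠ 0 ∧
      f * algebraMap (Polynomial k) (RatFunc k) q = algebraMap (Polynomial k) (RatFunc k) p := by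
  constructor
  · rintro ⟨n, F, G, hF, hG, h0, h⟩
    refine ⟨MvPolynomial.aeval (polyCoord k) F, MvPolynomial.aeval (polyCoord k) G, ?_, by rw [← aeval_coord, h, aeval_coord]⟩
    rw [eval_aeval_polyCoord, ← hi, eval_smul_of_isHomogeneous hG]
    exact mul_ne_zero (pow_ne_zero _ hr) h0
  · rintro ⟨p, q, hq, h⟩
    set n := max p.natDegree q.natDegree
    have hqn : q.natDegree ≤ n := le_max_right _ _
    refine ⟨n, homogenize n p, homogenize n q, homogenize_isHomogeneous _ _,
      homogenize_isHomogeneous _ _, ?_, by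
        rw [aeval_homogenize hqn, aeval_homogenize (le_max_left _ _), h]⟩
    have h1 : r ^ n * MvPolynomial.eval (point k i) (homogenize n q) = q.eval c := by
      rw [← eval_smul_of_isHomogeneous (homogenize_isHomogeneous n q), hi, eval_homogenize,
        q.eval_eq_sum_range' (n := n + 1) (by omega)]
      simp
    exact right_ne_zero_of_mul (h1 ▸ hq)

theorem mem_localRing_zero {f : RatFunc k} :
    f ∈ localRing k 0 ↔ ∃ p q : Polynomial k, q.eval 0 ≠ 0 ∧
      f * algebraMap (Polynomial k) (RatFunc k) q = algebraMap (Polynomial k) (RatFunc k) p :=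
  mem_localRing_of_eval (r := -1) (by simp) (by ext i; fin_cases i <;> simp [point])

theorem mem_localRing_one {f : RatFunc k} :
    f ∈ localRing k 1 ↔ ∃ p q : Polynomial k, q.eval (-1) ≠ 0 ∧
      f * algebraMap (Polynomial k) (RatFunc k) q = algebraMap (Polynomial k) (RatFunc k) p :=
  mem_localRing_of_eval (r := 1) (by simp) (by ext i; fin_cases i <;> simp [point])

/-- P₂ is the point at infinity: a form of degree n is nonzero there exactly when its
dehomogenization has degree n, so the condition on values becomes one on degrees. -/
theorem mem_localRing_two {f : RatFunc k} :
    f ∈ localRing k 2 ↔ ∃ p q : Polynomial k, q ≠ 0 ∧ p.natDegree ≤ q.natDegree ∧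
      f * algebraMap (Polynomial k) (RatFunc k) q = algebraMap (Polynomial k) (RatFunc k) p := by
  constructor
  · rintro ⟨n, F, G, hF, hG, h0, h⟩
    have h1 : (MvPolynomial.aeval (polyCoord k) G).coeff n ≠ 0 := by
      rw [(natDegree_aeval_polyCoord hG).2]
      exact h0
    refine ⟨MvPolynomial.aeval (polyCoord k) F, MvPolynomial.aeval (polyCoord k) G, ?_,
      (natDegree_aeval_polyCoord hF).1.trans (Polynomial.le_natDegree_of_ne_zero h1),
      by rw [← aeval_coord, h, aeval_coord]⟩
    intro h2
    simp [h2] at h1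
  · rintro ⟨p, q, hq, hpq, h⟩
    refine ⟨q.natDegree, homogenize _ p, homogenize _ q, homogenize_isHomogeneous _ _,
      homogenize_isHomogeneous _ _, ?_, by
        rw [aeval_homogenize le_rfl, aeval_homogenize hpq, h]⟩
    rw [eval_homogenize, Finset.sum_range_succ, Finset.sum_eq_zero]
    · simpa [point] using hq
    · intro i hi
      have : q.natDegree - i ≠ 0 := by have := Finset.mem_range.mp hi; omega
      simp [point, this]

theorem mem_openRing {f : RatFunc k} : f ∈ openRing k ↔ ∃ (p : Polynomial k) (a b : ℕ),
    f * (RatFunc.X ^ a * (RatFunc.X + 1) ^ b) = algebraMap (Polynomial k) (RatFunc k) p := by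
  constructor
  · intro hf
    have hX : algebraMap (Polynomial k) (RatFunc k) Polynomial.X = RatFunc.X := by simp
    have hX1 : algebraMap (Polynomial k) (RatFunc k) (Polynomial.X + 1) = RatFunc.X + 1 := by simp
    induction hf using Algebra.adjoin_induction with
    | mem f hf =>
      obtain ⟨i, j, rfl⟩ := hf
      refine ⟨polyCoord k i * (![Polynomial.X + 1, -Polynomial.X,
        Polynomial.X * (Polynomial.X + 1)] : Fin 3 → Polynomial k) j, 1, 1, ?_⟩
      rw [map_mul, algebraMap_polyCoord, div_mul_eq_mul_div, mul_div_assoc]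
      congr 1
      rw [div_eq_iff (coord_ne_zero k j)]
      fin_cases j <;> simp [coord] <;> ring
    | algebraMap c => exact ⟨Polynomial.C c, 0, 0, by simp [RatFunc.algebraMap_eq_C]⟩
    | add f g _ _ hf hg =>
      obtain ⟨p, a, b, hp⟩ := hf
      obtain ⟨q, c, d, hq⟩ := hg
      refine ⟨p * (Polynomial.X ^ c * (Polynomial.X + 1) ^ d) +
        q * (Polynomial.X ^ a * (Polynomial.X + 1) ^ b), a + c, b + d, ?_⟩
      simp only [map_add, map_mul, map_pow, hX, hX1, ← hp, ← hq]
      ring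
    | mul f g _ _ hf hg =>
      obtain ⟨p, a, b, hp⟩ := hf
      obtain ⟨q, c, d, hq⟩ := hg
      refine ⟨p * q, a + c, b + d, ?_⟩
      rw [map_mul, ← hp, ← hq]
      ring
  · rintro ⟨p, a, b, h⟩
    have h0 : (RatFunc.X : RatFunc k) ≠ 0 := RatFunc.X_ne_zero
    have h1 : (RatFunc.X + 1 : RatFunc k) ≠ 0 := by
      simpa [coord] using neg_ne_zero.mp (coord_ne_zero k 1)
    have hf : f = algebraMap (Polynomial k) (RatFunc k) p * RatFunc.X⁻¹ ^ a *
        (RatFunc.X + 1)⁻¹ ^ b := by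
      rw [← h, inv_pow, inv_pow]; field_simp
    have m0 : RatFunc.X ∈ openRing k := Algebra.subset_adjoin ⟨0, 2, by simp [coord]⟩
    have m1 : RatFunc.X⁻¹ ∈ openRing k := Algebra.subset_adjoin ⟨2, 0, by simp [coord]⟩
    have m2 : (RatFunc.X + 1)⁻¹ ∈ openRing k := by
      rw [← neg_mem_iff]
      exact Algebra.subset_adjoin ⟨2, 1, by simp only [coord, Matrix.cons_val]; rw [one_div, inv_neg]⟩
    rw [hf]
    refine mul_mem (mul_mem ?_ (pow_mem m1 a)) (pow_mem m2 b)
    rw [← RatFunc.aeval_X_left_eq_algebraMap]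
    exact Algebra.adjoin_le (Set.singleton_subset_iff.mpr m0)
      (Polynomial.aeval_mem_adjoin_singleton k RatFunc.X)

end LocalRings

/-! ### The places at P₀, P₁ and infinity. -/

section Places

variable {k : Type u} [Field k]

theorem algebraMap_ratFunc_ne_zero {p : Polynomial k} (hp : p ≠ 0) :
    algebraMap (Polynomial k) (RatFunc k) p ≠ 0 := by
  simpa using hp

theorem exists_eq_div (f : RatFunc k) : ∃ p q : Polynomial k, q ≠ 0 ∧
    f * algebraMap (Polynomial k) (RatFunc k) q = algebraMap (Polynomial k) (RatFunc k) p := by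
  refine ⟨f.num, f.denom, f.denom_ne_zero, ?_⟩
  rw [← eq_div_iff (algebraMap_ratFunc_ne_zero f.denom_ne_zero), f.num_div_denom]

theorem exists_eq_pow_mul_of_ne_zero {p : Polynomial k} (hp : p ≠ 0) (c : k) :
    ∃ (n : ℕ) (q : Polynomial k), q.eval c ≠ 0 ∧ p = (Polynomial.X - Polynomial.C c) ^ n * q := by
  obtain ⟨q, hq, hq'⟩ := Polynomial.exists_eq_pow_rootMultiplicity_mul_and_not_dvd p hp c
  exact ⟨_, q, fun h => hq' (Polynomial.dvd_iff_isRoot.mpr h), hq⟩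

theorem isRationalPlace_of_eval {O : Subalgebra k (RatFunc k)} {c : k}
    (hO : ∀ f, f ∈ O ↔ ∃ p q : Polynomial k, q.eval c ≠ 0 ∧
      f * algebraMap (Polynomial k) (RatFunc k) q = algebraMap (Polynomial k) (RatFunc k) p) :
    IsRationalPlace O (algebraMap (Polynomial k) (RatFunc k)
      (Polynomial.X - Polynomial.C c)) := by
  have h0 := algebraMap_ratFunc_ne_zero (Polynomial.X_sub_C_ne_zero c)
  have hinj := RatFunc.algebraMap_injective k
  have hne : ∀ {q : Polynomial k}, q.eval c ≠ 0 →
      algebraMap (Polynomial k) (RatFunc k) q ≠ 0 := fun {q} hq =>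
    algebraMap_ratFunc_ne_zero (by rintro rfl; simp at hq)
  refine ⟨(hO _).mpr ⟨Polynomial.X - Polynomial.C c, 1, by simp, by rw [map_one, mul_one]⟩, h0, fun h => ?_, fun f hf => ?_,
    fun f hf => ?_⟩
  · obtain ⟨p, q, hq, h⟩ := (hO _).mp h
    rw [inv_mul_eq_iff_eq_mul₀ h0, ← map_mul] at h
    rw [hinj h] at hq
    simp at hq
  · obtain ⟨p, q, hq, h⟩ := exists_eq_div f
    have hp : p ≠ 0 := by
      rintro rfl
      rw [map_zero, mul_eq_zero] at h
      exact h.elim hf (algebraMap_ratFunc_ne_zero hq)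
    obtain ⟨m, p', hp', rfl⟩ := exists_eq_pow_mul_of_ne_zero hp c
    obtain ⟨n, q', hq', rfl⟩ := exists_eq_pow_mul_of_ne_zero hq c
    have e1 := hne hp'
    have e2 := hne hq'
    refine ⟨m - n, algebraMap _ (RatFunc k) p' / algebraMap _ (RatFunc k) q',
      (hO _).mpr ⟨p', q', hq', div_mul_cancel₀ _ e2⟩,
      (hO _).mpr ⟨q', p', hp', by rw [inv_div, div_mul_cancel₀ _ e1]⟩, ?_⟩
    rw [zpow_sub₀ h0, zpow_natCast, zpow_natCast]
    rw [map_mul, map_mul, map_pow, map_pow] at h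
    field_simp
    linear_combination h
  · obtain ⟨p, q, hq, h⟩ := (hO _).mp hf
    obtain ⟨r, hr⟩ : Polynomial.X - Polynomial.C c ∣
        p - Polynomial.C (p.eval c / q.eval c) * q := by
      rw [Polynomial.dvd_iff_isRoot]
      simp [hq]
    refine ⟨p.eval c / q.eval c, (hO _).mpr ⟨r, q, hq, ?_⟩⟩
    rw [mul_assoc, inv_mul_eq_iff_eq_mul₀ h0, ← map_mul, ← hr, map_sub, map_mul, ← h,
      RatFunc.algebraMap_eq_C, RatFunc.algebraMap_C]
    ring

theorem isRationalPlace_zero : IsRationalPlace (localRing k 0) RatFunc.X := by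
  have := isRationalPlace_of_eval (k := k) (c := 0) fun f => mem_localRing_zero
  simpa using this

theorem isRationalPlace_one : IsRationalPlace (localRing k 1) (RatFunc.X + 1) := by
  have := isRationalPlace_of_eval (k := k) (c := -1) fun f => mem_localRing_one
  simpa using this

theorem isRationalPlace_two : IsRationalPlace (localRing k 2) RatFunc.X⁻¹ := by
  have h0 : (RatFunc.X : RatFunc k) ≠ 0 := RatFunc.X_ne_zero
  have hinj := RatFunc.algebraMap_injective k
  have hX : algebraMap (Polynomial k) (RatFunc k) Polynomial.X = RatFunc.X := by simp
  refine ⟨mem_localRing_two.mpr ⟨1, Polynomial.X, Polynomial.X_ne_zero, by simp, by simp [h0]⟩,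
    inv_ne_zero h0, fun h => ?_, fun f hf => ?_, fun f hf => ?_⟩
  · rw [inv_inv] at h
    obtain ⟨p, q, hq, hpq, h⟩ := mem_localRing_two.mp h
    rw [← hX, ← map_mul] at h
    rw [← hinj h, Polynomial.natDegree_X_mul hq] at hpq
    omega
  · obtain ⟨p, q, hq, h⟩ := exists_eq_div f
    have hp : p ≠ 0 := by
      rintro rfl
      rw [map_zero, mul_eq_zero] at h
      exact h.elim hf (algebraMap_ratFunc_ne_zero hq)
    have e1 := algebraMap_ratFunc_ne_zero hp
    have e2 := algebraMap_ratFunc_ne_zero hq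
    have hXn : ∀ n : ℕ, (Polynomial.X ^ n : Polynomial k) ≠ 0 := fun n =>
      pow_ne_zero _ Polynomial.X_ne_zero
    -- Powers of `X` equalise the degrees of numerator and denominator, which makes their quotient a
    -- unit at infinity.
    have d1 : (p * Polynomial.X ^ q.natDegree).natDegree = p.natDegree + q.natDegree := by
      rw [Polynomial.natDegree_mul hp (hXn _), Polynomial.natDegree_X_pow]
    have d2 : (q * Polynomial.X ^ p.natDegree).natDegree = p.natDegree + q.natDegree := by
      rw [Polynomial.natDegree_mul hq (hXn _), Polynomial.natDegree_X_pow, add_comm]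
    have e3 := algebraMap_ratFunc_ne_zero (mul_ne_zero hp (hXn q.natDegree))
    have e4 := algebraMap_ratFunc_ne_zero (mul_ne_zero hq (hXn p.natDegree))
    refine ⟨q.natDegree - p.natDegree, algebraMap _ (RatFunc k) (p * Polynomial.X ^ q.natDegree) /
      algebraMap _ (RatFunc k) (q * Polynomial.X ^ p.natDegree),
      mem_localRing_two.mpr ⟨_, _, mul_ne_zero hq (hXn p.natDegree), (d1.trans d2.symm).le,
        div_mul_cancel₀ _ e4⟩,
      mem_localRing_two.mpr ⟨_, _, mul_ne_zero hp (hXn q.natDegree), (d2.trans d1.symm).le, by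
        rw [inv_div, div_mul_cancel₀ _ e3]⟩, ?_⟩
    rw [zpow_sub₀ (inv_ne_zero h0), zpow_natCast, zpow_natCast]
    simp only [map_mul, map_pow, hX, inv_pow]
    rw [← h]
    field_simp
  · obtain ⟨p, q, hq, hpq, h⟩ := mem_localRing_two.mp hf
    -- The value at infinity. The coefficient of `p` is taken in degree `q.natDegree`, so that it is
    -- zero when `p` has smaller degree.
    refine ⟨p.coeff q.natDegree / q.leadingCoeff, mem_localRing_two.mpr
      ⟨Polynomial.X * (p - Polynomial.C (p.coeff q.natDegree / q.leadingCoeff) * q), q, hq, ?_, ?_⟩⟩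
    · rw [Polynomial.natDegree_le_iff_coeff_eq_zero]
      intro N hN
      obtain ⟨N, rfl⟩ := Nat.exists_eq_add_of_lt (Nat.zero_lt_of_lt hN)
      rw [zero_add, Polynomial.coeff_X_mul, Polynomial.coeff_sub, Polynomial.coeff_C_mul]
      rcases (show q.natDegree ≤ N by omega).eq_or_lt with rfl | hlt
      · rw [Polynomial.coeff_natDegree,
          div_mul_cancel₀ _ (Polynomial.leadingCoeff_ne_zero.mpr hq), sub_self]
      · rw [Polynomial.coeff_eq_zero_of_natDegree_lt hlt,
          Polynomial.coeff_eq_zero_of_natDegree_lt (hpq.trans_lt hlt), mul_zero, sub_zero]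
    · rw [map_mul, map_sub, map_mul, ← h, hX, inv_inv, RatFunc.algebraMap_eq_C,
        RatFunc.algebraMap_C]
      ring

/-- Euclidean division provides the polynomial part: remainder over divisor vanishes at infinity. A
polynomial with this property is zero by degree. -/
theorem isComplementary_localRing_two :
    IsComplementary (algebraMap (Polynomial k) (RatFunc k)).range
      (algebraMap (localRing k 2) (RatFunc k)).range RatFunc.X := by
  have h0 : (RatFunc.X : RatFunc k) ≠ 0 := RatFunc.X_ne_zero
  have hinj := RatFunc.algebraMap_injective k
  have hX : algebraMap (Polynomial k) (RatFunc k) Polynomial.X = RatFunc.X := by simp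
  have hR : ∀ {f : RatFunc k}, f ∈ (algebraMap (localRing k 2) (RatFunc k)).range ↔
      f ∈ localRing k 2 := fun {f} => ⟨fun ⟨x, hx⟩ => hx ▸ x.2, fun h => ⟨⟨f, h⟩, rfl⟩⟩
  refine ⟨h0, ⟨_, hX⟩, hR.mpr isRationalPlace_two.mem, ?_, fun f => ?_, fun f => ?_⟩
  · rintro _ ⟨p, rfl⟩ h
    obtain ⟨r, q, hq, hrq, h⟩ := mem_localRing_two.mp (hR.mp h)
    rw [← hX, ← map_mul, ← map_mul] at h
    by_contra hp
    have hp : p ≠ 0 := by rintro rfl; simp at hp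
    rw [← hinj h, mul_assoc, Polynomial.natDegree_X_mul (mul_ne_zero hp hq),
      Polynomial.natDegree_mul hp hq] at hrq
    omega
  · obtain ⟨p, q, hq, h⟩ := exists_eq_div f
    refine ⟨_, ⟨p / q, rfl⟩, hR.mpr (mem_localRing_two.mpr ⟨Polynomial.X * (p % q), q, hq, ?_, ?_⟩)⟩
    · by_cases hpq : p % q = 0
      · simp [hpq]
      · rw [Polynomial.natDegree_X_mul hpq]
        exact Polynomial.natDegree_lt_natDegree hpq (EuclideanDomain.mod_lt p hq)
    · have := congrArg (algebraMap (Polynomial k) (RatFunc k)) (EuclideanDomain.div_add_mod p q)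
      rw [map_add, map_mul] at this
      rw [map_mul, hX]
      linear_combination RatFunc.X * h - RatFunc.X * this
  · obtain ⟨p, q, hq, h⟩ := exists_eq_div f
    refine ⟨p.natDegree, hR.mpr (mem_localRing_two.mpr
      ⟨p, Polynomial.X ^ p.natDegree * q, mul_ne_zero (pow_ne_zero _ Polynomial.X_ne_zero) hq, ?_, ?_⟩)⟩
    · rw [Polynomial.natDegree_mul (pow_ne_zero _ Polynomial.X_ne_zero) hq,
        Polynomial.natDegree_X_pow]
      omega
    · rw [map_mul, map_pow, hX, inv_pow, ← h]
      field_simp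

theorem range_algebraMap_eq_inf : (algebraMap k (RatFunc k)).range =
    (algebraMap (Polynomial k) (RatFunc k)).range ⊓
      (algebraMap (localRing k 2) (RatFunc k)).range := by
  refine le_antisymm ?_ ?_
  · rintro _ ⟨c, rfl⟩
    exact ⟨⟨Polynomial.C c, by simp [RatFunc.algebraMap_eq_C]⟩, ⟨algebraMap k _ c, rfl⟩⟩
  · rintro _ ⟨⟨p, rfl⟩, ⟨x, hx⟩⟩
    have h1 : algebraMap (Polynomial k) (RatFunc k) p ∈ localRing k 2 := hx ▸ x.2
    obtain ⟨r, q, hq, hrq, h⟩ := mem_localRing_two.mp h1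
    rw [← map_mul] at h
    have h2 : p.natDegree = 0 := by
      by_cases hp : p = 0
      · simp [hp]
      rw [← RatFunc.algebraMap_injective k h, Polynomial.natDegree_mul hp hq] at hrq
      omega
    refine ⟨p.coeff 0, ?_⟩
    conv_rhs => rw [Polynomial.eq_C_of_natDegree_eq_zero h2]
    simp [RatFunc.algebraMap_eq_C]

end Places

/-! ### The coordinate ring of Z° and the cover of the affine line. -/

section OpenRing

variable {k : Type u} [Field k]

theorem X_add_one_ne_zero : (RatFunc.X + 1 : RatFunc k) ≠ 0 :=
  isRationalPlace_one.ne_zero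

theorem algebraMap_mem_openRing (p : Polynomial k) :
    algebraMap (Polynomial k) (RatFunc k) p ∈ openRing k :=
  mem_openRing.mpr ⟨p, 0, 0, by simp⟩

theorem algebraMap_mem_localRing (p : Polynomial k) (i : Fin 3) (hi : i ≠ 2) :
    algebraMap (Polynomial k) (RatFunc k) p ∈ localRing k i := by
  fin_cases i
  · exact mem_localRing_zero.mpr ⟨p, 1, by simp, by simp⟩
  · exact mem_localRing_one.mpr ⟨p, 1, by simp, by simp⟩
  · exact absurd rfl hi

theorem X_inv_mem_openRing : (RatFunc.X : RatFunc k)⁻¹ ∈ openRing k :=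
  mem_openRing.mpr ⟨1, 1, 0, by simp [RatFunc.X_ne_zero]⟩

theorem X_add_one_inv_mem_openRing : (RatFunc.X + 1 : RatFunc k)⁻¹ ∈ openRing k :=
  mem_openRing.mpr ⟨1, 0, 1, by simp [X_add_one_ne_zero]⟩

/-- The inclusion of the polynomial ring. -/
noncomputable def polyToOpen (k : Type u) [Field k] : Polynomial k →+* openRing k :=
  (algebraMap (Polynomial k) (RatFunc k)).codRestrict (openRing k).toSubring
    algebraMap_mem_openRing

/-- The ring is the localization of k[t] at t(t + 1), so an ideal is generated by the generator of
its contraction. -/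
theorem openRing_isPrincipalIdealRing : IsPrincipalIdealRing (openRing k) := by
  refine ⟨fun I => ?_⟩
  obtain ⟨g, hg⟩ := (IsPrincipalIdealRing.principal (I.comap (polyToOpen k))).principal
  have hg' : ∀ p, polyToOpen k p ∈ I ↔ g ∣ p := fun p => by
    rw [← Ideal.mem_comap, hg, Ideal.submodule_span_eq, Ideal.mem_span_singleton]
  refine ⟨⟨polyToOpen k g, le_antisymm (fun f hf => ?_) ?_⟩⟩
  · obtain ⟨p, a, b, h⟩ := mem_openRing.mp f.2
    let w : openRing k := polyToOpen k (Polynomial.X ^ a * (Polynomial.X + 1) ^ b)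
    let w' : openRing k := ⟨_, mul_mem (pow_mem X_inv_mem_openRing a) (pow_mem X_add_one_inv_mem_openRing b)⟩
    have hw : (w : RatFunc k) = RatFunc.X ^ a * (RatFunc.X + 1) ^ b := by
      change algebraMap (Polynomial k) (RatFunc k) _ = _
      simp
    have h1 : f * w = polyToOpen k p := Subtype.ext (by
      change (f : RatFunc k) * w = algebraMap (Polynomial k) (RatFunc k) p
      rw [hw, h])
    have h2 : w * w' = 1 := Subtype.ext (by
      change (w : RatFunc k) * (RatFunc.X⁻¹ ^ a * (RatFunc.X + 1)⁻¹ ^ b) = 1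
      have := X_add_one_ne_zero (k := k)
      have := RatFunc.X_ne_zero (K := k)
      rw [hw, inv_pow, inv_pow]
      field_simp)
    obtain ⟨r, rfl⟩ := (hg' p).mp (h1 ▸ I.mul_mem_right _ hf)
    rw [Ideal.submodule_span_eq, Ideal.mem_span_singleton]
    refine ⟨polyToOpen k r * w', ?_⟩
    rw [← mul_assoc, ← map_mul, ← h1, mul_assoc, h2, mul_one]
  · rw [Ideal.submodule_span_eq, Ideal.span_singleton_le_iff_mem]
    exact (hg' g).mpr dvd_rfl

theorem openRing_isFractionRing : IsFractionRing (openRing k) (RatFunc k) := by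
  refine IsFractionRing.of_field _ _ fun z => ?_
  exact ⟨polyToOpen k z.num, polyToOpen k z.denom, z.num_div_denom.symm⟩

variable (k) in
/-- The rings of functions regular on `Z°`, at `P₀` and at `P₁`, which together cover the affine
line. -/
noncomputable def coverRing : Fin 3 → Subalgebra k (RatFunc k) :=
  ![openRing k, localRing k 0, localRing k 1]

/-- The three rings intersect in k[t]: a function on Z° has only t and t + 1 in its denominator, and
Bézout identities with denominators prime to them remove both. Writing a denominator as a power of t
times a power of t + 1 times a factor prime to both separates the rings, as gluing demands. -/
theorem isTraceOrder_cover {D : Type*} [Ring D] [Algebra (RatFunc k) D] {C : Fin 3 → Subring D}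
    (hC : ∀ i, IsTraceOrder (algebraMap (coverRing k i) (RatFunc k)).range (1 : RatFunc k) (C i)) :
    IsTraceOrder (algebraMap (Polynomial k) (RatFunc k)).range (1 : RatFunc k) (⨅ i, C i) := by
  have h0 : (RatFunc.X : RatFunc k) ≠ 0 := RatFunc.X_ne_zero
  have h1 : (RatFunc.X + 1 : RatFunc k) ≠ 0 := X_add_one_ne_zero
  have hX : algebraMap (Polynomial k) (RatFunc k) Polynomial.X = RatFunc.X := by simp
  have hX1 : algebraMap (Polynomial k) (RatFunc k) (Polynomial.X + 1) = RatFunc.X + 1 := by simp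
  have hR : ∀ {i} {f : RatFunc k}, f ∈ (algebraMap (coverRing k i) (RatFunc k)).range ↔
      f ∈ coverRing k i := fun {i f} => ⟨fun ⟨x, hx⟩ => hx ▸ x.2, fun h => ⟨⟨f, h⟩, rfl⟩⟩
  have hdecomp : ∀ f : RatFunc k, ∃ (p q : Polynomial k) (a b : ℕ), q.eval 0 ≠ 0 ∧
      q.eval (-1) ≠ 0 ∧ f * (RatFunc.X ^ a * (RatFunc.X + 1) ^ b * algebraMap _ (RatFunc k) q) =
        algebraMap _ (RatFunc k) p := by
    intro f
    obtain ⟨p, q, hq, h⟩ := exists_eq_div f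
    obtain ⟨a, q, hq0, rfl⟩ := exists_eq_pow_mul_of_ne_zero hq 0
    obtain ⟨b, q, hq1, rfl⟩ :=
      exists_eq_pow_mul_of_ne_zero (p := q) (by rintro rfl; simp at hq0) (-1)
    refine ⟨p, q, a, b, by simpa using hq0, hq1, ?_⟩
    rw [← h]
    simp only [map_mul, map_pow, map_zero, map_neg, map_one, sub_zero, sub_neg_eq_add, hX, hX1]
    ring
  refine isTraceOrder_iInf (fun i => ?_) (fun f hf => ?_) (fun f => ?_) (fun i j hij f => ?_) hC
  · rintro _ ⟨p, rfl⟩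
    rw [hR]
    fin_cases i
    · exact algebraMap_mem_openRing p
    · exact algebraMap_mem_localRing p 0 (by decide)
    · exact algebraMap_mem_localRing p 1 (by decide)
  · obtain ⟨p, a, b, hp⟩ := mem_openRing.mp (hR.mp (hf 0))
    obtain ⟨p₀, q₀, hq₀, hp₀⟩ := mem_localRing_zero.mp (hR.mp (hf 1))
    obtain ⟨p₁, q₁, hq₁, hp₁⟩ := mem_localRing_one.mp (hR.mp (hf 2))
    have hcop : ∀ (c : k) (q : Polynomial k) (n : ℕ), q.eval c ≠ 0 →
        IsCoprime ((Polynomial.X - Polynomial.C c) ^ n) q := fun c q n hq =>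
      ((Polynomial.irreducible_X_sub_C c).coprime_iff_not_dvd.mpr
        fun h => hq (Polynomial.dvd_iff_isRoot.mp h)).pow_left
    obtain ⟨u₀, v₀, h₀⟩ := hcop 0 q₀ a hq₀
    obtain ⟨u₁, v₁, h₁⟩ := hcop (-1) q₁ b hq₁
    have e₀ := congrArg (algebraMap (Polynomial k) (RatFunc k)) h₀
    have e₁ := congrArg (algebraMap (Polynomial k) (RatFunc k)) h₁
    simp only [map_mul, map_pow, map_add, map_zero, map_neg, map_one, sub_zero, sub_neg_eq_add,
      RatFunc.algebraMap_X] at e₀ e₁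
    refine ⟨u₁ * (u₀ * p + v₀ * (Polynomial.X + 1) ^ b * p₀) + v₁ * p₁, ?_⟩
    simp only [map_mul, map_pow, map_add, ← hp, ← hp₀, ← hp₁, map_one, RatFunc.algebraMap_X]
    linear_combination f * algebraMap _ (RatFunc k) u₁ * (RatFunc.X + 1) ^ b * e₀ + f * e₁
  · obtain ⟨p, q, hq, h⟩ := exists_eq_div f
    exact ⟨_, ⟨q, rfl⟩, algebraMap_ratFunc_ne_zero hq, ⟨p, by rw [mul_comm, h]⟩⟩
  · obtain ⟨p, q, a, b, hq0, hq1, h⟩ := hdecomp f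
    have hq : algebraMap _ (RatFunc k) q ≠ 0 :=
      algebraMap_ratFunc_ne_zero (by rintro rfl; simp at hq0)
    have sX : RatFunc.X ^ a ∈ (algebraMap (Polynomial k) (RatFunc k)).range :=
      ⟨Polynomial.X ^ a, by simp⟩
    have s1 : (RatFunc.X + 1) ^ b ∈ (algebraMap (Polynomial k) (RatFunc k)).range :=
      ⟨(Polynomial.X + 1) ^ b, by simp⟩
    have mX : RatFunc.X ^ a * f ∈ localRing k 0 := mem_localRing_zero.mpr
      ⟨p, (Polynomial.X + 1) ^ b * q, by simpa using hq0, by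
        rw [← h, map_mul, map_pow, hX1]; ring⟩
    have m1 : (RatFunc.X + 1) ^ b * f ∈ localRing k 1 := mem_localRing_one.mpr
      ⟨p, Polynomial.X ^ a * q, by simpa using hq1, by rw [← h, map_mul, map_pow, hX]; ring⟩
    have mq : algebraMap _ (RatFunc k) q * f ∈ openRing k := mem_openRing.mpr
      ⟨p, a, b, by rw [← h]; ring⟩
    have i1 : (RatFunc.X ^ a)⁻¹ ∈ localRing k 1 := mem_localRing_one.mpr
      ⟨1, Polynomial.X ^ a, by simp, by simp [h0]⟩
    have i2 : ((RatFunc.X + 1) ^ b)⁻¹ ∈ localRing k 0 := mem_localRing_zero.mpr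
      ⟨1, (Polynomial.X + 1) ^ b, by simp, by simp [h1]⟩
    have i3 : (RatFunc.X ^ a)⁻¹ ∈ openRing k := by
      rw [← inv_pow]; exact pow_mem X_inv_mem_openRing a
    have i4 : ((RatFunc.X + 1) ^ b)⁻¹ ∈ openRing k := by
      rw [← inv_pow]; exact pow_mem X_add_one_inv_mem_openRing b
    have i5 : (algebraMap _ (RatFunc k) q)⁻¹ ∈ localRing k 0 := mem_localRing_zero.mpr
      ⟨1, q, hq0, by rw [inv_mul_cancel₀ hq, map_one]⟩
    have i6 : (algebraMap _ (RatFunc k) q)⁻¹ ∈ localRing k 1 := mem_localRing_one.mpr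
      ⟨1, q, hq1, by rw [inv_mul_cancel₀ hq, map_one]⟩
    simp only [hR]
    fin_cases i <;> fin_cases j
    · exact absurd rfl hij
    · exact ⟨_, sX, pow_ne_zero _ h0, i3, mX⟩
    · exact ⟨_, s1, pow_ne_zero _ h1, i4, m1⟩
    · exact ⟨_, ⟨q, rfl⟩, hq, i5, mq⟩
    · exact absurd rfl hij
    · exact ⟨_, s1, pow_ne_zero _ h1, i2, m1⟩
    · exact ⟨_, ⟨q, rfl⟩, hq, i6, mq⟩
    · exact ⟨_, sX, pow_ne_zero _ h0, i1, mX⟩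
    · exact absurd rfl hij

end OpenRing

/-! ### Classes with at most quadratic ramification at infinity. -/

section Unramified

variable {k : Type u} [Field k] [CharZero k]

theorem Br.baseChange_baseChange (R S T : Type u) [CommRing R] [CommRing S] [CommRing T]
    [Algebra R S] [Algebra S T] [Algebra R T] [IsScalarTower R S T] (β : Br R) :
    Br.baseChange S T (Br.baseChange R S β) = Br.baseChange R T β := by
  obtain ⟨A, rfl⟩ := Br.exists_rep β
  rw [← Br.mk_baseChange, ← Br.mk_baseChange, ← Br.mk_baseChange]
  let e : T ⊗[R] A.carrier ≃ₐ[T] T ⊗[S] (S ⊗[R] A.carrier) :=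
    AlgEquiv.ofLinearEquiv
      (TensorProduct.AlgebraTensorModule.cancelBaseChange R S T T A.carrier).symm
      (by simp [Algebra.TensorProduct.one_def])
      (LinearMap.map_mul_of_map_mul_tmul (fun _ _ _ _ => by simp))
  exact Br.mk_eq_of_algEquiv (A := (A.baseChange S).baseChange T) (B := A.baseChange T) e.symm

instance : CharZero (RatFunc k) :=
  charZero_of_injective_algebraMap (algebraMap k (RatFunc k)).injective

theorem openRing_baseChange_injective :
    Function.Injective (Br.baseChange (openRing k) (RatFunc k)) := by
  have := openRing_isPrincipalIdealRing (k := k)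
  have := openRing_isFractionRing (k := k)
  exact Br.baseChange_injective (isUnit_natCast k _)

/-- A class on `Z°` that is unramified at `P₀` and `P₁` and has quadratic ramification at `P₂` is
constant. -/
theorem mem_constantClasses {β : Br (openRing k)}
    (h0 : Br.baseChange (openRing k) (RatFunc k) β ∈ (Br.baseChange (localRing k 0) (RatFunc k)).range)
    (h1 : Br.baseChange (openRing k) (RatFunc k) β ∈ (Br.baseChange (localRing k 1) (RatFunc k)).range)
    (d : kˣ) (h2 : Br.baseChange (openRing k) (RatFunc k) β -
      quaternionClass isUnit_two_field (Units.map (algebraMap k (RatFunc k)).toMonoidHom d)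
        (Units.mk0 RatFunc.X⁻¹ isRationalPlace_two.ne_zero) ∈
          (Br.baseChange (localRing k 2) (RatFunc k)).range) :
    β ∈ constantClasses k := by
  obtain ⟨D, _, _, _, hD⟩ := Br.exists_divisionRing (Br.baseChange (openRing k) (RatFunc k) β)
  have hcover : ∀ i, ∃ C : Subring D,
      IsTraceOrder (algebraMap (coverRing k i) (RatFunc k)).range (1 : RatFunc k) C := by
    intro i
    fin_cases i
    · have := openRing_isPrincipalIdealRing (k := k)
      have := openRing_isFractionRing (k := k)
      have h : ∃ C : Subring D, IsTraceOrder (algebraMap (openRing k) (RatFunc k)).range 1 C :=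
        exists_isTraceOrder_of_mem_range (isUnit_natCast k _) ⟨D⟩ (hD ▸ ⟨β, rfl⟩)
      exact h
    · have := (isRationalPlace_zero (k := k)).isDiscreteValuationRing
      have := (isRationalPlace_zero (k := k)).isFractionRing
      have h : ∃ C : Subring D, IsTraceOrder (algebraMap (localRing k 0) (RatFunc k)).range 1 C :=
        exists_isTraceOrder_of_mem_range (isUnit_natCast k _) ⟨D⟩ (hD ▸ h0)
      exact h
    · have := (isRationalPlace_one (k := k)).isDiscreteValuationRing
      have := (isRationalPlace_one (k := k)).isFractionRing
      have h : ∃ C : Subring D, IsTraceOrder (algebraMap (localRing k 1) (RatFunc k)).range 1 C :=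
        exists_isTraceOrder_of_mem_range (isUnit_natCast k _) ⟨D⟩ (hD ▸ h1)
      exact h
  choose C hC using hcover
  obtain ⟨C', hC'⟩ : ∃ C' : Subring D, IsTraceOrder (algebraMap (localRing k 2) (RatFunc k)).range
      (RatFunc.X⁻¹ : RatFunc k) C' := by
    have := (isRationalPlace_two (k := k)).isDiscreteValuationRing
    have := (isRationalPlace_two (k := k)).isFractionRing
    exact exists_isTraceOrder_of_sub_mem_range (O := localRing k 2) (isUnit_natCast k _) ⟨D⟩
      (Units.map (algebraMap k (localRing k 2)).toMonoidHom d) ⟨_, isRationalPlace_two.mem⟩ _ _ rfl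
      rfl (hD ▸ h2)
  -- The three unramified orders glue to one over k[t], while the symbol at P₂ costs one uniformizer
  -- `X⁻¹` in the order there: exactly the situation of the descent theorem.
  have h3 := mk_mem_range_of_isTraceOrder isComplementary_localRing_two range_algebraMap_eq_inf
    (isTraceOrder_cover hC) hC'
  rw [hD] at h3
  obtain ⟨γ, hγ⟩ := h3
  refine ⟨γ, openRing_baseChange_injective ?_⟩
  rw [Br.baseChange_baseChange, hγ]

end Unramified

/-! ### Bilinearity of quaternion symbols. -/

section Symbols

/-- The quaternion basis defined by two anticommuting elements. -/
def quaternionBasis {R A : Type*} [CommRing R] [Ring A] [Algebra R A] {a b : R} (i j : A)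
    (hi : i * i = algebraMap R A a) (hj : j * j = algebraMap R A b) (hij : i * j = -(j * i)) :
    QuaternionAlgebra.Basis A a 0 b where
  i := i
  j := j
  k := i * j
  i_mul_i := by rw [hi, zero_smul, add_zero, Algebra.algebraMap_eq_smul_one]
  j_mul_j := by rw [hj, Algebra.algebraMap_eq_smul_one]
  i_mul_j := rfl
  j_mul_i := by rw [hij, zero_smul, zero_sub, neg_neg]

theorem quaternion_i_mul_i {R : Type*} [CommRing R] (a b : R) :
    (⟨0, 1, 0, 0⟩ * ⟨0, 1, 0, 0⟩ : QuaternionAlgebra R a 0 b) = algebraMap R _ a := by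
  ext <;> simp

theorem quaternion_j_mul_j {R : Type*} [CommRing R] (a b : R) :
    (⟨0, 0, 1, 0⟩ * ⟨0, 0, 1, 0⟩ : QuaternionAlgebra R a 0 b) = algebraMap R _ b := by
  ext <;> simp

theorem quaternion_i_mul_j {R : Type*} [CommRing R] (a b : R) :
    (⟨0, 1, 0, 0⟩ * ⟨0, 0, 1, 0⟩ : QuaternionAlgebra R a 0 b) =
      -(⟨0, 0, 1, 0⟩ * ⟨0, 1, 0, 0⟩) := by
  ext <;> simp

theorem commute_lift {R A : Type*} [CommRing R] [Ring A] [Algebra R A] {a b c d : R}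
    (q : QuaternionAlgebra.Basis A a 0 b) (q' : QuaternionAlgebra.Basis A c 0 d)
    (h1 : Commute q.i q'.i) (h2 : Commute q.i q'.j) (h3 : Commute q.j q'.i)
    (h4 : Commute q.j q'.j) (x : QuaternionAlgebra R a 0 b) (y : QuaternionAlgebra R c 0 d) :
    Commute (q.liftHom x) (q'.liftHom y) := by
  have key : ∀ z : A, Commute q.i z → Commute q.j z → Commute (q.liftHom x) z := by
    intro z hi hj
    have hk : Commute q.k z := q.i_mul_j ▸ hi.mul_left hj
    exact (((Algebra.commute_algebraMap_left _ z).add_left (hi.smul_left _)).add_left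
      (hj.smul_left _)).add_left (hk.smul_left _)
  have e1 := key _ h1 h3
  have e2 := key _ h2 h4
  have e3 : Commute (q.liftHom x) q'.k := q'.i_mul_j ▸ e1.mul_right e2
  exact (((Algebra.commute_algebraMap_right _ _).add_right (e1.smul_right _)).add_right
      (e2.smul_right _)).add_right (e3.smul_right _)

variable {K : Type u} [Field K] [CharZero K]

/-- The symbol `(a, b)` in the Brauer group of a field. -/
noncomputable def symbol (a b : Kˣ) : Br K := quaternionClass isUnit_two_field a b

theorem symbol_eq_mk {A : AzumayaAlg K} (hA : Module.finrank K A.carrier = 4) {a b : Kˣ}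
    (i j : A.carrier) (hi : i * i = algebraMap K A.carrier a) (hj : j * j = algebraMap K A.carrier b)
    (hij : i * j = -(j * i)) : symbol a b = Br.mk A := by
  have := isAzumaya_quaternion isUnit_two_field a b
  exact Br.mk_eq_of_algEquiv (AlgEquiv.ofBijective (quaternionBasis i j hi hj hij).liftHom
    (IsAzumaya.bijective_of_finrank_eq _ (by rw [hA, QuaternionAlgebra.finrank_eq_four])))

theorem symbol_comm (a b : Kˣ) : symbol a b = symbol b a := by
  have := isAzumaya_quaternion isUnit_two_field b a
  refine symbol_eq_mk (A := ⟨QuaternionAlgebra K (b : K) 0 (a : K)⟩)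
    (QuaternionAlgebra.finrank_eq_four _ _ _) ⟨0, 0, 1, 0⟩ ⟨0, 1, 0, 0⟩ ?_ ?_ ?_ <;>
  ext <;> simp

theorem symbol_sq_right (a b : Kˣ) : symbol a (b ^ 2) = 0 := by
  have := isAzumaya_quaternion isUnit_two_field a (b ^ 2)
  let i : Matrix (Fin 2) (Fin 2) K := !![0, a; 1, 0]
  let j : Matrix (Fin 2) (Fin 2) K := !![b, 0; 0, -b]
  have hi : i * i = algebraMap K _ (a : K) := by
    ext m n
    fin_cases m <;> fin_cases n <;> simp [i, Matrix.mul_apply, Matrix.algebraMap_matrix_apply]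
  have hj : j * j = algebraMap K _ ((b ^ 2 : Kˣ) : K) := by
    ext m n
    fin_cases m <;> fin_cases n <;> simp [j, Matrix.mul_apply, Matrix.algebraMap_matrix_apply, sq]
  have hij : i * j = -(j * i) := by
    ext m n
    fin_cases m <;> fin_cases n <;> simp [i, j, Matrix.mul_apply, mul_comm]
  exact Br.mk_eq_zero_of_algEquiv_end (A := ⟨QuaternionAlgebra K (a : K) 0 ((b ^ 2 : Kˣ) : K)⟩)
    ⟨Fin 2 → K⟩ ((AlgEquiv.ofBijective (quaternionBasis i j hi hj hij).liftHom
      (IsAzumaya.bijective_of_finrank_eq _ (by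
        rw [Module.finrank_matrix, QuaternionAlgebra.finrank_eq_four]; simp))).trans
      Matrix.toLinAlgEquiv')

/-- The tensor product of (a, b) and (a, c) contains commuting copies of (a, bc), generated by i ⊗ 1
and j ⊗ j', and of (c, a²), generated by 1 ⊗ j' and i ⊗ i'. Dimensions agree, and (c, a²) is split.
-/
theorem symbol_mul_right (a b c : Kˣ) : symbol a (b * c) = symbol a b + symbol a c := by
  have z1 := isAzumaya_quaternion isUnit_two_field a (b * c)
  have z2 := isAzumaya_quaternion isUnit_two_field c (a ^ 2)
  have z3 := isAzumaya_quaternion isUnit_two_field a b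
  have z4 := isAzumaya_quaternion isUnit_two_field a c
  let A : AzumayaAlg K := ⟨QuaternionAlgebra K (a : K) 0 ((b * c : Kˣ) : K)⟩
  let A' : AzumayaAlg K := ⟨QuaternionAlgebra K (c : K) 0 ((a ^ 2 : Kˣ) : K)⟩
  let B : AzumayaAlg K := ⟨QuaternionAlgebra K (a : K) 0 (b : K)⟩
  let B' : AzumayaAlg K := ⟨QuaternionAlgebra K (a : K) 0 (c : K)⟩
  let H := QuaternionAlgebra K (a : K) 0 (b : K)
  let H' := QuaternionAlgebra K (a : K) 0 (c : K)
  let i : H := ⟨0, 1, 0, 0⟩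
  let j : H := ⟨0, 0, 1, 0⟩
  let i' : H' := ⟨0, 1, 0, 0⟩
  let j' : H' := ⟨0, 0, 1, 0⟩
  have hi : i * i = algebraMap K H a := quaternion_i_mul_i _ _
  have hj : j * j = algebraMap K H b := quaternion_j_mul_j _ _
  have hij : i * j = -(j * i) := quaternion_i_mul_j _ _
  have hi' : i' * i' = algebraMap K H' a := quaternion_i_mul_i _ _
  have hj' : j' * j' = algebraMap K H' c := quaternion_j_mul_j _ _
  have hij' : i' * j' = -(j' * i') := quaternion_i_mul_j _ _
  have ht : ∀ x y : K, algebraMap K H x ⊗ₜ[K] algebraMap K H' y = algebraMap K (H ⊗[K] H') (x * y) := by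
    intro x y
    rw [Algebra.TensorProduct.algebraMap_apply, map_mul, Algebra.algebraMap_eq_smul_one y,
      ← TensorProduct.smul_tmul, Algebra.smul_def, ← map_mul, ← map_mul, mul_comm]
  let q : QuaternionAlgebra.Basis (H ⊗[K] H') (a : K) 0 ((b * c : Kˣ) : K) :=
    quaternionBasis (i ⊗ₜ 1) (j ⊗ₜ j')
      (by rw [Algebra.TensorProduct.tmul_mul_tmul, hi, mul_one, Algebra.TensorProduct.algebraMap_apply])
      (by rw [Algebra.TensorProduct.tmul_mul_tmul, hj, hj', ht, Units.val_mul])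
      (by simp only [Algebra.TensorProduct.tmul_mul_tmul, one_mul, mul_one, hij, TensorProduct.neg_tmul])
  let q' : QuaternionAlgebra.Basis (H ⊗[K] H') (c : K) 0 ((a ^ 2 : Kˣ) : K) :=
    quaternionBasis (1 ⊗ₜ j') (i ⊗ₜ i')
      (by rw [Algebra.TensorProduct.tmul_mul_tmul, hj', mul_one, ← map_one (algebraMap K H), ht, one_mul])
      (by rw [Algebra.TensorProduct.tmul_mul_tmul, hi, hi', ht, Units.val_pow_eq_pow_val, sq])
      (by simp only [Algebra.TensorProduct.tmul_mul_tmul, one_mul, mul_one, hij', TensorProduct.tmul_neg, neg_neg])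
  have hc := commute_lift q q'
    (by change (i ⊗ₜ 1) * (1 ⊗ₜ j') = (1 ⊗ₜ j') * (i ⊗ₜ 1); simp)
    (by change (i ⊗ₜ 1) * (i ⊗ₜ i') = (i ⊗ₜ i') * (i ⊗ₜ 1); simp)
    (by change (j ⊗ₜ j') * (1 ⊗ₜ j') = (1 ⊗ₜ j') * (j ⊗ₜ j'); simp)
    (by
      change (j ⊗ₜ j') * (i ⊗ₜ i') = (i ⊗ₜ i') * (j ⊗ₜ j')
      simp [hij, hij', TensorProduct.neg_tmul, TensorProduct.tmul_neg])
  let f := Algebra.TensorProduct.lift q.liftHom q'.liftHom hc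
  have hf : Function.Bijective f := by
    have := isAzumaya_tensor (R := K) (QuaternionAlgebra K (a : K) 0 ((b * c : Kˣ) : K))
      (QuaternionAlgebra K (c : K) 0 ((a ^ 2 : Kˣ) : K))
    refine IsAzumaya.bijective_of_finrank_eq f ?_
    simp only [Module.finrank_tensorProduct, H, H', QuaternionAlgebra.finrank_eq_four]
  have h1 : Br.mk (A.tensor A') = Br.mk (B.tensor B') :=
    Br.mk_eq_of_algEquiv (A := A.tensor A') (B := B.tensor B') (AlgEquiv.ofBijective f hf)
  have h2 : symbol a (b * c) + symbol c (a ^ 2) = symbol a b + symbol a c := h1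
  rwa [symbol_sq_right, add_zero] at h2

theorem symbol_mul_left (a b c : Kˣ) : symbol (a * b) c = symbol a c + symbol b c := by
  rw [symbol_comm, symbol_mul_right, symbol_comm c, symbol_comm c]

theorem symbol_sq_left (a b : Kˣ) : symbol (a ^ 2) b = 0 := by
  rw [symbol_comm, symbol_sq_right]

theorem symbol_one_right (a : Kˣ) : symbol a 1 = 0 := by
  simpa using symbol_sq_right a 1

theorem symbol_one_left (a : Kˣ) : symbol 1 a = 0 := by
  simpa using symbol_sq_left 1 a

theorem symbol_add_self (a b : Kˣ) : symbol a b + symbol a b = 0 := by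
  rw [← symbol_mul_right, ← sq, symbol_sq_right]

theorem neg_symbol (a b : Kˣ) : -symbol a b = symbol a b :=
  neg_eq_of_add_eq_zero_left (symbol_add_self a b)

theorem symbol_inv_right (a b : Kˣ) : symbol a b⁻¹ = symbol a b := by
  have h := symbol_mul_right a b b⁻¹
  rw [mul_inv_cancel, symbol_one_right] at h
  rw [← neg_symbol a b]
  exact (neg_eq_of_add_eq_zero_right h.symm).symm

theorem baseChange_quaternionClass {R : Type u} [CommRing R] [Algebra R K] (h2 : IsUnit (2 : R))
    (a b : Rˣ) : Br.baseChange R K (quaternionClass h2 a b) =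
      symbol (Units.map (algebraMap R K).toMonoidHom a) (Units.map (algebraMap R K).toMonoidHom b) := by
  have z := isAzumaya_quaternion h2 a b
  let A : AzumayaAlg R := ⟨QuaternionAlgebra R (a : R) 0 (b : R)⟩
  have hA : Br.mk (A.baseChange K) = Br.baseChange R K (quaternionClass h2 a b) := rfl
  rw [← hA]
  let H := QuaternionAlgebra R (a : R) 0 (b : R)
  let i : H := ⟨0, 1, 0, 0⟩
  let j : H := ⟨0, 0, 1, 0⟩
  have hi : i * i = algebraMap R H a := quaternion_i_mul_i _ _
  have hj : j * j = algebraMap R H b := quaternion_j_mul_j _ _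
  have hij : i * j = -(j * i) := quaternion_i_mul_j _ _
  have ht : ∀ x : R, (1 : K) ⊗ₜ[R] algebraMap R H x = algebraMap K (K ⊗[R] H) (algebraMap R K x) := by
    intro x
    rw [Algebra.TensorProduct.algebraMap_apply, Algebra.algebraMap_eq_smul_one x,
      ← TensorProduct.smul_tmul, Algebra.smul_def, mul_one]
    rfl
  have e0 : Module.finrank K (K ⊗[R] H) = 4 := by
    have : Nontrivial R := (algebraMap R K).domain_nontrivial
    have : Module.Free R H := .of_basis (QuaternionAlgebra.basisOneIJK _ _ _)
    rw [Module.finrank_baseChange, QuaternionAlgebra.finrank_eq_four]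
  have e1 : (1 ⊗ₜ i : K ⊗[R] H) * (1 ⊗ₜ i) = algebraMap K (K ⊗[R] H) (algebraMap R K a) := by
    rw [Algebra.TensorProduct.tmul_mul_tmul, hi, mul_one, ht]
  have e2 : (1 ⊗ₜ j : K ⊗[R] H) * (1 ⊗ₜ j) = algebraMap K (K ⊗[R] H) (algebraMap R K b) := by
    rw [Algebra.TensorProduct.tmul_mul_tmul, hj, mul_one, ht]
  have e3 : (1 ⊗ₜ i : K ⊗[R] H) * (1 ⊗ₜ j) = -((1 ⊗ₜ j) * (1 ⊗ₜ i)) := by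
    rw [Algebra.TensorProduct.tmul_mul_tmul, Algebra.TensorProduct.tmul_mul_tmul, hij,
      TensorProduct.tmul_neg]
  exact (symbol_eq_mk (A := A.baseChange K) e0 _ _ e1 e2 e3).symm

end Symbols

/-! ### Quadratic Kummer theory. -/

section Kummer

open IntermediateField

variable {k : Type u} [Field k]

/-- A square root in the algebraic closure. -/
noncomputable def sqrt (d : k) : AlgebraicClosure k :=
  (IsAlgClosed.exists_pow_nat_eq (algebraMap k (AlgebraicClosure k) d) zero_lt_two).choose

theorem sqrt_sq (d : k) : sqrt d ^ 2 = algebraMap k (AlgebraicClosure k) d :=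
  (IsAlgClosed.exists_pow_nat_eq (algebraMap k (AlgebraicClosure k) d) zero_lt_two).choose_spec

theorem ne_zero_of_sq_eq {d : kˣ} {y : AlgebraicClosure k}
    (hy : y ^ 2 = algebraMap k (AlgebraicClosure k) d) : y ≠ 0 := by
  rintro rfl
  rw [zero_pow two_ne_zero] at hy
  exact d.ne_zero ((map_eq_zero _).mp hy.symm)

theorem sqrt_ne_zero (d : kˣ) : sqrt (d : k) ≠ 0 := ne_zero_of_sq_eq (sqrt_sq (d : k))

theorem apply_eq_or_eq_neg {y : AlgebraicClosure k} {d : k}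
    (hy : y ^ 2 = algebraMap k (AlgebraicClosure k) d) (g : AbsGal k) : g y = y ∨ g y = -y := by
  rw [← sq_eq_sq_iff_eq_or_eq_neg, ← map_pow, hy, AlgEquiv.commutes]

theorem ker_eq_fixingSubgroup {A : Type*} [Group A] {φ : AbsGal k →* A} {y : AlgebraicClosure k}
    (h : ∀ g, φ g = 1 ↔ g y = y) : φ.ker = k⟮y⟯.fixingSubgroup := by
  ext g
  rw [MonoidHom.mem_ker, h, IntermediateField.mem_fixingSubgroup_iff]
  constructor
  · intro hg x hx
    have : k⟮y⟯ ≤ fixedField (Subgroup.zpowers g) := by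
      rw [adjoin_simple_le_iff, mem_fixedField_iff]
      intro f hf
      have : Subgroup.zpowers g ≤ MulAction.stabilizer (AbsGal k) y := by
        rw [Subgroup.zpowers_le]; exact hg
      exact this hf
    exact (mem_fixedField_iff _ _).mp (this hx) g (Subgroup.mem_zpowers g)
  · exact fun hg => hg y (mem_adjoin_simple_self k y)

theorem isOpen_ker_of_iff {A : Type*} [Group A] {φ : AbsGal k →* A} {y : AlgebraicClosure k}
    (h : ∀ g, φ g = 1 ↔ g y = y) : IsOpen (φ.ker : Set (AbsGal k)) := by
  rw [ker_eq_fixingSubgroup h]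
  have : FiniteDimensional k k⟮y⟯ := adjoin.finiteDimensional (Algebra.IsIntegral.isIntegral y)
  exact fixingSubgroup_isOpen _

variable [CharZero k]

theorem neg_ne_self_of_ne_zero {y : AlgebraicClosure k} (hy : y ≠ 0) : -y ≠ y := by
  intro h
  exact hy (self_eq_neg.mp h.symm)

theorem mem_range_of_forall_apply_eq {y : AlgebraicClosure k} (h : ∀ g : AbsGal k, g y = y) :
    ∃ c : k, algebraMap k (AlgebraicClosure k) c = y :=
  (InfiniteGalois.mem_range_algebraMap_iff_fixed y).mpr h

theorem isSquare_of_forall_apply_eq {y : AlgebraicClosure k} {d : k}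
    (hy : y ^ 2 = algebraMap k (AlgebraicClosure k) d) (h : ∀ g : AbsGal k, g y = y) :
    IsSquare d := by
  obtain ⟨c, rfl⟩ := mem_range_of_forall_apply_eq h
  rw [← map_pow] at hy
  exact ⟨c, by rw [← sq, (algebraMap k (AlgebraicClosure k)).injective hy]⟩

/-- An open subgroup of index two is the stabilizer of a square root. -/
theorem exists_sq_eq_of_ker {A : Type*} [CommGroup A] (φ : AbsGal k →* A)
    (hφ : IsOpen (φ.ker : Set (AbsGal k))) {g₀ : AbsGal k} (hg₀ : φ g₀ ≠ 1)
    (h2 : ∀ g, φ g = 1 ∨ φ g = φ g₀) :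
    ∃ (d : kˣ) (y : AlgebraicClosure k), y ^ 2 = algebraMap k (AlgebraicClosure k) d ∧
      (∀ g, φ g = 1 → g y = y) ∧ ∀ g, φ g ≠ 1 → g y = -y := by
  have hclosed : IsClosed (φ.ker : Set (AbsGal k)) := Subgroup.isClosed_of_isOpen _ hφ
  have hfix := InfiniteGalois.fixingSubgroup_fixedField (⟨φ.ker, hclosed⟩ : ClosedSubgroup (AbsGal k))
  -- By the Galois correspondence `g₀` moves some `z` in the fixed field of the kernel. Then `z - g₀
  -- z` is fixed by the kernel and negated by everything else, so its square lies in `k`.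
  obtain ⟨z, hz, hgz⟩ : ∃ z ∈ fixedField φ.ker, g₀ z ≠ z := by
    by_contra hcon
    push Not at hcon
    have : g₀ ∈ (fixedField φ.ker).fixingSubgroup := (mem_fixingSubgroup_iff _ _).mpr hcon
    rw [hfix] at this
    exact hg₀ this
  have hz' : ∀ g, φ g = 1 → g z = z := fun g hg => (mem_fixedField_iff _ _).mp hz g hg
  have hsq : φ (g₀ * g₀) = 1 := (h2 _).resolve_right fun h => by
    rw [map_mul, mul_eq_left] at h
    exact hg₀ h
  have h1 : ∀ g, φ g = 1 → g (z - g₀ z) = z - g₀ z := by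
    intro g hg
    have h3 := hz' (g₀⁻¹ * g * g₀) (by simp [hg])
    have h4 : g (g₀ z) = g₀ z := by
      conv_rhs => rw [← h3]
      simp only [AlgEquiv.mul_apply]
      exact (AlgEquiv.apply_symm_apply g₀ _).symm
    rw [map_sub, hz' g hg, h4]
  have h0 : g₀ (z - g₀ z) = -(z - g₀ z) := by
    rw [map_sub, ← AlgEquiv.mul_apply, hz' _ hsq, neg_sub]
  have h3 : ∀ g, φ g ≠ 1 → g (z - g₀ z) = -(z - g₀ z) := by
    intro g hg
    have hg' := (h2 g).resolve_left hg
    have h4 := h1 (g₀⁻¹ * g) (by rw [map_mul, map_inv, hg', inv_mul_cancel])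
    rw [← h0]
    conv_rhs => rw [← h4]
    simp only [AlgEquiv.mul_apply]
    exact (AlgEquiv.apply_symm_apply g₀ _).symm
  obtain ⟨d, hd⟩ := mem_range_of_forall_apply_eq (y := (z - g₀ z) ^ 2) fun g => by
    by_cases hg : φ g = 1
    · rw [map_pow, h1 g hg]
    · rw [map_pow, h3 g hg, neg_sq]
  have hd0 : d ≠ 0 := by
    rintro rfl
    rw [map_zero] at hd
    exact hgz (sub_eq_zero.mp (eq_zero_of_pow_eq_zero hd.symm)).symm
  exact ⟨Units.mk0 d hd0, z - g₀ z, hd.symm, h1, h3⟩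

open Classical in
/-- The quadratic character of the absolute Galois group attached to `d`. -/
noncomputable def kummerChar (d : kˣ) : AbsGal k →* Multiplicative (ZMod 2) where
  toFun g := if g (sqrt (d : k)) = sqrt (d : k) then 1 else Multiplicative.ofAdd 1
  map_one' := by simp
  map_mul' g h := by
    have hne := neg_ne_self_of_ne_zero (sqrt_ne_zero d)
    have e : (Multiplicative.ofAdd 1 * Multiplicative.ofAdd 1 : Multiplicative (ZMod 2)) = 1 := by
      decide
    rcases apply_eq_or_eq_neg (sqrt_sq (d : k)) g with hg | hg <;>
      rcases apply_eq_or_eq_neg (sqrt_sq (d : k)) h with hh | hh <;>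
      simp [AlgEquiv.mul_apply, hg, hh, hne, e]

theorem kummerChar_eq_one_iff {d : kˣ} {y : AlgebraicClosure k}
    (hy : y ^ 2 = algebraMap k (AlgebraicClosure k) d) (g : AbsGal k) :
    kummerChar d g = 1 ↔ g y = y := by
  have h1 : kummerChar d g = 1 ↔ g (sqrt (d : k)) = sqrt (d : k) := by
    classical
    by_cases h : g (sqrt (d : k)) = sqrt (d : k) <;> simp [kummerChar, h]
  rw [h1]
  rcases sq_eq_sq_iff_eq_or_eq_neg.mp (hy.trans (sqrt_sq (d : k)).symm) with rfl | rfl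
  · rfl
  · simp

theorem multiplicative_zmod_two_eq {a b : Multiplicative (ZMod 2)} (h : a = 1 ↔ b = 1) : a = b := by
  revert a b; decide

theorem kummerChar_mul (d e : kˣ) : kummerChar (d * e) = kummerChar d * kummerChar e := by
  ext g : 1
  have hd := sqrt_sq (d : k)
  have he := sqrt_sq (e : k)
  have h1 := kummerChar_eq_one_iff (d := d * e) (y := sqrt (d : k) * sqrt (e : k))
    (by rw [mul_pow, hd, he, Units.val_mul, map_mul]) g
  have h2 := kummerChar_eq_one_iff hd g
  have h3 := kummerChar_eq_one_iff he g
  have h4 := neg_ne_self_of_ne_zero (sqrt_ne_zero d)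
  have h5 := neg_ne_self_of_ne_zero (sqrt_ne_zero e)
  have h6 := neg_ne_self_of_ne_zero (mul_ne_zero (sqrt_ne_zero d) (sqrt_ne_zero e))
  rw [MonoidHom.mul_apply]
  refine multiplicative_zmod_two_eq (h1.trans ?_)
  have key : ∀ a b : Multiplicative (ZMod 2), a * b = 1 ↔ (a = 1 ↔ b = 1) := by decide
  rw [key, h2, h3, map_mul]
  rcases apply_eq_or_eq_neg hd g with hg | hg <;>
    rcases apply_eq_or_eq_neg he g with hh | hh <;> simp [hg, hh, h4, h5, h6]

theorem kummerChar_eq_one {d : kˣ} : kummerChar d = 1 ↔ IsSquare (d : k) := by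
  constructor
  · intro h
    exact isSquare_of_forall_apply_eq (sqrt_sq (d : k)) fun g =>
      (kummerChar_eq_one_iff (sqrt_sq (d : k)) g).mp (by rw [h]; rfl)
  · rintro ⟨c, hc⟩
    ext g : 1
    exact (kummerChar_eq_one_iff (y := algebraMap k (AlgebraicClosure k) c)
      (by rw [hc, map_mul, sq]) g).mpr (AlgEquiv.commutes g c)

theorem isOpen_ker_kummerChar (d : kˣ) : IsOpen ((kummerChar d).ker : Set (AbsGal k)) :=
  isOpen_ker_of_iff (kummerChar_eq_one_iff (sqrt_sq (d : k)))

theorem exists_kummerChar_eq (φ : AbsGal k →* Multiplicative (ZMod 2))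
    (hφ : IsOpen (φ.ker : Set (AbsGal k))) : ∃ d : kˣ, kummerChar d = φ := by
  by_cases h : ∃ g₀, φ g₀ ≠ 1
  · obtain ⟨g₀, hg₀⟩ := h
    have key : ∀ a b : Multiplicative (ZMod 2), b ≠ 1 → a = 1 ∨ a = b := by decide
    obtain ⟨d, y, hy, h1, h2⟩ := exists_sq_eq_of_ker φ hφ hg₀ fun g => key _ _ hg₀
    refine ⟨d, MonoidHom.ext fun g => multiplicative_zmod_two_eq ?_⟩
    rw [kummerChar_eq_one_iff hy]
    refine ⟨fun h => ?_, h1 g⟩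
    by_contra hg
    exact neg_ne_self_of_ne_zero (ne_zero_of_sq_eq hy) ((h2 g hg).symm.trans h)
  · push Not at h
    exact ⟨1, by rw [kummerChar_eq_one.mpr (by simp)]; ext g : 1; exact (h g).symm⟩

end Kummer

/-! ### Cyclic algebras of quadratic characters are quaternion algebras. -/

section Cyclic

open IntermediateField

theorem addCircle_eq_half_of_two_nsmul {x : AddCircle (1 : ℚ)} (h : 2 • x = 0) :
    x = 0 ∨ x = ((1 / 2 : ℚ) : AddCircle (1 : ℚ)) := by
  obtain ⟨q, rfl⟩ := QuotientAddGroup.mk_surjective x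
  change 2 • (q : AddCircle (1 : ℚ)) = 0 at h
  rw [← AddCircle.coe_nsmul, AddCircle.coe_eq_zero_iff] at h
  obtain ⟨m, hm⟩ := h
  simp only [zsmul_eq_mul, mul_one, nsmul_eq_mul, Nat.cast_ofNat] at hm
  obtain ⟨r, rfl | rfl⟩ := m.even_or_odd'
  · refine .inl ((AddCircle.coe_eq_zero_iff 1).mpr ⟨r, ?_⟩)
    push_cast at hm
    simp only [zsmul_eq_mul, mul_one]
    linarith
  · refine .inr ?_
    change (q : AddCircle (1 : ℚ)) = _
    rw [← sub_eq_zero, ← AddCircle.coe_sub, AddCircle.coe_eq_zero_iff]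
    refine ⟨r, ?_⟩
    push_cast at hm
    simp only [zsmul_eq_mul, mul_one]
    linarith

theorem addCircle_half_ne_zero : ((1 / 2 : ℚ) : AddCircle (1 : ℚ)) ≠ 0 := by
  intro h
  obtain ⟨m, hm⟩ := (AddCircle.coe_eq_zero_iff 1).mp h
  simp only [zsmul_eq_mul, mul_one] at hm
  have : (2 * m : ℚ) = 1 := by linarith
  have : 2 * m = 1 := by exact_mod_cast this
  omega

theorem le_two_of_two_nsmul {n : ℕ} (h : 2 • ((1 / n : ℚ) : AddCircle (1 : ℚ)) = 0) : n ≤ 2 := by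
  rw [← AddCircle.coe_nsmul, AddCircle.coe_eq_zero_iff] at h
  obtain ⟨m, hm⟩ := h
  simp only [zsmul_eq_mul, mul_one, nsmul_eq_mul, Nat.cast_ofNat] at hm
  rcases Nat.eq_zero_or_pos n with rfl | hn
  · omega
  have hn' : (n : ℚ) ≠ 0 := by exact_mod_cast hn.ne'
  have h1 : (m * n : ℚ) = 2 := by rw [hm]; field_simp
  have h2 : m * n = 2 := by exact_mod_cast h1
  exact Nat.le_of_dvd two_pos (by exact_mod_cast (Dvd.intro_left m h2 : (n : ℤ) ∣ 2))

theorem exists_powerBasis_of_not_isSquare {k : Type u} [Field k] {d : k} (hd : ¬ IsSquare d) {y : AlgebraicClosure k}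
    (hy : y ^ 2 = algebraMap k (AlgebraicClosure k) d)
    {L : IntermediateField k (AlgebraicClosure k)} (hL : L = k⟮y⟯) :
    ∃ pb : PowerBasis k L, (pb.gen : AlgebraicClosure k) = y ∧
      minpoly k pb.gen = Polynomial.X ^ 2 - Polynomial.C d ∧ Module.finrank k L = 2 := by
  subst hL
  have hyInt : IsIntegral k y := Algebra.IsIntegral.isIntegral y
  have hirr : Irreducible (Polynomial.X ^ 2 - Polynomial.C d) :=
    X_pow_sub_C_irreducible_of_prime Nat.prime_two fun b hb => hd ⟨b, by rw [← hb, sq]⟩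
  have hmin : minpoly k y = Polynomial.X ^ 2 - Polynomial.C d :=
    (minpoly.eq_of_irreducible_of_monic hirr (by simp [hy])
      (Polynomial.monic_X_pow_sub_C d two_ne_zero)).symm
  refine ⟨adjoin.powerBasis hyInt, AdjoinSimple.coe_gen k y, ?_, ?_⟩
  · rw [adjoin.powerBasis_gen, minpoly_gen, hmin]
  · rw [adjoin.finrank hyInt, hmin, Polynomial.natDegree_X_pow_sub_C]

theorem mul_aeval_eq {k A : Type*} [Field k] [Ring A] [Algebra k A] {i j : A} (hij : i * j = -(j * i))
    (f : Polynomial k) : j * Polynomial.aeval i f = Polynomial.aeval (-i) f * j := by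
  have h : SemiconjBy j i (-i) := by
    rw [SemiconjBy, neg_mul, hij, neg_neg]
  induction f using Polynomial.induction_on' with
  | add p q hp hq => rw [map_add, map_add, mul_add, add_mul, hp, hq]
  | monomial n c =>
    rw [Polynomial.aeval_monomial, Polynomial.aeval_monomial, ← mul_assoc, ← Algebra.commutes,
      mul_assoc, (h.pow_right n).eq, mul_assoc]

variable {k K : Type u} [Field k] [CharZero k] [Field K] [CharZero K] [Algebra k K]

/-- A cyclic algebra given by a character of order two is a quaternion algebra. -/
theorem exists_symbol_eq_of_isCyclicAlgebra {χ : Characters k} (hχ : χ ^ 2 = 1) (π : Kˣ)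
    {A : AzumayaAlg K} (hA : IsCyclicAlgebra (A := A.carrier) χ (π : K)) :
    ∃ d : kˣ, Br.mk A = symbol (Units.map (algebraMap k K).toMonoidHom d) π := by
  obtain ⟨g, φ, v, hg, hrank, hφ, hv, hcomm⟩ := hA
  have hχ2 : ∀ h : AbsGal k, 2 • (Multiplicative.toAdd (χ.1 h)) = 0 := by
    intro h
    have := congrArg (fun ψ : Characters k => Multiplicative.toAdd (ψ.1 h)) hχ
    simpa using this
  have hg2 := hχ2 g
  rw [hg, toAdd_ofAdd] at hg2
  have hn := le_two_of_two_nsmul hg2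
  have : Nontrivial A.carrier := (IsAzumaya.isSimpleRing (F := K) A.carrier).instNontrivial
  have hpos : 0 < Module.finrank K A.carrier := Module.finrank_pos
  generalize hN : Module.finrank k (charField χ) = n at *
  interval_cases n
  -- The value 0 of `finrank` stands for an infinite extension; it would give `A` dimension 0.
  · simp [hrank] at hpos
  · refine ⟨1, ?_⟩
    rw [map_one, symbol_one_left]
    have : IsAzumaya K K := (AzumayaAlg.one K).isAzumaya
    have h1 : Function.Bijective (Algebra.ofId K A.carrier) :=
      IsAzumaya.bijective_of_finrank_eq (Algebra.ofId K A.carrier)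
        (by rw [hrank]; exact Module.finrank_self K)
    exact (Br.mk_eq_of_algEquiv (A := AzumayaAlg.one K) (B := A) (AlgEquiv.ofBijective _ h1)).symm
  · have hg1 : χ.1 g ≠ 1 := by
      rw [hg]
      intro h
      exact addCircle_half_ne_zero (by simpa using congrArg Multiplicative.toAdd h)
    -- The kernel of `χ` has index two, so it is the stabilizer of a square root `y`. As `g` negates
    -- `y`, the elements `φ y'` and `v` anticommute and generate a quaternion algebra.
    obtain ⟨d, y, hy, hy1, hy2⟩ := exists_sq_eq_of_ker χ.1 χ.2 hg1 fun h => by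
      rcases addCircle_eq_half_of_two_nsmul (hχ2 h) with h1 | h1
      · exact .inl h1
      · refine .inr ?_
        rw [hg]
        exact congrArg Multiplicative.ofAdd (h1.trans (by norm_num))
    let y' : charField χ := ⟨y, (mem_fixedField_iff _ _).mpr fun h hh => hy1 h hh⟩
    have hyy : y' * y' = algebraMap k (charField χ) d := Subtype.ext (by
      rw [← sq]; exact hy)
    refine ⟨d, (symbol_eq_mk (hrank.trans (by norm_num)) (φ y') v ?_ ?_ ?_).symm⟩
    · rw [← map_mul, hyy, hφ]; rfl
    · rw [← sq, hv]
    · have := hcomm y' (-y') (by rw [hy2 g hg1]; rfl)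
      rw [this, map_neg, neg_mul, neg_neg]

/-- The homomorphism `ℤ/2 → ℚ/ℤ`. -/
noncomputable def zmodTwoToCircle : ZMod 2 →+ AddCircle (1 : ℚ) :=
  ZMod.lift 2 ⟨zmultiplesHom _ ((1 / 2 : ℚ) : AddCircle (1 : ℚ)), by
    change (2 : ℤ) • ((1 / 2 : ℚ) : AddCircle (1 : ℚ)) = 0
    rw [← AddCircle.coe_zsmul, AddCircle.coe_eq_zero_iff]
    exact ⟨1, by norm_num⟩⟩

theorem zmodTwoToCircle_one : zmodTwoToCircle 1 = ((1 / 2 : ℚ) : AddCircle (1 : ℚ)) := by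
  have := ZMod.lift_coe 2 (A := AddCircle (1 : ℚ)) ⟨zmultiplesHom _ ((1 / 2 : ℚ) : AddCircle (1 : ℚ)), by
    change (2 : ℤ) • ((1 / 2 : ℚ) : AddCircle (1 : ℚ)) = 0
    rw [← AddCircle.coe_zsmul, AddCircle.coe_eq_zero_iff]
    exact ⟨1, by norm_num⟩⟩ 1
  simpa [zmodTwoToCircle] using this

theorem zmodTwoToCircle_injective : Function.Injective zmodTwoToCircle := by
  rw [injective_iff_map_eq_zero]
  intro a ha
  have key : ∀ a : ZMod 2, a = 0 ∨ a = 1 := by decide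
  rcases key a with rfl | rfl
  · rfl
  · rw [zmodTwoToCircle_one] at ha
    exact absurd ha addCircle_half_ne_zero

/-- The quadratic character attached to `d` with values in `ℚ/ℤ`. -/
noncomputable def quadraticCharacter (d : kˣ) : Characters k :=
  ⟨(AddMonoidHom.toMultiplicative zmodTwoToCircle).comp (kummerChar d), by
    have : ((AddMonoidHom.toMultiplicative zmodTwoToCircle).comp (kummerChar d)).ker =
        (kummerChar d).ker := by
      rw [← MonoidHom.comap_ker, (MonoidHom.ker_eq_bot_iff _).mpr]
      · rfl
      · exact zmodTwoToCircle_injective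
    have h := isOpen_ker_kummerChar d
    rw [← this] at h
    exact h⟩

theorem quadraticCharacter_apply (d : kˣ) (g : AbsGal k) : (quadraticCharacter d).1 g =
    Multiplicative.ofAdd (zmodTwoToCircle (Multiplicative.toAdd (kummerChar d g))) := rfl

theorem quadraticCharacter_sq (d : kˣ) : quadraticCharacter d ^ 2 = 1 := by
  apply Subtype.ext
  ext g : 1
  have key : ∀ a : Multiplicative (ZMod 2), a ^ 2 = 1 := by decide
  change ((AddMonoidHom.toMultiplicative zmodTwoToCircle) (kummerChar d g)) ^ 2 = 1
  rw [← map_pow, key, map_one]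

theorem charField_quadraticCharacter (d : kˣ) :
    charField (quadraticCharacter d) = k⟮sqrt (d : k)⟯ := by
  have : (quadraticCharacter d).1.ker = k⟮sqrt (d : k)⟯.fixingSubgroup := by
    refine ker_eq_fixingSubgroup fun g => ?_
    rw [← kummerChar_eq_one_iff (sqrt_sq (d : k))]
    change (AddMonoidHom.toMultiplicative zmodTwoToCircle) (kummerChar d g) = 1 ↔ _
    exact map_eq_zero_iff zmodTwoToCircle zmodTwoToCircle_injective
  rw [charField, this]
  exact InfiniteGalois.fixedField_fixingSubgroup _

/-- Every quaternion algebra `(d, π)` with constant `d` is cyclic. -/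
theorem exists_isCyclicAlgebra (d : kˣ) (π : Kˣ) :
    ∃ A : AzumayaAlg K, IsCyclicAlgebra (A := A.carrier) (quadraticCharacter d) (π : K) ∧
      Br.mk A = symbol (Units.map (algebraMap k K).toMonoidHom d) π := by
  have hL := charField_quadraticCharacter d
  by_cases hd : IsSquare (d : k)
  · obtain ⟨c, hc⟩ := hd
    have hbot : charField (quadraticCharacter d) = ⊥ := by
      rw [hL, adjoin_simple_eq_bot_iff]
      have h1 : sqrt (d : k) ^ 2 = algebraMap k (AlgebraicClosure k) c ^ 2 := by
        rw [sqrt_sq, hc, ← map_pow, sq]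
      rcases sq_eq_sq_iff_eq_or_eq_neg.mp h1 with h | h
      · exact h ▸ IntermediateField.algebraMap_mem _ c
      · exact h ▸ neg_mem (IntermediateField.algebraMap_mem _ c)
    have hrank : Module.finrank k (charField (quadraticCharacter d)) = 1 := by
      rw [hbot, IntermediateField.finrank_bot]
    -- For a square `d` the character is trivial and the extension has degree one, so `K` itself is
    -- the cyclic algebra, with `v = π`.
    refine ⟨AzumayaAlg.one K, ?_, ?_⟩
    · let φ : charField (quadraticCharacter d) →ₐ[k] k :=
        (botEquiv k (AlgebraicClosure k)).toAlgHom.comp (equivOfEq hbot).toAlgHom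
      have hcyc : IsCyclicAlgebra (A := K) (quadraticCharacter d) (π : K) := by
        refine ⟨1, (algebraMap k K).comp φ.toRingHom, π, ?_, ?_, fun c => ?_, ?_, fun x y hxy => ?_⟩
        · rw [hrank, map_one]
          refine (ofAdd_eq_one.mpr ?_).symm
          simp
        · rw [hrank, Module.finrank_self, one_pow]
        · exact congrArg (algebraMap k K) (φ.commutes c)
        · rw [hrank, pow_one]; rfl
        · rw [show y = x from Subtype.ext hxy, mul_comm]
      exact hcyc
    · have hc0 : c ≠ 0 := by rintro rfl; simp at hc
      have : d = Units.mk0 c hc0 ^ 2 := Units.ext (by rw [hc, sq]; rfl)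
      rw [this, map_pow, symbol_sq_left]
      rfl
  · have haz := isAzumaya_quaternion isUnit_two_field (Units.map (algebraMap k K).toMonoidHom d) π
    refine ⟨⟨QuaternionAlgebra K (Units.map (algebraMap k K).toMonoidHom d : Kˣ) 0 (π : K)⟩, ?_, rfl⟩
    obtain ⟨pb, hgen, hmin, hrank⟩ := exists_powerBasis_of_not_isSquare hd (sqrt_sq (d : k)) hL
    obtain ⟨g, hg⟩ : ∃ g : AbsGal k, g (sqrt (d : k)) ≠ sqrt (d : k) := by
      by_contra hcon
      push Not at hcon
      exact hd (isSquare_of_forall_apply_eq (sqrt_sq (d : k)) hcon)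
    have hgs : g (sqrt (d : k)) = -sqrt (d : k) :=
      (apply_eq_or_eq_neg (sqrt_sq (d : k)) g).resolve_left hg
    let H := QuaternionAlgebra K (Units.map (algebraMap k K).toMonoidHom d : Kˣ) 0 (π : K)
    let i : H := ⟨0, 1, 0, 0⟩
    let j : H := ⟨0, 0, 1, 0⟩
    have hi : i * i = algebraMap k H d := by
      rw [IsScalarTower.algebraMap_apply k K H]
      exact quaternion_i_mul_i _ _
    have hj : j * j = algebraMap K H π := quaternion_j_mul_j _ _
    have hij : i * j = -(j * i) := quaternion_i_mul_j _ _
    -- The square root of `d` is sent to `i`. Conjugation by `j` negates `i`, just as `g` negates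
    -- the square root.
    let φ : charField (quadraticCharacter d) →ₐ[k] H := pb.lift i (by
      rw [hmin, map_sub, Polynomial.aeval_X_pow, Polynomial.aeval_C, sq, hi, sub_self])
    have hφ : ∀ f : Polynomial k, φ (Polynomial.aeval pb.gen f) = Polynomial.aeval i f := fun f => by
      rw [← Polynomial.aeval_algHom_apply, PowerBasis.lift_gen]
    have hcyc : IsCyclicAlgebra (A := H) (quadraticCharacter d) (π : K) := by
      refine ⟨g, φ.toRingHom, j, ?_, ?_, fun c => ?_, ?_, fun x y hxy => ?_⟩
      · have h1 : kummerChar d g = Multiplicative.ofAdd 1 := by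
          have key : ∀ a : Multiplicative (ZMod 2), a ≠ 1 → a = Multiplicative.ofAdd 1 := by decide
          exact key _ fun h => hg ((kummerChar_eq_one_iff (sqrt_sq (d : k)) g).mp h)
        rw [hrank, quadraticCharacter_apply, h1, toAdd_ofAdd, zmodTwoToCircle_one]
        norm_num
      · rw [hrank, QuaternionAlgebra.finrank_eq_four]; norm_num
      · exact (φ.commutes c).trans (IsScalarTower.algebraMap_apply k K H c)
      · rw [hrank, sq, hj]
      · obtain ⟨f, rfl⟩ := pb.exists_eq_aeval' x
        have h1 : y = Polynomial.aeval pb.gen (f.comp (-Polynomial.X)) := by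
          apply Subtype.ext
          have e1 : ∀ p : Polynomial k, ((Polynomial.aeval pb.gen p : charField (quadraticCharacter d)) :
              AlgebraicClosure k) = Polynomial.aeval (sqrt (d : k)) p := fun p => by
            rw [← hgen]
            exact (Polynomial.aeval_algHom_apply (charField (quadraticCharacter d)).val pb.gen p).symm
          rw [hxy, e1, e1, Polynomial.aeval_comp, map_neg, Polynomial.aeval_X, ← hgs]
          exact (Polynomial.aeval_algHom_apply g.toAlgHom _ f).symm
        have h2 : φ y = Polynomial.aeval (-i) f := by
          rw [h1, hφ, Polynomial.aeval_comp, map_neg, Polynomial.aeval_X]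
        change j * φ _ = φ y * j
        rw [hφ, h2]
        exact mul_aeval_eq hij f
    exact hcyc

end Cyclic

/-! ### The Campana Brauer group and its residues. -/

section Campana

variable {k : Type u} [Field k]

variable (k) in
/-- The uniformizers `t`, `t + 1` and `t⁻¹` at the three points. -/
noncomputable def uniformizer : Fin 3 → (RatFunc k)ˣ :=
  ![Units.mk0 RatFunc.X isRationalPlace_zero.ne_zero,
    Units.mk0 (RatFunc.X + 1) isRationalPlace_one.ne_zero,
    Units.mk0 RatFunc.X⁻¹ isRationalPlace_two.ne_zero]

theorem isRationalPlace (i : Fin 3) :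
    IsRationalPlace (localRing k i) (uniformizer k i : RatFunc k) := by
  fin_cases i
  · exact isRationalPlace_zero
  · exact isRationalPlace_one
  · exact isRationalPlace_two

/-- The image of a constant in the function field. -/
noncomputable def const : kˣ →* (RatFunc k)ˣ := Units.map (algebraMap k (RatFunc k)).toMonoidHom

variable (k) in
/-- The classes that are unramified at the point `Pᵢ`. -/
noncomputable def unramified (i : Fin 3) : AddSubgroup (Br (RatFunc k)) :=
  (Br.baseChange (localRing k i) (RatFunc k)).range

/-- An invertible constant on `Z°`. -/
noncomputable def openConst : kˣ →* (openRing k)ˣ := Units.map (algebraMap k (openRing k)).toMonoidHom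

/-- The coordinates as units of the function field. -/
noncomputable def coordUnit (i : Fin 3) : (RatFunc k)ˣ := Units.mk0 (coord k i) (coord_ne_zero k i)

theorem coordUnit_two : (coordUnit 2 : (RatFunc k)ˣ) = 1 := Units.ext (by simp [coordUnit, coord])

theorem coordUnit_zero : (coordUnit 0 : (RatFunc k)ˣ) = uniformizer k 0 := Units.ext rfl

theorem coordUnit_one : (coordUnit 1 : (RatFunc k)ˣ) = uniformizer k 1 * (-1) := Units.ext (by
  simp [coordUnit, coord, uniformizer])

theorem baseChange_mem_unramified {β : Br (openRing k)} (hβ : β ∈ constantClasses k) (i : Fin 3) :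
    Br.baseChange (openRing k) (RatFunc k) β ∈ unramified k i := by
  obtain ⟨γ, rfl⟩ := hβ
  rw [Br.baseChange_baseChange]
  exact ⟨Br.baseChange k (localRing k i) γ, Br.baseChange_baseChange k (localRing k i) (RatFunc k) γ⟩

variable [CharZero k]

theorem symbol_mem_unramified {i : Fin 3} {u v : (RatFunc k)ˣ} (hu : (u : RatFunc k) ∈ localRing k i)
    (hu' : (u : RatFunc k)⁻¹ ∈ localRing k i) (hv : (v : RatFunc k) ∈ localRing k i)
    (hv' : (v : RatFunc k)⁻¹ ∈ localRing k i) : symbol u v ∈ unramified k i := by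
  let u' : (localRing k i)ˣ := ⟨⟨u, hu⟩, ⟨_, hu'⟩, Subtype.ext (mul_inv_cancel₀ u.ne_zero),
    Subtype.ext (inv_mul_cancel₀ u.ne_zero)⟩
  let v' : (localRing k i)ˣ := ⟨⟨v, hv⟩, ⟨_, hv'⟩, Subtype.ext (mul_inv_cancel₀ v.ne_zero),
    Subtype.ext (inv_mul_cancel₀ v.ne_zero)⟩
  have h2 : IsUnit (2 : localRing k i) := by simpa using isUnit_natCast k (localRing k i) 2 two_ne_zero
  refine ⟨quaternionClass h2 u' v', ?_⟩
  rw [baseChange_quaternionClass]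
  congr 1 <;> exact Units.ext rfl

theorem symbol_const_mem_unramified {i : Fin 3} (d : kˣ) {v : (RatFunc k)ˣ}
    (hv : (v : RatFunc k) ∈ localRing k i) (hv' : (v : RatFunc k)⁻¹ ∈ localRing k i) :
    symbol (const d) v ∈ unramified k i := by
  refine symbol_mem_unramified ((localRing k i).algebraMap_mem d) ?_ hv hv'
  change (algebraMap k (RatFunc k) d)⁻¹ ∈ _
  rw [← map_inv₀]
  exact (localRing k i).algebraMap_mem _

theorem isSquare_of_symbol_mem_unramified {i : Fin 3} {d : kˣ}
    (h : symbol (const d) (uniformizer k i) ∈ unramified k i) : IsSquare (d : k) := by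
  by_contra hd
  refine (isRationalPlace i).quaternionClass_notMem d hd ?_
  have : Units.mk0 (uniformizer k i : RatFunc k) (isRationalPlace i).ne_zero = uniformizer k i :=
    Units.ext rfl
  rw [this]
  exact h

/-- Two uniformizers differ by a unit w of the local ring, and the symbol (d, w) comes from its
Brauer group. -/
theorem symbol_irreducible_sub_mem {i : Fin 3} (d : kˣ) {π : localRing k i} (hπ : Irreducible π)
    (hπ0 : (π : RatFunc k) ≠ 0) :
    symbol (const d) (Units.mk0 (π : RatFunc k) hπ0) - symbol (const d) (uniformizer k i) ∈
      unramified k i := by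
  have := (isRationalPlace (k := k) i).isDiscreteValuationRing
  obtain ⟨w, hw⟩ := IsDiscreteValuationRing.associated_of_irreducible _
    (isRationalPlace (k := k) i).irreducible hπ
  let w' : (RatFunc k)ˣ := Units.map (localRing k i).val.toMonoidHom w
  have h1 : Units.mk0 (π : RatFunc k) hπ0 = uniformizer k i * w' :=
    Units.ext (congrArg Subtype.val hw).symm
  rw [h1, symbol_mul_right, add_sub_cancel_left]
  refine symbol_const_mem_unramified d w.1.2 ?_
  have h2 : ((w' : RatFunc k))⁻¹ = ((w⁻¹ : (localRing k i)ˣ) : localRing k i) := by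
    rw [← Units.val_inv_eq_inv_val, ← map_inv]
    rfl
  change (w' : RatFunc k)⁻¹ ∈ _
  rw [h2]
  exact Subtype.property _

/-- The cyclic algebras of characters killed by 2 are the symbols with constant first entry, and the
choice of uniformizer only changes them by unramified classes. In this form the condition is visibly
stable under addition. -/
theorem exists_hasResidue_iff (i : Fin 3) (β : Br (RatFunc k)) :
    (∃ χ : Characters k, HasResidue (localRing k i) β χ ∧ χ ^ 2 = 1) ↔
      ∃ d : kˣ, β - symbol (const d) (uniformizer k i) ∈ unramified k i := by
  constructor
  · rintro ⟨χ, ⟨π, A, hπ, hA, hβ⟩, hχ⟩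
    have hπ0 : (π : RatFunc k) ≠ 0 := by simpa using hπ.ne_zero
    obtain ⟨d, hd⟩ := exists_symbol_eq_of_isCyclicAlgebra hχ (Units.mk0 (π : RatFunc k) hπ0) hA
    refine ⟨d, ?_⟩
    have h1 := (unramified k i).add_mem hβ (symbol_irreducible_sub_mem d hπ hπ0)
    rw [hd] at h1
    have h2 : symbol (Units.map (algebraMap k (RatFunc k)).toMonoidHom d)
      (Units.mk0 (π : RatFunc k) hπ0) = symbol (const d) (Units.mk0 (π : RatFunc k) hπ0) := rfl
    rw [h2, sub_add_sub_cancel] at h1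
    exact h1
  · rintro ⟨d, hd⟩
    obtain ⟨A, hA, hAd⟩ := exists_isCyclicAlgebra d (uniformizer k i)
    refine ⟨quadraticCharacter d, ⟨⟨_, (isRationalPlace i).mem⟩, A, (isRationalPlace i).irreducible,
      hA, ?_⟩, quadraticCharacter_sq d⟩
    rw [hAd]
    exact hd

variable (k) in
/-- The Campana Brauer group with all multiplicities equal to two, as a subgroup. -/
noncomputable def campanaSubgroup : AddSubgroup (Br (openRing k)) where
  carrier := {β | ∀ i, ∃ d : kˣ, Br.baseChange (openRing k) (RatFunc k) β -
    symbol (const d) (uniformizer k i) ∈ unramified k i}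
  zero_mem' i := ⟨1, by
    rw [map_zero, map_one, symbol_one_left, sub_zero]; exact zero_mem _⟩
  add_mem' {β γ} hβ hγ i := by
    obtain ⟨d, hd⟩ := hβ i
    obtain ⟨e, he⟩ := hγ i
    refine ⟨d * e, ?_⟩
    rw [map_add, map_mul, symbol_mul_left, add_sub_add_comm]
    exact add_mem hd he
  neg_mem' {β} hβ i := by
    obtain ⟨d, hd⟩ := hβ i
    refine ⟨d, ?_⟩
    have := neg_mem hd
    rwa [neg_sub, ← neg_symbol, sub_eq_add_neg, add_comm, ← map_neg, ← sub_eq_add_neg] at this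

theorem coe_campanaSubgroup :
    (campanaSubgroup k : Set (Br (openRing k))) = campanaBrauer k (fun _ => 2) := by
  ext β
  exact forall_congr' fun i => (exists_hasResidue_iff i _).symm

theorem constantClasses_le : constantClasses k ≤ campanaSubgroup k := fun β hβ i => ⟨1, by
  rw [map_one, symbol_one_left, sub_zero]
  exact baseChange_mem_unramified hβ i⟩

theorem isUnit_two_openRing : IsUnit (2 : openRing k) := by
  simpa using isUnit_natCast k (openRing k) 2 two_ne_zero

theorem baseChange_symbol (d : kˣ) (i j : Fin 3) : Br.baseChange (openRing k) (RatFunc k)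
    (quaternionClass isUnit_two_openRing (openConst d) (ratio k i j)) =
      symbol (const d) (coordUnit i) + symbol (const d) (coordUnit j) := by
  rw [baseChange_quaternionClass, ← symbol_inv_right (const d) (coordUnit j), ← symbol_mul_right]
  have h : Units.map (algebraMap (openRing k) (RatFunc k)).toMonoidHom (ratio k i j) =
      coordUnit i * (coordUnit j)⁻¹ := by
    refine Units.ext ?_
    rw [Units.val_mul, Units.val_inv_eq_inv_val]
    exact div_eq_mul_inv (coord k i) (coord k j)
  rw [h]
  rfl

/-- The class `(x, z₁ / z₂) + (y, z₀ / z₂)`. -/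
noncomputable def pairClass (x y : kˣ) : Br (openRing k) :=
  quaternionClass isUnit_two_openRing (openConst x) (ratio k 1 2) +
    quaternionClass isUnit_two_openRing (openConst y) (ratio k 0 2)

theorem baseChange_pairClass (x y : kˣ) : Br.baseChange (openRing k) (RatFunc k) (pairClass x y) =
    symbol (const x) (coordUnit 1) + symbol (const y) (coordUnit 0) := by
  rw [pairClass, map_add, baseChange_symbol, baseChange_symbol, coordUnit_two, symbol_one_right,
    symbol_one_right, add_zero, add_zero]

theorem pairClass_mul (x y x' y' : kˣ) :
    pairClass (x * x') (y * y') = pairClass x y + pairClass x' y' := by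
  apply openRing_baseChange_injective
  rw [map_add, baseChange_pairClass, baseChange_pairClass, baseChange_pairClass, map_mul, map_mul,
    symbol_mul_left, symbol_mul_left, add_add_add_comm]

theorem symbol_mem_unramified_zero (x : kˣ) {v : (RatFunc k)ˣ} (p q : Polynomial k)
    (hp : p.eval 0 ≠ 0) (hq : q.eval 0 ≠ 0)
    (h : (v : RatFunc k) * algebraMap _ (RatFunc k) q = algebraMap _ (RatFunc k) p) :
    symbol (const x) v ∈ unramified k 0 :=
  symbol_const_mem_unramified x (mem_localRing_zero.mpr ⟨p, q, hq, h⟩)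
    (mem_localRing_zero.mpr ⟨q, p, hp, by rw [← h, inv_mul_cancel_left₀ v.ne_zero]⟩)

theorem symbol_mem_unramified_one (x : kˣ) {v : (RatFunc k)ˣ} (p q : Polynomial k)
    (hp : p.eval (-1) ≠ 0) (hq : q.eval (-1) ≠ 0)
    (h : (v : RatFunc k) * algebraMap _ (RatFunc k) q = algebraMap _ (RatFunc k) p) :
    symbol (const x) v ∈ unramified k 1 :=
  symbol_const_mem_unramified x (mem_localRing_one.mpr ⟨p, q, hq, h⟩)
    (mem_localRing_one.mpr ⟨q, p, hp, by rw [← h, inv_mul_cancel_left₀ v.ne_zero]⟩)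

theorem symbol_mem_unramified_two (x : kˣ) {v : (RatFunc k)ˣ} (p q : Polynomial k)
    (hp : p ≠ 0) (hq : q ≠ 0) (hpq : p.natDegree = q.natDegree)
    (h : (v : RatFunc k) * algebraMap _ (RatFunc k) q = algebraMap _ (RatFunc k) p) :
    symbol (const x) v ∈ unramified k 2 :=
  symbol_const_mem_unramified x (mem_localRing_two.mpr ⟨p, q, hq, hpq.le, h⟩)
    (mem_localRing_two.mpr ⟨q, p, hp, hpq.ge, by rw [← h, inv_mul_cancel_left₀ v.ne_zero]⟩)

/-- The function z₁/z₂ is a unit at P₀, so only (y, t) contributes. -/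
theorem pairClass_sub_zero (x y : kˣ) :
    Br.baseChange (openRing k) (RatFunc k) (pairClass x y) -
      symbol (const y) (uniformizer k 0) ∈ unramified k 0 := by
  rw [baseChange_pairClass, coordUnit_zero, add_sub_cancel_right]
  exact symbol_mem_unramified_zero x (-(Polynomial.X + 1)) 1 (by simp) (by simp)
    (by simp [coordUnit, coord])

/-- Here z₁/z₂ = -(t + 1), and both (x, -1) and (y, t) have unit entries at P₁. -/
theorem pairClass_sub_one (x y : kˣ) :
    Br.baseChange (openRing k) (RatFunc k) (pairClass x y) -
      symbol (const x) (uniformizer k 1) ∈ unramified k 1 := by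
  rw [baseChange_pairClass, coordUnit_one, symbol_mul_right, add_assoc, add_sub_cancel_left]
  exact add_mem (symbol_mem_unramified_one x (-1) 1 (by simp) (by simp) (by simp))
    (symbol_mem_unramified_one y Polynomial.X 1 (by simp) (by simp) (by simp [coordUnit, coord]))

/-- Rewrite (x, -(t + 1)) as (x, t) + (x, -(t + 1)/t). The last entry is a unit at infinity, and
what remains is (xy, t) = (xy, t⁻¹). -/
theorem pairClass_sub_two (x y : kˣ) :
    Br.baseChange (openRing k) (RatFunc k) (pairClass x y) -
      symbol (const (x * y)) (uniformizer k 2) ∈ unramified k 2 := by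
  have h1 : (uniformizer k 2)⁻¹ = coordUnit 0 := Units.ext (by simp [uniformizer, coordUnit, coord])
  have h2 : (coordUnit 1 : (RatFunc k)ˣ) = coordUnit 0 * (coordUnit 1 * (coordUnit 0)⁻¹) := by
    rw [mul_comm, inv_mul_cancel_right]
  rw [baseChange_pairClass, ← symbol_inv_right _ (uniformizer k 2), h1, map_mul, symbol_mul_left, h2,
    symbol_mul_right, add_right_comm, add_sub_cancel_left]
  have h3 := RatFunc.X_ne_zero (K := k)
  refine symbol_mem_unramified_two x (-(Polynomial.X + 1)) Polynomial.X ?_ Polynomial.X_ne_zero ?_ ?_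
  · exact neg_ne_zero.mpr (Polynomial.X_add_C_ne_zero 1)
  · rw [Polynomial.natDegree_neg, Polynomial.natDegree_X]
    exact Polynomial.natDegree_X_add_C 1
  · simp [coordUnit, coord, h3]

theorem pairClass_mem (x y : kˣ) : pairClass x y ∈ campanaSubgroup k := by
  intro i
  fin_cases i
  · exact ⟨y, pairClass_sub_zero x y⟩
  · exact ⟨x, pairClass_sub_one x y⟩
  · exact ⟨x * y, pairClass_sub_two x y⟩

/-- Take for y and x the residues at P₀ and P₁. The difference is unramified there and still
satisfies the Campana condition at P₂, so `mem_constantClasses` applies. -/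
theorem exists_sub_pairClass_mem {β : Br (openRing k)} (hβ : β ∈ campanaSubgroup k) :
    ∃ x y : kˣ, β - pairClass x y ∈ constantClasses k := by
  obtain ⟨y, hy⟩ := hβ 0
  obtain ⟨x, hx⟩ := hβ 1
  obtain ⟨d, hd⟩ := sub_mem hβ (pairClass_mem x y) 2
  refine ⟨x, y, mem_constantClasses ?_ ?_ d hd⟩
  · have := sub_mem hy (pairClass_sub_zero x y)
    rwa [sub_sub_sub_cancel_right, ← map_sub] at this
  · have := sub_mem hx (pairClass_sub_one x y)
    rwa [sub_sub_sub_cancel_right, ← map_sub] at this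

/-- Constant classes are unramified everywhere, so the residues x at P₁ and y at P₀ must be trivial
square classes. Conversely, symbols with a square entry vanish. -/
theorem pairClass_mem_constantClasses {x y : kˣ} :
    pairClass x y ∈ constantClasses k ↔ IsSquare x ∧ IsSquare y := by
  have key : ∀ d : kˣ, IsSquare (d : k) → IsSquare d := by
    rintro d ⟨c, hc⟩
    exact ⟨Units.mk0 c (by rintro rfl; simp at hc), Units.ext hc⟩
  constructor
  · intro h
    constructor
    · refine key x (isSquare_of_symbol_mem_unramified (i := 1) ?_)
      have := sub_mem (baseChange_mem_unramified h 1) (pairClass_sub_one x y)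
      rwa [sub_sub_cancel] at this
    · refine key y (isSquare_of_symbol_mem_unramified (i := 0) ?_)
      have := sub_mem (baseChange_mem_unramified h 0) (pairClass_sub_zero x y)
      rwa [sub_sub_cancel] at this
  · rintro ⟨⟨a, rfl⟩, ⟨b, rfl⟩⟩
    have : pairClass (a * a) (b * b) = 0 := by
      apply openRing_baseChange_injective
      rw [baseChange_pairClass, ← sq, ← sq, map_pow, map_pow, symbol_sq_left, symbol_sq_left,
        add_zero, map_zero]
    rw [this]
    exact zero_mem _

end Campana

/-! ### Squarefree representatives and triples of integers. -/

section Triples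

/-- If ab = c² with a squarefree, then a divides c and b = ae². Squarefreeness of b forces e = ±1,
so even the signs agree. -/
theorem eq_of_isSquare_mul {a b : ℤ} (ha : Squarefree a) (hb : Squarefree b)
    (h : IsSquare ((a : ℚ) * b)) : a = b := by
  have h' : IsSquare (a * b) := by
    rw [← Rat.isSquare_intCast_iff]; push_cast; exact h
  obtain ⟨c, hc⟩ := h'
  have ha0 : a ≠ 0 := ha.ne_zero
  have h1 : a ∣ c := by
    rw [← ha.dvd_pow_iff_dvd two_ne_zero, sq, ← hc]
    exact dvd_mul_right a b
  obtain ⟨e, rfl⟩ := h1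
  have h2 : b = a * (e * e) := mul_left_cancel₀ ha0 (by linear_combination hc)
  have h3 : IsUnit e := hb e ⟨a, by rw [h2, mul_comm]⟩
  rcases Int.isUnit_iff.mp h3 with rfl | rfl <;> simpa using h2.symm

/-- Numerator times denominator has the same square class as `x`; its squarefree part, with the sign
restored, is the representative. -/
theorem exists_squarefree_mul_isSquare (x : ℚˣ) :
    ∃ a : ℤ, Squarefree a ∧ IsSquare ((a : ℚ) * x) := by
  have hn : (x : ℚ).num * (x : ℚ).den ≠ 0 := mul_ne_zero (by simp) (by simp)
  obtain ⟨s, r, h1, h2⟩ := Nat.sq_mul_squarefree ((x : ℚ).num * (x : ℚ).den).natAbs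
  set N : ℤ := (x : ℚ).num * (x : ℚ).den with hN
  have hNs : N = N.sign * (r ^ 2 * s) := by
    conv_lhs => rw [← Int.sign_mul_natAbs N, ← h1]
    push_cast
    ring
  have hsign : N.sign * N.sign = 1 := by
    rcases lt_or_gt_of_ne hn with h | h
    · rw [Int.sign_eq_neg_one_of_neg h]; rfl
    · rw [Int.sign_eq_one_of_pos h]; rfl
  refine ⟨N.sign * s, ?_, ⟨(r : ℚ) * s / (x : ℚ).den, ?_⟩⟩
  · rw [← Int.squarefree_natAbs, Int.natAbs_mul, Int.natAbs_sign_of_ne_zero hn, one_mul,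
      Int.natAbs_natCast]
    exact h2
  · have hden : ((x : ℚ).den : ℚ) ≠ 0 := by simp
    have hx : (x : ℚ) * (x : ℚ).den = (x : ℚ).num := Rat.mul_den_eq_num _
    have h3 : ((x : ℚ).num : ℚ) * (x : ℚ).den = N.sign * (r ^ 2 * s) := by
      exact_mod_cast hNs
    have h4 : (N.sign : ℚ) * N.sign = 1 := by exact_mod_cast hsign
    push_cast
    field_simp
    linear_combination (N.sign * s * (x : ℚ).den) * hx + (N.sign * s : ℚ) * h3 +
      (r ^ 2 * s ^ 2 : ℚ) * h4

/-- The triple attached to a pair of squarefree integers. -/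
theorem exists_triple {a b : ℤ} (ha : Squarefree a) (hb : Squarefree b) :
    ∃ d : Triple, d.1 0 * d.1 2 = a ∧ d.1 1 * d.1 2 = b := by
  have ha0 := ha.ne_zero
  have hb0 := hb.ne_zero
  have hg0 : (Int.gcd a b : ℤ) ≠ 0 := by
    simp [Int.gcd_eq_zero_iff, ha0]
  -- The third entry is ± gcd(a, b), with the sign of ab; this choice makes the product of the three
  -- entries positive.
  obtain ⟨c, hc, hcpos⟩ : ∃ c : ℤ, (c = Int.gcd a b ∨ c = -Int.gcd a b) ∧ 0 < c * (a * b) := by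
    have hgpos : (0 : ℤ) < Int.gcd a b := by positivity
    rcases lt_or_gt_of_ne (mul_ne_zero ha0 hb0) with h | h
    · exact ⟨-Int.gcd a b, .inr rfl, by nlinarith⟩
    · exact ⟨Int.gcd a b, .inl rfl, by positivity⟩
  have hdvd : ∀ z, c ∣ z ↔ (Int.gcd a b : ℤ) ∣ z := fun z => by
    rcases hc with rfl | rfl
    · rfl
    · exact neg_dvd
  obtain ⟨p, hp⟩ := (hdvd a).mpr (Int.gcd_dvd_left a b)
  obtain ⟨q, hq⟩ := (hdvd b).mpr (Int.gcd_dvd_right a b)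
  have hc0 : c ≠ 0 := by rintro rfl; simp at hcpos
  have hpq : IsRelPrime p q := by
    intro e hep heq
    have h1 : c * e ∣ c := by
      rw [← dvd_abs]
      have : (|c| : ℤ) = Int.gcd a b := by rcases hc with rfl | rfl <;> simp
      rw [this]
      exact Int.dvd_coe_gcd (hp ▸ mul_dvd_mul_left c hep) (hq ▸ mul_dvd_mul_left c heq)
    exact isUnit_of_dvd_one ((mul_dvd_mul_iff_left hc0).mp (by simpa using h1))
  rw [hp, squarefree_mul_iff] at ha
  rw [hq, squarefree_mul_iff] at hb
  refine ⟨⟨![p, q, c], ?_, ?_⟩, ?_, ?_⟩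
  · change Squarefree (p * q * c)
    rw [squarefree_mul_iff, squarefree_mul_iff]
    exact ⟨(ha.1.symm.mul_left hb.1.symm), ⟨hpq, ha.2.2, hb.2.2⟩, ha.2.1⟩
  · change 0 < p * q * c
    rw [hp, hq] at hcpos
    have : c * (c * p * (c * q)) = (c * c) * (p * q * c) := by ring
    rw [this] at hcpos
    exact (mul_pos_iff_of_pos_left (mul_self_pos.mpr hc0)).mp hcpos
  · change p * c = a
    rw [hp, mul_comm]
  · change q * c = b
    rw [hq, mul_comm]

theorem Triple.squarefree (d : Triple) :
    Squarefree (d.1 0 * d.1 2) ∧ Squarefree (d.1 1 * d.1 2) ∧ IsRelPrime (d.1 0) (d.1 1) := by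
  have h := d.2.1
  refine ⟨h.squarefree_of_dvd ⟨d.1 1, by ring⟩, h.squarefree_of_dvd ⟨d.1 0, by ring⟩, ?_⟩
  exact (squarefree_mul_iff.mp (squarefree_mul_iff.mp h).2.1).1

/-- As d₀ and d₁ are coprime, the gcd of d₀d₂ and d₁d₂ is |d₂|. Positivity of d₀d₁d₂ fixes the sign
of d₂, and the other entries follow. -/
theorem Triple.eq_of_mul_eq {d e : Triple} (h0 : d.1 0 * d.1 2 = e.1 0 * e.1 2)
    (h1 : d.1 1 * d.1 2 = e.1 1 * e.1 2) : d = e := by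
  have key : ∀ d : Triple, (Int.gcd (d.1 0 * d.1 2) (d.1 1 * d.1 2) : ℤ) = |d.1 2| := by
    intro d
    rw [Int.gcd_mul_right, Int.isCoprime_iff_gcd_eq_one.mp d.squarefree.2.2.isCoprime, one_mul,
      Int.natCast_natAbs]
  have habs : |d.1 2| = |e.1 2| := by rw [← key, ← key, h0, h1]
  have hd := d.2.2
  have he := e.2.2
  have hd2 : d.1 2 ≠ 0 := by intro h; simp [h] at hd
  have h2 : d.1 2 = e.1 2 := by
    rcases abs_eq_abs.mp habs with h | h
    · exact h
    · exfalso
      have h3 : (d.1 0 * d.1 1 * d.1 2) * d.1 2 = (e.1 0 * e.1 1 * e.1 2) * e.1 2 := by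
        linear_combination (d.1 1 * d.1 2) * h0 + (e.1 0 * e.1 2) * h1
      rw [h] at h3
      have h4 : e.1 2 ≠ 0 := by intro h; simp [h] at he
      have h5 : -(d.1 0 * d.1 1 * -e.1 2) = e.1 0 * e.1 1 * e.1 2 :=
        mul_right_cancel₀ h4 (by linear_combination h3)
      rw [h] at hd
      linarith
  have h3 : d.1 0 = e.1 0 := mul_right_cancel₀ hd2 (by rw [h0, h2])
  have h4 : d.1 1 = e.1 1 := mul_right_cancel₀ hd2 (by rw [h1, h2])
  refine Subtype.ext (funext fun i => ?_)
  fin_cases i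
  · exact h3
  · exact h4
  · exact h2

/-- The entries of a triple as units of `ℚ`. -/
noncomputable def Triple.ratUnit (d : Triple) (i : Fin 3) : ℚˣ := Units.mk0 (d.1 i : ℚ) (d.ne_zero i)

/-- Modulo squares (d₂, z₀/z₁) = (d₂, z₀/z₂) + (d₂, z₁/z₂), so d₂ multiplies both of the other
entries. -/
theorem symbolClass_eq (d : Triple) :
    symbolClass d = pairClass (d.ratUnit 0 * d.ratUnit 2) (d.ratUnit 1 * d.ratUnit 2) := by
  apply openRing_baseChange_injective
  have h : symbolClass d = quaternionClass isUnit_two_openRing (openConst (d.ratUnit 0)) (ratio ℚ 1 2) +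
    quaternionClass isUnit_two_openRing (openConst (d.ratUnit 1)) (ratio ℚ 0 2) +
    quaternionClass isUnit_two_openRing (openConst (d.ratUnit 2)) (ratio ℚ 0 1) := rfl
  rw [h, map_add, map_add, baseChange_symbol, baseChange_symbol, baseChange_symbol,
    baseChange_pairClass, map_mul, map_mul, symbol_mul_left, symbol_mul_left, coordUnit_two,
    symbol_one_right, symbol_one_right]
  abel

end Triples

/-! ### The quotient by constants as a quotient of k* × k*. -/

section Quotient

variable (k : Type u) [Field k] [CharZero k]

/-- The homomorphism sending `(x, y)` to the class `(x, z₁ / z₂) + (y, z₀ / z₂)` modulo constants. -/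
noncomputable def pairHom : Additive (kˣ × kˣ) →+
    campanaSubgroup k ⧸ (constantClasses k).addSubgroupOf (campanaSubgroup k) :=
  (QuotientAddGroup.mk' _).comp (AddMonoidHom.mk'
    (fun p => ⟨pairClass p.toMul.1 p.toMul.2, pairClass_mem _ _⟩)
    fun p q => Subtype.ext (pairClass_mul p.toMul.1 p.toMul.2 q.toMul.1 q.toMul.2))

variable {k}

theorem pairHom_surjective : Function.Surjective (pairHom k) := by
  intro β
  obtain ⟨β, rfl⟩ := QuotientAddGroup.mk_surjective β
  obtain ⟨x, y, h⟩ := exists_sub_pairClass_mem β.2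
  refine ⟨Additive.ofMul (x, y), ?_⟩
  rw [pairHom, AddMonoidHom.comp_apply, QuotientAddGroup.mk'_apply, QuotientAddGroup.eq]
  rw [AddSubgroup.mem_addSubgroupOf]
  change -pairClass x y + β ∈ _
  rwa [neg_add_eq_sub]

theorem mem_ker_pairHom {p : Additive (kˣ × kˣ)} :
    p ∈ (pairHom k).ker ↔ IsSquare p.toMul.1 ∧ IsSquare p.toMul.2 := by
  rw [AddMonoidHom.mem_ker, pairHom, AddMonoidHom.comp_apply, QuotientAddGroup.mk'_apply,
    QuotientAddGroup.eq_zero_iff, AddSubgroup.mem_addSubgroupOf]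
  exact pairClass_mem_constantClasses

end Quotient

/-! ### Bijectivity of the map on triples. -/

section TripleBijection

theorem symbolClass_mem (d : Triple) : symbolClass d ∈ campanaSubgroup ℚ :=
  symbolClass_eq d ▸ pairClass_mem _ _

theorem mk_symbolClass (d : Triple) :
    (QuotientAddGroup.mk ⟨symbolClass d, symbolClass_mem d⟩ :
      campanaSubgroup ℚ ⧸ (constantClasses ℚ).addSubgroupOf (campanaSubgroup ℚ)) =
    pairHom ℚ (Additive.ofMul (d.ratUnit 0 * d.ratUnit 2, d.ratUnit 1 * d.ratUnit 2)) := by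
  refine congrArg QuotientAddGroup.mk (Subtype.ext (symbolClass_eq d))

/-- Every square class of ℚ* contains exactly one squarefree integer, so triples, seen as pairs
(d₀d₂, d₁d₂), run once through the pairs of square classes. -/
theorem symbolClass_bijective : Function.Bijective (fun d : Triple =>
    (QuotientAddGroup.mk ⟨symbolClass d, symbolClass_mem d⟩ :
      campanaSubgroup ℚ ⧸ (constantClasses ℚ).addSubgroupOf (campanaSubgroup ℚ))) := by
  constructor
  · intro d e h
    simp only [mk_symbolClass] at h
    rw [← sub_eq_zero, ← map_sub, ← AddMonoidHom.mem_ker, mem_ker_pairHom] at h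
    have key : ∀ a b : ℤ, ∀ u v : ℚˣ, (u : ℚ) = a → (v : ℚ) = b → IsSquare (u / v) →
        IsSquare ((a : ℚ) * b) := by
      rintro a b u v hu hv ⟨w, hw⟩
      have h1 : u * v = (w * v) * (w * v) := by
        rw [div_eq_iff_eq_mul] at hw
        rw [hw, mul_mul_mul_comm w v w v, mul_assoc]
      exact ⟨((w * v : ℚˣ) : ℚ), by
        rw [← hu, ← hv, ← Units.val_mul, h1, Units.val_mul]⟩
    refine Triple.eq_of_mul_eq
      (eq_of_isSquare_mul d.squarefree.1 e.squarefree.1 (key _ _ _ _ ?_ ?_ h.1))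
      (eq_of_isSquare_mul d.squarefree.2.1 e.squarefree.2.1 (key _ _ _ _ ?_ ?_ h.2)) <;>
    simp [Triple.ratUnit]
  · intro β
    obtain ⟨p, rfl⟩ := pairHom_surjective β
    obtain ⟨a, ha, ha'⟩ := exists_squarefree_mul_isSquare p.toMul.1
    obtain ⟨b, hb, hb'⟩ := exists_squarefree_mul_isSquare p.toMul.2
    obtain ⟨d, hd0, hd1⟩ := exists_triple ha hb
    refine ⟨d, ?_⟩
    simp only [mk_symbolClass]
    rw [← sub_eq_zero, ← map_sub, ← AddMonoidHom.mem_ker, mem_ker_pairHom]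
    have key : ∀ a : ℤ, ∀ u v : ℚˣ, (u : ℚ) = a → IsSquare ((a : ℚ) * v) → IsSquare (u / v) := by
      rintro a u v hu ⟨w, hw⟩
      rw [← hu] at hw
      have hw0 : w ≠ 0 := by
        rintro rfl
        simp at hw
      have h1 : u * v = Units.mk0 w hw0 * Units.mk0 w hw0 := Units.ext hw
      refine ⟨Units.mk0 w hw0 / v, ?_⟩
      rw [div_mul_div_comm, ← h1, mul_div_mul_right_eq_div]
    exact ⟨key a _ _ (by rw [← hd0]; simp [Triple.ratUnit]) ha',
      key b _ _ (by rw [← hd1]; simp [Triple.ratUnit]) hb'⟩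

end TripleBijection

/-! ### First continuous cohomology with trivial coefficients as continuous homomorphisms. -/

section TrivialCohomology

open CategoryTheory TopRep ContRepresentation

variable {R : Type*} {G M : Type u} [Ring R] [TopologicalSpace R] [Group G] [TopologicalSpace G]
  [IsTopologicalGroup G] [AddCommGroup M] [Module R M] [TopologicalSpace M]
  [IsTopologicalAddGroup M] [ContinuousSMul R M]

/-- The invariants of `C(G, M)` are constant when the action on `M` is trivial. -/
theorem homogeneousCochains_d_zero_one :
    (homogeneousCochains (TopRep.of (ContRepresentation.trivial R G M))).d 0 1 = 0 := by
  rw [homogeneousCochains.d_eq]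
  refine ConcreteCategory.hom_ext _ _ fun f => Subtype.ext ?_
  refine ContinuousMap.ext fun g => ContinuousMap.ext fun h => ?_
  obtain ⟨f, hf⟩ := f
  have hf' (x : G) : (f : C(G, M)) x = (f : C(G, M)) 1 := by
    have := DFunLike.congr_fun (hf x) x
    exact this.symm.trans (congrArg (f : C(G, M)) (inv_mul_cancel x))
  change (f : C(G, M)) h - (f : C(G, M)) g = 0
  rw [hf' g, hf' h, sub_self]

variable (R G M) in
/-- Homogeneous continuous `1`-cocycles with trivial coefficients. -/
abbrev trivialCocycles : Submodule R
    ((homogeneousCochains (TopRep.of (ContRepresentation.trivial R G M))).X 1) :=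
  ((homogeneousCochains (TopRep.of (ContRepresentation.trivial R G M))).d 1 2).hom.ker

variable (R G M) in
/-- For trivial coefficients there are no nonzero `1`-coboundaries. -/
noncomputable def trivialCocyclesEquiv :
    trivialCocycles R G M ≃+
      continuousCohomology 1 (TopRep.of (ContRepresentation.trivial R G M)) :=
  let K := homogeneousCochains (TopRep.of (ContRepresentation.trivial R G M))
  let e : K.cycles 1 ≅ TopModuleCat.of R (K.d 1 2).hom.ker :=
    Limits.KernelFork.mapIsoOfIsLimit (K.cyclesIsKernel 1 2 (by simp))
      (TopModuleCat.isLimitKer _) (Iso.refl _)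
  (e.symm ≪≫ K.isoHomologyπ 0 1 (by simp)
    homogeneousCochains_d_zero_one).toContinuousLinearEquiv.toLinearEquiv.toAddEquiv

/-- A cochain as a function of two variables. -/
def cochainFun (σ : trivialCocycles R G M) : C(G, C(G, M)) := σ.1.1

theorem cochainFun_injective : Function.Injective (cochainFun (R := R) (G := G) (M := M)) :=
  fun _ _ h => Subtype.ext (Subtype.ext h)

theorem cochainFun_cocycle (σ : trivialCocycles R G M) (g h l : G) :
    cochainFun σ h l = cochainFun σ g l - cochainFun σ g h := by
  have h1 := (homogeneousCochains.d_apply _ 1 σ.1).symm.trans (congrArg Subtype.val σ.2)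
  exact sub_eq_zero.1 (DFunLike.congr_fun (DFunLike.congr_fun (DFunLike.congr_fun h1 g) h) l)

theorem cochainFun_invariant (σ : trivialCocycles R G M) (g h l : G) :
    cochainFun σ (g⁻¹ * h) (g⁻¹ * l) = cochainFun σ h l :=
  DFunLike.congr_fun (DFunLike.congr_fun (σ.1.2 g) h) l

/-- The continuous homomorphism underlying a cocycle. -/
def cocycleHom (σ : trivialCocycles R G M) : G →* Multiplicative M where
  toFun g := .ofAdd (cochainFun σ 1 g)
  map_one' := by
    have := cochainFun_cocycle σ 1 1 1
    rw [sub_self] at this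
    rw [this, ofAdd_zero]
  map_mul' g h := by
    have h1 := cochainFun_cocycle σ 1 g (g * h)
    -- Invariance under translation turns the value at (g, gh) into the value at (1, h), and the
    -- cocycle relation becomes additivity.
    have h2 := cochainFun_invariant σ g g (g * h)
    rw [inv_mul_cancel, inv_mul_cancel_left] at h2
    rw [← ofAdd_add, h2, h1, add_sub_cancel]

theorem continuous_cocycleHom (σ : trivialCocycles R G M) :
    Continuous fun g => (cocycleHom σ g).toAdd :=
  (cochainFun σ 1).continuous

/-- The cocycle relation with first argument 1 recovers f(g, l) as f(1, l) - f(1, g). -/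
theorem cocycleHom_injective : Function.Injective (cocycleHom (R := R) (G := G) (M := M)) := by
  intro σ τ h
  refine cochainFun_injective (ContinuousMap.ext fun g => ContinuousMap.ext fun l => ?_)
  have h' (x : G) : cochainFun σ 1 x = cochainFun τ 1 x := DFunLike.congr_fun h x
  rw [cochainFun_cocycle σ 1, cochainFun_cocycle τ 1, h', h']

theorem cocycleHom_add (σ τ : trivialCocycles R G M) :
    cocycleHom (σ + τ) = cocycleHom σ * cocycleHom τ := rfl

theorem exists_cocycleHom_eq (φ : G →* Multiplicative M) (hφ : Continuous fun g => (φ g).toAdd) :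
    ∃ σ : trivialCocycles R G M, cocycleHom σ = φ := by
  let F : C(G, C(G, M)) := ContinuousMap.curry
    ⟨fun p : G × G => (φ p.2).toAdd - (φ p.1).toAdd,
      (hφ.comp continuous_snd).sub (hφ.comp continuous_fst)⟩
  have hF (g h : G) : F g h = (φ h).toAdd - (φ g).toAdd := rfl
  have hinv : F ∈
      ((resolution' (TopRep.of (ContRepresentation.trivial R G M))).X 1).ρ.invariants := by
    intro g
    refine ContinuousMap.ext fun h => ContinuousMap.ext fun l => ?_
    change F (g⁻¹ * h) (g⁻¹ * l) = F h l
    simp only [hF, map_mul, toAdd_mul]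
    abel
  refine ⟨⟨⟨F, hinv⟩, ?_⟩, MonoidHom.ext fun g => ?_⟩
  · refine Subtype.ext ((homogeneousCochains.d_apply
      (TopRep.of (ContRepresentation.trivial R G M)) 1 ⟨F, hinv⟩).trans ?_)
    refine ContinuousMap.ext fun g => ContinuousMap.ext fun h => ContinuousMap.ext fun l => ?_
    change F h l - (F g l - F g h) = 0
    simp only [hF]
    abel
  · change Multiplicative.ofAdd (F 1 g) = φ g
    rw [hF, map_one, toAdd_one, sub_zero, ofAdd_toAdd]

end TrivialCohomology

/-! ### Pairs of quadratic characters and the comparison with cohomology. -/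

section KummerPair

variable {k : Type} [Field k] [CharZero k]

/-- The pair of quadratic characters attached to a pair of scalars. -/
noncomputable def kummerPair (p : kˣ × kˣ) : AbsGal k →* Multiplicative (ZMod 2 × ZMod 2) where
  toFun g := .ofAdd ((kummerChar p.1 g).toAdd, (kummerChar p.2 g).toAdd)
  map_one' := by simp only [map_one]; rfl
  map_mul' g h := by simp only [map_mul]; rfl

theorem kummerPair_mul (p q : kˣ × kˣ) : kummerPair (p * q) = kummerPair p * kummerPair q := by
  refine MonoidHom.ext fun g => ?_
  change Multiplicative.ofAdd ((kummerChar (p.1 * q.1) g).toAdd,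
    (kummerChar (p.2 * q.2) g).toAdd) = _
  rw [kummerChar_mul, kummerChar_mul]
  rfl

theorem continuous_of_isOpen_ker {G A : Type*} [Group G] [TopologicalSpace G]
    [IsTopologicalGroup G] [AddGroup A] [TopologicalSpace A] [DiscreteTopology A]
    (φ : G →* Multiplicative A) (hφ : IsOpen (φ.ker : Set G)) :
    Continuous fun g => (φ g).toAdd := by
  refine continuous_discrete_rng.2 fun a => isOpen_iff_mem_nhds.2 fun g hg => ?_
  have h1 : (g * ·) '' (φ.ker : Set G) ∈ nhds g :=
    ((Homeomorph.mulLeft g).isOpenMap _ hφ).mem_nhds ⟨1, one_mem _, mul_one g⟩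
  refine Filter.mem_of_superset h1 ?_
  rintro _ ⟨x, hx, rfl⟩
  have hx' : φ x = 1 := hx
  simpa [hx'] using hg

theorem continuous_kummerPair (p : kˣ × kˣ) : Continuous fun g => (kummerPair p g).toAdd :=
  (continuous_of_isOpen_ker _ (isOpen_ker_kummerChar p.1)).prodMk
    (continuous_of_isOpen_ker _ (isOpen_ker_kummerChar p.2))

theorem exists_kummerPair_eq (φ : AbsGal k →* Multiplicative (ZMod 2 × ZMod 2))
    (hφ : Continuous fun g => (φ g).toAdd) : ∃ p : kˣ × kˣ, kummerPair p = φ := by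
  have key (ψ : ZMod 2 × ZMod 2 →+ ZMod 2) :
      ∃ d : kˣ, kummerChar d = (AddMonoidHom.toMultiplicative ψ).comp φ := by
    refine exists_kummerChar_eq _ ?_
    have h : Continuous fun g => ψ (φ g).toAdd := continuous_of_discreteTopology.comp hφ
    exact (isOpen_discrete {(0 : ZMod 2)}).preimage h
  obtain ⟨d, hd⟩ := key (AddMonoidHom.fst _ _)
  obtain ⟨e, he⟩ := key (AddMonoidHom.snd _ _)
  refine ⟨(d, e), MonoidHom.ext fun g => ?_⟩
  change Multiplicative.ofAdd ((kummerChar d g).toAdd, (kummerChar e g).toAdd) = _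
  rw [hd, he]
  rfl

theorem kummerPair_eq_one {p : kˣ × kˣ} : kummerPair p = 1 ↔ IsSquare p.1 ∧ IsSquare p.2 := by
  have key (d : kˣ) : IsSquare d ↔ kummerChar d = 1 := by
    rw [kummerChar_eq_one]
    refine ⟨fun ⟨c, hc⟩ => ⟨c, by rw [hc, Units.val_mul]⟩, fun ⟨c, hc⟩ => ?_⟩
    have hc0 : c ≠ 0 := by rintro rfl; exact d.ne_zero (by rw [hc, mul_zero])
    exact ⟨Units.mk0 c hc0, Units.ext hc⟩
  rw [key, key]
  refine ⟨fun h => ⟨MonoidHom.ext fun g => ?_, MonoidHom.ext fun g => ?_⟩, fun h => ?_⟩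
  · exact congrArg (fun x => Multiplicative.ofAdd x.toAdd.1) (DFunLike.congr_fun h g)
  · exact congrArg (fun x => Multiplicative.ofAdd x.toAdd.2) (DFunLike.congr_fun h g)
  · refine MonoidHom.ext fun g => ?_
    change Multiplicative.ofAdd ((kummerChar p.1 g).toAdd, (kummerChar p.2 g).toAdd) = _
    rw [h.1, h.2]
    rfl

variable (k) in
/-- The Kummer map to the cocycles of `AbsGal k` with values in `ℤ/2 × ℤ/2`. -/
noncomputable def kummerCocycle :
    Additive (kˣ × kˣ) →+ trivialCocycles ℤ (AbsGal k) (ZMod 2 × ZMod 2) :=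
  AddMonoidHom.mk'
    (fun p => (exists_cocycleHom_eq (kummerPair p.toMul) (continuous_kummerPair _)).choose)
    fun p q => cocycleHom_injective <| by
      rw [cocycleHom_add, (exists_cocycleHom_eq _ (continuous_kummerPair _)).choose_spec,
        (exists_cocycleHom_eq _ (continuous_kummerPair _)).choose_spec,
        (exists_cocycleHom_eq _ (continuous_kummerPair _)).choose_spec,
        toMul_add, kummerPair_mul]

theorem cocycleHom_kummerCocycle (p : Additive (kˣ × kˣ)) :
    cocycleHom (kummerCocycle k p) = kummerPair p.toMul :=
  (exists_cocycleHom_eq (kummerPair p.toMul) (continuous_kummerPair _)).choose_spec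

theorem kummerCocycle_surjective : Function.Surjective (kummerCocycle k) := by
  intro σ
  obtain ⟨p, hp⟩ := exists_kummerPair_eq _ (continuous_cocycleHom σ)
  exact ⟨.ofMul p, cocycleHom_injective ((cocycleHom_kummerCocycle _).trans hp)⟩

theorem mem_ker_kummerCocycle {p : Additive (kˣ × kˣ)} :
    p ∈ (kummerCocycle k).ker ↔ IsSquare p.toMul.1 ∧ IsSquare p.toMul.2 := by
  rw [← kummerPair_eq_one, ← cocycleHom_kummerCocycle, AddMonoidHom.mem_ker]
  have h0 : cocycleHom (0 : trivialCocycles ℤ (AbsGal k) (ZMod 2 × ZMod 2)) = 1 := rfl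
  rw [← h0, cocycleHom_injective.eq_iff]

variable (k) in
/-- The Campana Brauer group modulo constants is the first Galois cohomology group of
`ℤ/2 × ℤ/2`. -/
noncomputable def campanaQuotientEquiv :
    campanaSubgroup k ⧸ (constantClasses k).addSubgroupOf (campanaSubgroup k) ≃+
      continuousCohomology 1
        (TopRep.of (ContRepresentation.trivial ℤ (AbsGal k) (ZMod 2 × ZMod 2))) :=
  -- Both groups are quotients of k* × k* by the subgroup of pairs of squares.
  (QuotientAddGroup.quotientKerEquivOfSurjective (pairHom k) pairHom_surjective).symm.trans <|
    (QuotientAddGroup.quotientAddEquivOfEq (AddSubgroup.ext fun _ =>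
      mem_ker_pairHom.trans mem_ker_kummerCocycle.symm)).trans <|
    (QuotientAddGroup.quotientKerEquivOfSurjective (kummerCocycle k)
      kummerCocycle_surjective).trans (trivialCocyclesEquiv ℤ (AbsGal k) (ZMod 2 × ZMod 2))

end KummerPair

end CampanaBrauer

theorem mainTheorem7 :
    ∃ B : AddSubgroup (CampanaBrauer.Br (CampanaBrauer.openRing ℚ)),
      (B : Set (CampanaBrauer.Br (CampanaBrauer.openRing ℚ))) = CampanaBrauer.campanaBrauer ℚ (fun _ => 2) ∧
      CampanaBrauer.constantClasses ℚ ≤ B ∧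
      (∃ h : ∀ d : CampanaBrauer.Triple, CampanaBrauer.symbolClass d ∈ B,
        Function.Bijective (fun d : CampanaBrauer.Triple =>
          (QuotientAddGroup.mk ⟨CampanaBrauer.symbolClass d, h d⟩ :
            B ⧸ (CampanaBrauer.constantClasses ℚ).addSubgroupOf B))) ∧
      Nonempty ((B ⧸ (CampanaBrauer.constantClasses ℚ).addSubgroupOf B) ≃+ CampanaBrauer.H1TwoTwo) :=
  ⟨CampanaBrauer.campanaSubgroup ℚ, CampanaBrauer.coe_campanaSubgroup,
    CampanaBrauer.constantClasses_le,
    ⟨CampanaBrauer.symbolClass_mem, CampanaBrauer.symbolClass_bijective⟩,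
    ⟨CampanaBrauer.campanaQuotientEquiv ℚ⟩⟩
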